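/- **Problems.** An instance of *connected min-sum-diameter (MSD)* consists of a finite vertex set $V$ with $n=|V|$, a distance $d:V\times V\to\mathbb{R}_{\ge 0}$ with $d(v,v)=0$ that is symmetric and satisfies the triangle inequality (i.e. a metric; distinct vertices at distance $0$ are allowed), an integer $k\ge 2$, and an undirected graph $G=(V,E)$. A feasible solution is a partition of $V$ into exactly $k$ nonempty clusters $P_1,\dots,P_k$ such that each $P_i$ induces a connected subgraph of $G$. Its cost is $\sum_{i=1}^{k}\max_{v,w\in P_i} d(v,w)$, which is to be minimized. In *regular MSD* there is no connectivity requirement: every partition of $V$ into exactly $k$ nonempty clusters is feasible. **Computation model.** Algorithms are finite programs of a random access machine with a memory for natural numbers and a memory for real numbers (both with computed indices), whose operations are addition, subtraction (truncated on natural numbers) and comparison, each at unit cost. The input is $n$, $k$, the distance matrix and the adjacency matrix of the connectivity graph. **Theorem.** For every $\varepsilon>0$ there are one such program $A$ and one polynomial $p$ such that $A$ halts on every instance after at most $p(n)$ steps, and 1. on every instance $(V,d,k,G)$ of connected MSD that has a feasible solution, $A$ outputs a feasible solution whose cost is at most $(4+\varepsilon)$ times the minimum cost of a feasible solution; 2.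 on every instance $(V,d,k)$ of regular MSD that has a feasible solution, $A$, given the complete graph on $V$ as connectivity graph, outputs a partition of $V$ into $k$ nonempty clusters whose cost is at most $(4+\varepsilon)$ times the minimum cost over all such partitions. -/

import Mathlib

/-! ## Connected and regular min-sum-diameter clustering -/

namespace Clustering

/-- A distance on `V`: zero on the diagonal, symmetric, with the triangle inequality (hence
nonnegative). Distinct points may have distance zero, so every metric is included. -/
structure IsDistance {V : Type} (d : V → V → ℝ) : Prop where
  self : ∀ v, d v v = 0
  symm : ∀ v w, d v w = d w v
  triangle : ∀ u v w, d u w ≤ d u v + d v w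

/-- The `i`-th cluster of the assignment `c` of the points of `V` to `k` clusters. -/
def cluster {V : Type} {k : ℕ} (c : V → Fin k) (i : Fin k) : Set V := {v | c v = i}

/-- `c` is a partition of `V` into exactly `k` nonempty clusters. -/
def Feasible {V : Type} {k : ℕ} (c : V → Fin k) : Prop :=
  ∀ i, (cluster c i).Nonempty

/-- `c` is a partition of `V` into exactly `k` clusters, each of which induces a connected
(in particular nonempty) subgraph of `G`. -/
def ConnectedFeasible {V : Type} {k : ℕ} (G : SimpleGraph V) (c : V → Fin k) : Prop :=
  ∀ i, (G.induce (cluster c i)).Connected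

/-- The diameter of a set `S` of points, `max_{v, w ∈ S} d v w` (for finite nonempty `S`). -/
noncomputable def diam {V : Type} (d : V → V → ℝ) (S : Set V) : ℝ :=
  ⨆ p : S × S, d p.1 p.2

/-- The min-sum-diameter objective: the sum of the diameters of the clusters. -/
noncomputable def msdCost {V : Type} {k : ℕ} (d : V → V → ℝ) (c : V → Fin k) : ℝ :=
  ∑ i, diam d (cluster c i)

/-- `c` satisfies the constraint `feas` and its cost is at most `ρ` times the cost of every
assignment that does, i.e. at most `ρ` times the optimum. -/
def IsApprox {V : Type} {k : ℕ} (feas : (V → Fin k) → Prop) (d : V → V → ℝ) (ρ : ℝ)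
    (c : V → Fin k) : Prop :=
  feas c ∧ ∀ c', feas c' → msdCost d c ≤ ρ * msdCost d c'

end Clustering

/-! ## Machine model

A random access machine with a memory for natural numbers and a memory for real numbers, running
structured programs. Both memories consist of arrays with two indices; a program names finitely
many arrays and may compute the indices. The only operations are addition, (truncated) subtraction
and comparison, so that the unit cost measure is polynomially related to the running time of a
Turing machine whenever the real inputs are rational. -/

namespace RAM

/-- The memory: `nat a i j` is the cell `(i, j)` of the array `a` of natural numbers, `real a i j`
the cell `(i, j)` of the array `a` of real numbers. -/
structure Store where
  nat : ℕ → ℕ → ℕ → ℕ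
  real : ℕ → ℕ → ℕ → ℝ

/-- Expressions for natural numbers: constants, the contents of a cell, `+`, truncated `-`. -/
inductive NExp : Type
  | const (m : ℕ)
  | cell (a : ℕ) (i j : NExp)
  | add (e f : NExp)
  | sub (e f : NExp)

namespace NExp

def eval (s : Store) : NExp → ℕ
  | const m => m
  | cell a i j => s.nat a (i.eval s) (j.eval s)
  | add e f => e.eval s + f.eval s
  | sub e f => e.eval s - f.eval s

/-- Number of operations in the evaluation of an expression. -/
def cost : NExp → ℕ
  | const _ => 1
  | cell _ i j => i.cost + j.cost + 1
  | add e f => e.cost + f.cost + 1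
  | sub e f => e.cost + f.cost + 1

end NExp

/-- Expressions for real numbers: zero, the contents of a cell, `+`, `-`. -/
inductive RExp : Type
  | zero
  | cell (a : ℕ) (i j : NExp)
  | add (x y : RExp)
  | sub (x y : RExp)

namespace RExp

noncomputable def eval (s : Store) : RExp → ℝ
  | zero => 0
  | cell a i j => s.real a (i.eval s) (j.eval s)
  | add x y => x.eval s + y.eval s
  | sub x y => x.eval s - y.eval s

def cost : RExp → ℕ
  | zero => 1
  | cell _ i j => i.cost + j.cost + 1
  | add x y => x.cost + y.cost + 1
  | sub x y => x.cost + y.cost + 1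

end RExp

/-- Tests: comparisons of natural or of real numbers, and their Boolean combinations. -/
inductive Test : Type
  | natLe (e f : NExp)
  | realLe (x y : RExp)
  | not (b : Test)
  | and (b c : Test)

namespace Test

def Holds (s : Store) : Test → Prop
  | natLe e f => e.eval s ≤ f.eval s
  | realLe x y => x.eval s ≤ y.eval s
  | not b => ¬ b.Holds s
  | and b c => b.Holds s ∧ c.Holds s

def cost : Test → ℕ
  | natLe e f => e.cost + f.cost + 1
  | realLe x y => x.cost + y.cost + 1
  | not b => b.cost + 1
  | and b c => b.cost + c.cost + 1

end Test

/-- Programs. `setNat a i j e` writes the value of `e` into the cell `(i, j)` of the array `a` of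
natural numbers; `setReal` does the same for real numbers. -/
inductive Program : Type
  | skip
  | setNat (a : ℕ) (i j e : NExp)
  | setReal (a : ℕ) (i j : NExp) (x : RExp)
  | seq (P Q : Program)
  | ite (b : Test) (P Q : Program)
  | loop (b : Test) (P : Program)

/-- The store after writing `m` into the cell `(i, j)` of the array `a` of natural numbers. -/
def Store.updateNat (s : Store) (a i j m : ℕ) : Store where
  nat a' i' j' := if a' = a ∧ i' = i ∧ j' = j then m else s.nat a' i' j'
  real := s.real

/-- The store after writing `x` into the cell `(i, j)` of the array `a` of real numbers. -/
noncomputable def Store.updateReal (s : Store) (a i j : ℕ) (x : ℝ) : Store where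
  nat := s.nat
  real a' i' j' := if a' = a ∧ i' = i ∧ j' = j then x else s.real a' i' j'

/-- `Exec P s s' t`: the program `P`, started in the store `s`, halts in the store `s'` after
exactly `t` steps. `loop b P` repeats `P` while `b` holds. -/
inductive Exec : Program → Store → Store → ℕ → Prop
  | skip (s : Store) : Exec .skip s s 1
  | setNat (a : ℕ) (i j e : NExp) (s : Store) :
      Exec (.setNat a i j e) s (s.updateNat a (i.eval s) (j.eval s) (e.eval s))
        (i.cost + j.cost + e.cost + 1)
  | setReal (a : ℕ) (i j : NExp) (x : RExp) (s : Store) :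
      Exec (.setReal a i j x) s (s.updateReal a (i.eval s) (j.eval s) (x.eval s))
        (i.cost + j.cost + x.cost + 1)
  | seq {P Q : Program} {s s' s'' : Store} {t t' : ℕ} :
      Exec P s s' t → Exec Q s' s'' t' → Exec (.seq P Q) s s'' (t + t')
  | iteTrue {b : Test} {P Q : Program} {s s' : Store} {t : ℕ} :
      b.Holds s → Exec P s s' t → Exec (.ite b P Q) s s' (b.cost + 1 + t)
  | iteFalse {b : Test} {P Q : Program} {s s' : Store} {t : ℕ} :
      ¬ b.Holds s → Exec Q s s' t → Exec (.ite b P Q) s s' (b.cost + 1 + t)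
  | loopStop {b : Test} {P : Program} {s : Store} :
      ¬ b.Holds s → Exec (.loop b P) s s (b.cost + 1)
  | loopStep {b : Test} {P : Program} {s s' s'' : Store} {t t' : ℕ} :
      b.Holds s → Exec P s s' t → Exec (.loop b P) s' s'' t' →
        Exec (.loop b P) s s'' (b.cost + 1 + t + t')

/-- Execution is deterministic. -/
theorem Exec.unique {P : Program} {s s₁ s₂ : Store} {t₁ t₂ : ℕ} (h₁ : Exec P s s₁ t₁)
    (h₂ : Exec P s s₂ t₂) : s₁ = s₂ ∧ t₁ = t₂ := by
  induction h₁ generalizing s₂ t₂ with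
  | skip | setNat | setReal => cases h₂; exact ⟨rfl, rfl⟩
  | seq _ _ ih ih' =>
    cases h₂ with
    | seq g g' =>
      obtain ⟨rfl, rfl⟩ := ih g
      obtain ⟨rfl, rfl⟩ := ih' g'
      exact ⟨rfl, rfl⟩
  | iteTrue hb _ ih =>
    cases h₂ with
    | iteTrue _ g => obtain ⟨rfl, rfl⟩ := ih g; exact ⟨rfl, rfl⟩
    | iteFalse hn _ => exact absurd hb hn
  | iteFalse hb _ ih =>
    cases h₂ with
    | iteTrue hn _ => exact absurd hn hb
    | iteFalse _ g => obtain ⟨rfl, rfl⟩ := ih g; exact ⟨rfl, rfl⟩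
  | loopStop hb =>
    cases h₂ with
    | loopStop _ => exact ⟨rfl, rfl⟩
    | loopStep hn _ _ => exact absurd hn hb
  | loopStep hb _ _ ih ih' =>
    cases h₂ with
    | loopStop hn => exact absurd hb hn
    | loopStep _ g g' =>
      obtain ⟨rfl, rfl⟩ := ih g
      obtain ⟨rfl, rfl⟩ := ih' g'
      exact ⟨rfl, rfl⟩

open Classical in
/-- The store that holds the input: `n` and `k` in the cells `(0, 0)` and `(0, 1)` of the natural
array `0`, the adjacency matrix of `G` in the natural array `1`, and the distances in the real
array `0`. All other cells are zero. -/
noncomputable def input (n k : ℕ) (d : Fin n → Fin n → ℝ) (G : SimpleGraph (Fin n)) : Store where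
  nat a i j :=
    if a = 0 ∧ i = 0 ∧ j = 0 then n
    else if a = 0 ∧ i = 0 ∧ j = 1 then k
    else if a = 1 ∧ ∃ (hi : i < n) (hj : j < n), G.Adj ⟨i, hi⟩ ⟨j, hj⟩ then 1
    else 0
  real a i j :=
    if h : a = 0 ∧ i < n ∧ j < n then d ⟨i, h.2.1⟩ ⟨j, h.2.2⟩ else 0

/-- The store `s` holds the assignment `c` as output: the index of the cluster of the vertex `v` is
in the cell `(v, 0)` of the natural array `2`. -/
def IsOutput {n k : ℕ} (s : Store) (c : Fin n → Fin k) : Prop :=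
  ∀ v : Fin n, s.nat 2 v 0 = (c v : ℕ)

end RAM

/-! A cluster with diametral pair `(a, b)` is connected and within distance `d a b` of `a`, so it
lies in the connected ball `connBall d G (a, b)`, of radius equal to the diameter of the cluster. A
feasible solution thus gives a cover by `k` connected balls whose radii sum to its cost. The
algorithm is a primal-dual scheme for this covering problem: points have dual values `y`, the number
of balls has a multiplier `l`, and the constraint of a ball of radius `r` is `∑ y ≤ n * r + l`.

Tight balls are merged into classes of the relation "joined by a chain of intersecting balls". On a
shortest chain, balls that are not consecutive are disjoint. Twice the sum of the radii on the chain
bounds the distance of its ends, and the heavier of the two parities is a disjoint family with at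
least half of this sum. Hence a class has diameter at most four times the radii of disjoint tight
balls (`Linked.exists_disjoint`). Guessed balls are left out of the parity argument and are charged
twice their radius. Weak duality (`IsSlack.sum_le`, `IsSlack.le_sum`) compares the disjoint balls
with the balls of the solution. With at least `k` classes there are enough disjoint balls for the
multiplier terms to cancel (`card_roots_le`, `IsLabelling.exists_diamBound`).

A constant number `m + 1` of balls is guessed, meant for the largest clusters, and `R` is the
smallest of their radii. All other balls in use have radius at most `R`. The multiplier grows by `R`
in each of `n * n` stages, after which the dual values are raised greedily. In the beginning the
labelling is good enough already or has more than `k` classes. In the end more than `k` classes are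
impossible (`IsLabelling.multiplier_le`, `GoodGuess.achieved`). So in some stage the number of
classes drops to at most `k`. The new tight balls of a stage are added one by one. Just before the
drop the dual bound holds up to `4 * R`, and the ball that causes the drop adds at most `2 * R`
(`IsDiamBound.merge`). Since `(m + 1) * R` is at most the cost of the solution, a large `m` makes `6
* R` at most `ε` times this cost (`exists_goodGuess`).

Fewer than `k` classes do no harm: exactly `k` connected clusters arise by growing the classes from
their roots and stopping early (`den_join`). All labellings on the way are evaluated and the
cheapest result is kept, so wrong guesses are harmless. The program is written with loops of length
`n` only, for which termination in polynomial time is automatic (`exec_toProgram`), and its effect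
is a function `Stmt.den` on stores. -/

set_option linter.unusedSectionVars false

/-! ### Structured programs with bounded loops: semantics, running time and loop rules. -/

namespace RAM

/-- Programs whose only loops are `for` loops over the numbers below the content `n` of the cell
`(0, 0)` of the natural array `0`; the loop variable is the cell `(0, 0)` of its own array. -/
inductive Stmt : Type
  | setNat (a : ℕ) (i j e : NExp)
  | setReal (a : ℕ) (i j : NExp) (x : RExp)
  | seq (P Q : Stmt)
  | ifThen (b : Test) (P : Stmt)
  | forN (v : ℕ) (P : Stmt)

/-- The content of the cell `(0, 0)` of the array `a`. -/
abbrev NExp.var (a : ℕ) : NExp := .cell a (.const 0) (.const 0)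

/-- The content of the cell `(0, 0)` of the real array `a`. -/
abbrev RExp.var (a : ℕ) : RExp := .cell a (.const 0) (.const 0)

/-- `f` iterated `i` times, where the variable `v` is set to the number of the iteration first. -/
def iterVar (f : Store → Store) (v : ℕ) (s : Store) : ℕ → Store
  | 0 => s
  | i + 1 => f ((iterVar f v s i).updateNat v 0 0 i)

namespace Stmt

/-- The store in which a statement halts. -/
noncomputable def den : Stmt → Store → Store
  | setNat a i j e, s => s.updateNat a (i.eval s) (j.eval s) (e.eval s)
  | setReal a i j x, s => s.updateReal a (i.eval s) (j.eval s) (x.eval s)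
  | seq P Q, s => Q.den (P.den s)
  | ifThen b P, s => open Classical in if b.Holds s then P.den s else s
  | forN v P, s => (iterVar P.den v s (s.nat 0 0 0)).updateNat v 0 0 (s.nat 0 0 0)

/-- The natural arrays that a statement may change. -/
def natWrites : Stmt → List ℕ
  | setNat a _ _ _ => [a]
  | setReal _ _ _ _ => []
  | seq P Q => P.natWrites ++ Q.natWrites
  | ifThen _ P => P.natWrites
  | forN v P => v :: P.natWrites

/-- The real arrays that a statement may change. -/
def realWrites : Stmt → List ℕ
  | setNat _ _ _ _ => []
  | setReal a _ _ _ => [a]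
  | seq P Q => P.realWrites ++ Q.realWrites
  | ifThen _ P => P.realWrites
  | forN _ P => P.realWrites

/-- No loop changes its own variable, and nothing changes the array `0`. -/
def WellFormed : Stmt → Prop
  | setNat a _ _ _ => a ≠ 0
  | setReal _ _ _ _ => True
  | seq P Q => P.WellFormed ∧ Q.WellFormed
  | ifThen _ P => P.WellFormed
  | forN v P => v ≠ 0 ∧ v ∉ P.natWrites ∧ P.WellFormed

/-- The program that a statement stands for. -/
def toProgram : Stmt → Program
  | setNat a i j e => .setNat a i j e
  | setReal a i j x => .setReal a i j x
  | seq P Q => .seq P.toProgram Q.toProgram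
  | ifThen b P => .ite b P.toProgram .skip
  | forN v P => .seq (.setNat v (.const 0) (.const 0) (.const 0))
      (.loop (.not (.natLe (.var 0) (.var v)))
        (.seq P.toProgram
          (.setNat v (.const 0) (.const 0) (.add (.var v) (.const 1)))))

open Polynomial in
/-- A bound on the running time of a statement in terms of `n`. -/
noncomputable def time : Stmt → Polynomial ℕ
  | setNat _ i j e => C (i.cost + j.cost + e.cost + 1)
  | setReal _ i j x => C (i.cost + j.cost + x.cost + 1)
  | seq P Q => P.time + Q.time
  | ifThen b P => C (b.cost + 2) + P.time
  | forN _ P => C 20 + X * (P.time + C 20)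

end Stmt

@[simp] theorem Store.updateNat_real (s : Store) (a i j m : ℕ) :
    (s.updateNat a i j m).real = s.real := rfl

@[simp] theorem Store.updateReal_nat (s : Store) (a i j : ℕ) (x : ℝ) :
    (s.updateReal a i j x).nat = s.nat := rfl

theorem Store.updateNat_nat_of_ne (s : Store) {a b : ℕ} (h : b ≠ a) (i j m : ℕ) :
    (s.updateNat a i j m).nat b = s.nat b := by
  funext x y; simp [Store.updateNat, h]

theorem Store.updateReal_real_of_ne (s : Store) {a b : ℕ} (h : b ≠ a) (i j : ℕ) (x : ℝ) :
    (s.updateReal a i j x).real b = s.real b := by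
  funext x y; simp [Store.updateReal, h]

theorem Store.updateNat_nat_self (s : Store) (a i j m i' j' : ℕ) :
    (s.updateNat a i j m).nat a i' j' = if i' = i ∧ j' = j then m else s.nat a i' j' := by
  simp [Store.updateNat]

theorem Store.updateReal_real_self (s : Store) (a i j : ℕ) (x : ℝ) (i' j' : ℕ) :
    (s.updateReal a i j x).real a i' j' = if i' = i ∧ j' = j then x else s.real a i' j' := by
  simp [Store.updateReal]

namespace Stmt

open Classical in
theorem den_ifThen (b : Test) (P : Stmt) (s : Store) :
    (ifThen b P).den s = if b.Holds s then P.den s else s := rfl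

/-- The frame rule. For concrete statements the list of written arrays is computed, so the side
conditions below are mostly settled by `decide`. -/
theorem den_nat_of_notMem {P : Stmt} {a : ℕ} (h : a ∉ P.natWrites) (s : Store) :
    (P.den s).nat a = s.nat a := by
  induction P generalizing s with
  | setNat b i j e =>
    simp only [natWrites, List.mem_singleton] at h
    exact s.updateNat_nat_of_ne h _ _ _
  | setReal => rfl
  | seq P Q ihP ihQ =>
    simp only [natWrites, List.mem_append, not_or] at h
    rw [den, ihQ h.2, ihP h.1]
  | ifThen b P ih =>
    simp only [den]
    split_ifs
    · exact ih h s
    · rfl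
  | forN v P ih =>
    simp only [natWrites, List.mem_cons, not_or] at h
    rw [den, Store.updateNat_nat_of_ne _ h.1]
    generalize s.nat 0 0 0 = n
    induction n with
    | zero => rfl
    | succ i IH => rw [iterVar, ih h.2, Store.updateNat_nat_of_ne _ h.1, IH]

theorem den_real_of_notMem {P : Stmt} {a : ℕ} (h : a ∉ P.realWrites) (s : Store) :
    (P.den s).real a = s.real a := by
  induction P generalizing s with
  | setNat => rfl
  | setReal b i j e =>
    simp only [realWrites, List.mem_singleton] at h
    exact s.updateReal_real_of_ne h _ _ _
  | seq P Q ihP ihQ =>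
    simp only [realWrites, List.mem_append, not_or] at h
    rw [den, ihQ h.2, ihP h.1]
  | ifThen b P ih =>
    simp only [den]
    split_ifs
    · exact ih h s
    · rfl
  | forN v P ih =>
    rw [den, Store.updateNat_real]
    generalize s.nat 0 0 0 = n
    induction n with
    | zero => rfl
    | succ i IH => rw [iterVar, ih h, Store.updateNat_real, IH]

theorem WellFormed.zero_notMem {P : Stmt} (h : P.WellFormed) : 0 ∉ P.natWrites := by
  induction P with
  | setNat => simpa [natWrites] using h.symm
  | setReal => simp [natWrites]
  | seq P Q ihP ihQ => simp [natWrites, ihP h.1, ihQ h.2]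
  | ifThen b P ih => exact ih h
  | forN v P ih => simpa [natWrites, ih h.2.2] using h.1.symm

/-- Every statement halts, in a number of steps that is polynomial in `n`. -/
theorem exec_toProgram {P : Stmt} (hP : P.WellFormed) (s : Store) :
    ∃ t, Exec P.toProgram s (P.den s) t ∧ t ≤ P.time.eval (s.nat 0 0 0) := by
  induction P generalizing s with
  | setNat a i j e => exact ⟨_, .setNat a i j e s, by simp [time]⟩
  | setReal a i j x => exact ⟨_, .setReal a i j x s, by simp [time]⟩
  | seq P Q ihP ihQ =>
    obtain ⟨t, ht, hle⟩ := ihP hP.1 s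
    obtain ⟨t', ht', hle'⟩ := ihQ hP.2 (P.den s)
    rw [den_nat_of_notMem hP.1.zero_notMem] at hle'
    exact ⟨_, .seq ht ht', by simp only [time, Polynomial.eval_add]; lia⟩
  | ifThen b P ih =>
    by_cases hb : b.Holds s
    · obtain ⟨t, ht, hle⟩ := ih hP s
      refine ⟨b.cost + 1 + t, ?_, ?_⟩
      · simp only [den, if_pos hb]
        exact .iteTrue hb ht
      · simp only [time, Polynomial.eval_add, Polynomial.eval_C]; lia
    · refine ⟨b.cost + 1 + 1, ?_, ?_⟩
      · simp only [den, if_neg hb]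
        exact .iteFalse hb (.skip s)
      · simp only [time, Polynomial.eval_add, Polynomial.eval_C]; lia
  | forN v P ih =>
    obtain ⟨h0, hv, hP⟩ := hP
    set n := s.nat 0 0 0 with hn
    have hz (i : ℕ) : (iterVar P.den v s i).nat 0 = s.nat 0 := by
      induction i with
      | zero => rfl
      | succ i IH =>
        rw [iterVar, den_nat_of_notMem hP.zero_notMem, Store.updateNat_nat_of_ne _ h0.symm, IH]
    -- Induction on the number `j` of rounds that remain. The last, failing test takes 9 steps; a
    -- round spends 17 steps on its test and on the increment, which 20 covers.
    have key (j : ℕ) : ∀ i, i + j = n → ∃ t,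
        Exec (.loop (.not (.natLe (.var 0) (.var v)))
          (.seq P.toProgram (.setNat v (.const 0) (.const 0) (.add (.var v) (.const 1)))))
          ((iterVar P.den v s i).updateNat v 0 0 i) ((iterVar P.den v s n).updateNat v 0 0 n) t ∧
          t ≤ 9 + j * (P.time.eval n + 20) := by
      induction j with
      | zero =>
        rintro i rfl
        refine ⟨_, .loopStop ?_, ?_⟩
        · simp [Test.Holds, NExp.eval, Store.updateNat_nat_self,
            Store.updateNat_nat_of_ne _ h0.symm, hz, ← hn]
        · simp [Test.cost, NExp.cost]
      | succ j IH =>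
        intro i hi
        obtain ⟨t, ht, hle⟩ := IH (i + 1) (by lia)
        obtain ⟨t', ht', hle'⟩ := ih hP ((iterVar P.den v s i).updateNat v 0 0 i)
        have e0 : ((iterVar P.den v s i).updateNat v 0 0 i).nat 0 0 0 = n := by
          rw [Store.updateNat_nat_of_ne _ h0.symm, hz]
        rw [e0] at hle'
        have hs := Exec.setNat v (.const 0) (.const 0) (.add (.var v) (.const 1))
          (iterVar P.den v s (i + 1))
        have e1 : (iterVar P.den v s (i + 1)).nat v 0 0 = i := by
          rw [iterVar, den_nat_of_notMem hv, Store.updateNat_nat_self]; simp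
        simp only [NExp.eval, e1] at hs
        refine ⟨_, .loopStep ?_ (.seq ht' hs) ht, ?_⟩
        · simp only [Test.Holds, NExp.eval, e0, Store.updateNat_nat_self]
          simp; lia
        · simp only [Test.cost, NExp.cost]
          linarith
    obtain ⟨t, ht, hle⟩ := key n 0 (by simp)
    refine ⟨_, .seq (.setNat _ _ _ _ s) ht, ?_⟩
    simp only [time, NExp.cost, Polynomial.eval_add, Polynomial.eval_mul, Polynomial.eval_X,
      Polynomial.eval_C, hn] at hle ⊢
    linarith

/-- The rule for `for` loops. The invariant refers to the set of the values of the loop variable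
that have been processed. -/
theorem den_forN {n : ℕ} (I : Finset (Fin n) → Store → Prop) {v : ℕ} {P : Stmt}
    (hI : ∀ S s m, I S s → I S (s.updateNat v 0 0 m))
    (step : ∀ S (x : Fin n) s, x ∉ S → s.nat v 0 0 = (x : ℕ) → I S s → I (insert x S) (P.den s))
    {s : Store} (hn : s.nat 0 0 0 = n) (h : I ∅ s) : I Finset.univ ((forN v P).den s) := by
  rw [den, hn]
  refine hI _ _ _ ?_
  have key (i : ℕ) (hi : i ≤ n) :
      I (Finset.univ.filter fun x : Fin n => (x : ℕ) < i) (iterVar P.den v s i) := by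
    induction i with
    | zero => simpa [iterVar] using h
    | succ i IH =>
      have := step (Finset.univ.filter fun x : Fin n => (x : ℕ) < i) ⟨i, hi⟩
        ((iterVar P.den v s i).updateNat v 0 0 i) (by simp) (by simp [Store.updateNat_nat_self])
        (hI _ _ _ (IH (by lia)))
      have e : (Finset.univ.filter fun x : Fin n => (x : ℕ) < i + 1) =
          insert ⟨i, hi⟩ (Finset.univ.filter fun x : Fin n => (x : ℕ) < i) := by
        ext x
        simp [Fin.ext_iff]; lia
      rw [e]
      exact this
  have := key n le_rfl
  rwa [Finset.filter_true_of_mem (fun x _ => x.2)] at this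

/-- The rule for `for` loops, for a statement `Q` that unfolds to a loop. -/
theorem den_eq_forN (Q : Stmt) {n v : ℕ} {P : Stmt} (hQ : Q = forN v P)
    (I : Finset (Fin n) → Store → Prop)
    (hI : ∀ S s m, I S s → I S (s.updateNat v 0 0 m))
    (step : ∀ S (x : Fin n) s, x ∉ S → s.nat v 0 0 = (x : ℕ) → I S s → I (insert x S) (P.den s))
    {s : Store} (hn : s.nat 0 0 0 = n) (h : I ∅ s) : I Finset.univ (Q.den s) :=
  hQ ▸ den_forN I hI step hn h

/-- The rule for two nested `for` loops, for a statement `Q` that unfolds to them. -/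
theorem den_eq_forN₂ (Q : Stmt) {n v w : ℕ} {P : Stmt} (hQ : Q = forN v (forN w P))
    (hvw : v ≠ w) (hv : v ∉ P.natWrites) (I : Finset (Fin n × Fin n) → Store → Prop)
    (hI : ∀ S s u m, u = v ∨ u = w → I S s → I S (s.updateNat u 0 0 m))
    (hn : ∀ S s, I S s → s.nat 0 0 0 = n)
    (step : ∀ S (x y : Fin n) s, (x, y) ∉ S → s.nat v 0 0 = (x : ℕ) →
      s.nat w 0 0 = (y : ℕ) → I S s → I (insert (x, y) S) (P.den s))
    {s : Store} (h : I ∅ s) : I Finset.univ (Q.den s) := by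
  subst hQ
  rw [← Finset.univ_product_univ]
  refine den_forN (n := n) (fun S s => I (S ×ˢ Finset.univ) s)
    (fun S s m h => hI _ _ _ _ (.inl rfl) h) ?_ (hn _ _ h) (by simpa using h)
  rintro S x s hxS hx h
  have := den_forN (n := n) (v := w) (P := P)
    (fun T s => s.nat v 0 0 = (x : ℕ) ∧ I (S ×ˢ Finset.univ ∪ {x} ×ˢ T) s)
    (fun T s m h => ⟨by rw [Store.updateNat_nat_of_ne _ hvw]; exact h.1,
      hI _ _ _ _ (.inr rfl) h.2⟩) ?_ (hn _ _ h) ⟨hx, by simpa using h⟩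
  · have e : S ×ˢ Finset.univ ∪ {x} ×ˢ Finset.univ =
        insert x S ×ˢ (Finset.univ : Finset (Fin n)) := by
      ext ⟨a, b⟩; simp [or_comm, eq_comm]
    exact e ▸ this.2
  · rintro T y s hyT hy ⟨hx, h⟩
    have e : S ×ˢ Finset.univ ∪ {x} ×ˢ insert y T =
        insert (x, y) (S ×ˢ (Finset.univ : Finset (Fin n)) ∪ {x} ×ˢ T) := by
      ext ⟨a, b⟩
      simp only [Finset.mem_union, Finset.mem_product, Finset.mem_univ, and_true,
        Finset.mem_singleton, Finset.mem_insert, Prod.mk.injEq]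
      tauto
    rw [den_nat_of_notMem hv, e]
    exact ⟨hx, step _ x y s (by simp [hxS, hyT]) hx hy h⟩

/-- If one round of `P` over all pairs `(x, y)` adds `y` to the set `U` whenever `x ∈ U` and
`R x y`, unless `U` has at least `K` elements, then `U` is closed under `R` after `n` rounds. -/
theorem den_saturate {n : ℕ} (Inv : Finset (Fin n) → Store → Prop) (R : Fin n → Fin n → Prop)
    (K : ℕ) {a b c : ℕ} {P : Stmt}
    (hI : ∀ U s v m, v = a ∨ v = b ∨ v = c → Inv U s → Inv U (s.updateNat v 0 0 m))
    (hn : ∀ U s, Inv U s → s.nat 0 0 0 = n) (hbc : b ≠ c) (hw : b ∉ P.natWrites)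
    (step : ∀ U (x y : Fin n) s, s.nat b 0 0 = (x : ℕ) → s.nat c 0 0 = (y : ℕ) → Inv U s →
      ∃ U', Inv U' (P.den s) ∧ (U' = U ∨ x ∈ U ∧ R x y ∧ U' = insert y U) ∧
        (x ∈ U → R x y → y ∈ U' ∨ K ≤ U'.card))
    {U₀ : Finset (Fin n)} {s : Store} (h : Inv U₀ s) :
    ∃ U, Inv U ((forN a (forN b (forN c P))).den s) ∧ U₀ ⊆ U ∧
      (K ≤ U.card ∨ ∀ x ∈ U, ∀ y, R x y → y ∈ U) := by
  -- One pass over all pairs. Either the set was closed, and then it does not change, or some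
  -- missing point is added unless the bound `K` has been reached.
  have round (U₀ : Finset (Fin n)) (s : Store) (h : Inv U₀ s) :
      ∃ U, Inv U ((forN b (forN c P)).den s) ∧ U₀ ⊆ U ∧
        ((∀ x ∈ U₀, ∀ y, R x y → y ∈ U₀) → U = U₀) ∧
        ∀ x, ∀ y, x ∈ U₀ → R x y → y ∈ U ∨ K ≤ U.card := by
    have := den_forN (n := n) (fun S s => ∃ U, Inv U s ∧ U₀ ⊆ U ∧
        ((∀ x ∈ U₀, ∀ y, R x y → y ∈ U₀) → U = U₀) ∧
        ∀ x ∈ S, ∀ y, x ∈ U₀ → R x y → y ∈ U ∨ K ≤ U.card) (v := b) (P := forN c P)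
      (fun S s m ⟨U, hU, h⟩ => ⟨U, hI _ _ _ _ (by simp) hU, h⟩) ?_ (hn _ _ h)
      ⟨U₀, h, subset_rfl, fun _ => rfl, by simp⟩
    · simpa using this
    · rintro S x s - hx ⟨U, hU, h⟩
      have := den_forN (n := n) (fun S' s => s.nat b 0 0 = (x : ℕ) ∧ ∃ U, Inv U s ∧ U₀ ⊆ U ∧
        ((∀ x ∈ U₀, ∀ y, R x y → y ∈ U₀) → U = U₀) ∧
        (∀ x ∈ S, ∀ y, x ∈ U₀ → R x y → y ∈ U ∨ K ≤ U.card) ∧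
        ∀ y ∈ S', x ∈ U₀ → R x y → y ∈ U ∨ K ≤ U.card) (v := c) (P := P)
        (fun S s m ⟨hx, U, hU, h⟩ => ⟨by rwa [Store.updateNat_nat_of_ne _ hbc], U,
          hI _ _ _ _ (by simp) hU, h⟩) ?_ (hn _ _ hU)
        ⟨hx, U, hU, h.1, h.2.1, h.2.2, by simp⟩
      · obtain ⟨-, U, hU, h1, h2, h3, h4⟩ := this
        refine ⟨U, hU, h1, h2, fun z hz => ?_⟩
        rcases Finset.mem_insert.1 hz with rfl | hz
        · exact fun y => h4 y (Finset.mem_univ _)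
        · exact h3 z hz
      · rintro S' y s - hy ⟨hx, U, hU, h1, h2, h3, h4⟩
        obtain ⟨U', hU', hor, hadd⟩ := step U x y s hx hy hU
        have hsub : U ⊆ U' := by
          rcases hor with rfl | ⟨_, _, rfl⟩
          · rfl
          · exact Finset.subset_insert _ _
        have mono {z : Fin n} (hz : z ∈ U ∨ K ≤ U.card) : z ∈ U' ∨ K ≤ U'.card :=
          hz.imp (fun h => hsub h) (fun h => h.trans (Finset.card_le_card hsub))
        refine ⟨by rwa [den_nat_of_notMem hw], U', hU', h1.trans hsub, fun hc => ?_,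
          fun z hz y hzU hR => mono (h3 z hz y hzU hR), fun z hz hxU hR => ?_⟩
        · obtain rfl := h2 hc
          rcases hor with h | ⟨hxU, hR, rfl⟩
          · exact h
          · exact Finset.insert_eq_of_mem (hc x hxU y hR)
        · rcases Finset.mem_insert.1 hz with rfl | hz
          · exact hadd (h1 hxU) hR
          · exact mono (h4 z hz hxU hR)
  -- As long as the set is neither closed nor full, it has more elements than there were rounds,
  -- which is impossible after `n` rounds. The case `S = ∅` is needed because `U₀` may be empty.
  have := den_forN (n := n) (fun S s => ∃ U, Inv U s ∧ U₀ ⊆ U ∧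
      (K ≤ U.card ∨ (∀ x ∈ U, ∀ y, R x y → y ∈ U) ∨ S.card < U.card ∨ S = ∅)) (v := a)
      (P := forN b (forN c P))
      (fun S s m ⟨U, hU, h⟩ => ⟨U, hI _ _ _ _ (by simp) hU, h⟩) ?_ (hn _ _ h)
      ⟨U₀, h, subset_rfl, by simp⟩
  · obtain ⟨U, hU, hsub, hor⟩ := this
    refine ⟨U, hU, hsub, ?_⟩
    rcases hor with h | h | h | h
    · exact .inl h
    · exact .inr h
    · simpa using h.trans_le (Finset.card_le_univ U)
    · right
      intro x
      exact absurd (h ▸ Finset.mem_univ x) (Finset.notMem_empty x)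
  · rintro S x s hx - ⟨U, hU, hsub, hor⟩
    obtain ⟨U', hU', h1, h2, h3⟩ := round U s hU
    refine ⟨U', hU', hsub.trans h1, ?_⟩
    by_cases hc : ∀ x ∈ U, ∀ y, R x y → y ∈ U
    · right; left
      rwa [h2 hc]
    rw [or_iff_right hc] at hor
    push Not at hc
    obtain ⟨x', hx', y', hR, hy'⟩ := hc
    rcases h3 x' y' hx' hR with hmem | hK
    · have hlt : U.card < U'.card :=
        Finset.card_lt_card ⟨h1, fun hle => hy' (hle hmem)⟩
      rw [Finset.card_insert_of_notMem hx]
      rcases hor with h | h | h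
      · left; lia
      · right; right; left; lia
      · subst h
        have : 0 < U.card := Finset.card_pos.2 ⟨x', hx'⟩
        right; right; left; simp; lia
    · exact .inl hK

end Stmt
end RAM

/-! ### Chains of intersecting balls and disjoint subfamilies. -/

namespace Clustering

open Finset

section Chains

variable {V ι : Type} {d : V → V → ℝ} {B : ι → Set V} {r : ι → ℝ}

theorem IsDistance.nonneg (hd : IsDistance d) (x y : V) : 0 ≤ d x y := by
  have := hd.triangle x y x
  rw [hd.self, hd.symm y x] at this
  linarith

/-- `x` and `y` are joined by a chain of consecutively intersecting sets `B p` with `p ∈ A`. -/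
def Linked (B : ι → Set V) (A : Finset ι) : V → V → Prop :=
  Relation.EqvGen fun x y => ∃ p ∈ A, x ∈ B p ∧ y ∈ B p

theorem Linked.of_mem {A : Finset ι} {p : ι} (hp : p ∈ A) {x y : V} (hx : x ∈ B p)
    (hy : y ∈ B p) : Linked B A x y :=
  .rel _ _ ⟨p, hp, hx, hy⟩

theorem Linked.mono {A A' : Finset ι} (h : A ⊆ A') {x y : V} (hxy : Linked B A x y) :
    Linked B A' x y :=
  Relation.EqvGen.mono (fun _ _ ⟨p, hp, hx⟩ => ⟨p, h hp, hx⟩) _ _ hxy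

/-- The intersection graph of the sets `B p` with `p ∈ A`. -/
def intersectionGraph (B : ι → Set V) (A : Finset ι) : SimpleGraph ι where
  Adj p q := p ≠ q ∧ p ∈ A ∧ q ∈ A ∧ (B p ∩ B q).Nonempty
  symm := ⟨fun p q ⟨h, hp, hq, hne⟩ => ⟨h.symm, hq, hp, by rwa [Set.inter_comm]⟩⟩
  loopless := ⟨fun p h => h.1 rfl⟩

/-- Turns a chain of points into a walk in the intersection graph, where shortest walks are
available. A point outside all sets is linked only to itself, whence the first alternative. -/
theorem Linked.exists_reachable {A : Finset ι} {x y : V} (h : Linked B A x y) :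
    x = y ∨ ∃ p ∈ A, ∃ q ∈ A, x ∈ B p ∧ y ∈ B q ∧ (intersectionGraph B A).Reachable p q := by
  induction h with
  | rel x y h =>
    obtain ⟨p, hp, hx, hy⟩ := h
    exact .inr ⟨p, hp, p, hp, hx, hy, .rfl⟩
  | refl x => exact .inl rfl
  | symm x y _ ih =>
    rcases ih with rfl | ⟨p, hp, q, hq, hx, hy, h⟩
    · exact .inl rfl
    · exact .inr ⟨q, hq, p, hp, hy, hx, h.symm⟩
  | trans x y z _ _ ih ih' =>
    rcases ih with rfl | ⟨p, hp, q, hq, hx, hy, h⟩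
    · exact ih'
    rcases ih' with rfl | ⟨p', hp', q', hq', hy', hz, h'⟩
    · exact .inr ⟨p, hp, q, hq, hx, hy, h⟩
    refine .inr ⟨p, hp, q', hq', hx, hz, ?_⟩
    by_cases e : q = p'
    · subst e; exact h.trans h'
    · have : (intersectionGraph B A).Adj q p' := ⟨e, hq, hp', y, hy, hy'⟩
      exact h.trans (this.reachable.trans h')

variable [DecidableEq ι]

/-- The distance of two linked points is at most four times the sum of the radii in a disjoint
subfamily, up to the sets in `Γ`, which are charged twice their radius. -/
theorem Linked.exists_disjoint (hd : IsDistance d) (hr : ∀ p, 0 ≤ r p)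
    (hB : ∀ p, ∀ x ∈ B p, ∀ y ∈ B p, d x y ≤ 2 * r p) {A : Finset ι} (Γ : Finset ι) {x y : V}
    (h : Linked B A x y) (hx : ∃ p ∈ A, x ∈ B p) :
    ∃ D : Finset ι, D ⊆ A \ Γ ∧ (D : Set ι).PairwiseDisjoint B ∧
      (∀ p ∈ D, ∀ z ∈ B p, Linked B A x z) ∧
      (∃ Γ' ⊆ Γ, (∀ p ∈ Γ', ∀ z ∈ B p, Linked B A x z) ∧
        d x y ≤ 4 * ∑ p ∈ D, r p + 2 * ∑ p ∈ Γ', r p ∧ (D.Nonempty ∨ Γ'.Nonempty)) := by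
  obtain ⟨p, hp, q, hq, hx, hy, h⟩ :
      ∃ p ∈ A, ∃ q ∈ A, x ∈ B p ∧ y ∈ B q ∧ (intersectionGraph B A).Reachable p q := by
    rcases h.exists_reachable with rfl | h
    · obtain ⟨p, hp, hx⟩ := hx
      exact ⟨p, hp, p, hp, hx, hx, .rfl⟩
    · exact h
  obtain ⟨w, hw⟩ := h.exists_walk_length_eq_dist
  set L := w.length with hL
  set g := w.getVert with hg
  have hadj (s : ℕ) (hs : s < L) : (intersectionGraph B A).Adj (g s) (g (s + 1)) :=
    w.adj_getVert_succ hs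
  have hgA (s : ℕ) (hs : s ≤ L) : g s ∈ A := by
    rcases s with _ | s
    · simpa [hg] using hp
    · exact (hadj s hs).2.2.1
  -- Two sets at distance at least two on the walk that coincide or intersect would give a shortcut,
  -- against the choice of a shortest walk.
  have hfar (s t : ℕ) (hst : s + 2 ≤ t) (ht : t ≤ L) :
      g s ≠ g t ∧ Disjoint (B (g s)) (B (g t)) := by
    have short (c : (intersectionGraph B A).Walk (g s) (g t)) (hc : c.length ≤ 1) : False := by
      have := SimpleGraph.dist_le (((w.take s).append c).append (w.drop t))
      simp only [SimpleGraph.Walk.length_append, SimpleGraph.Walk.take_length,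
        SimpleGraph.Walk.drop_length] at this
      lia
    have hne : g s ≠ g t := fun e => short (SimpleGraph.Walk.nil.copy rfl e) (by simp)
    refine ⟨hne, ?_⟩
    rw [Set.disjoint_iff_inter_eq_empty]
    by_contra hd
    have : (intersectionGraph B A).Adj (g s) (g t) :=
      ⟨hne, hgA s (by lia), hgA t ht, Set.nonempty_iff_ne_empty.2 hd⟩
    exact short this.toWalk (by simp)
  have hinj : Set.InjOn g (Finset.range (L + 1)) := by
    have key (s t : ℕ) (hst : s < t) (ht : t ≤ L) : g s ≠ g t := by
      rcases Nat.lt_or_ge (s + 1) t with h | h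
      · exact (hfar s t h ht).1
      · obtain rfl : t = s + 1 := by lia
        exact (hadj s ht).1
    intro s hs t ht e
    simp only [Finset.coe_range, Set.mem_Iio] at hs ht
    rcases lt_trichotomy s t with h | h | h
    · exact absurd e (key s t h (by lia))
    · exact h
    · exact absurd e.symm (key t s h (by lia))
  have hlink (s : ℕ) (hs : s ≤ L) : ∀ z ∈ B (g s), Linked B A x z := by
    induction s with
    | zero => intro z hz; exact .of_mem hp hx (by simpa [hg] using hz)
    | succ s ih =>
      intro z hz
      obtain ⟨-, -, -, u, hu, hu'⟩ := hadj s hs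
      exact .trans _ _ _ (ih (by lia) u hu) (Linked.of_mem (hgA _ hs) hu' hz)
  -- Walking through consecutive sets costs at most the diameter of each of them.
  have hdist (s : ℕ) (hs : s ≤ L) : ∀ z ∈ B (g s), d x z ≤ 2 * ∑ i ∈ range (s + 1), r (g i) := by
    induction s with
    | zero =>
      intro z hz
      simpa [hg] using hB p x hx z (by simpa [hg] using hz)
    | succ s ih =>
      intro z hz
      obtain ⟨-, -, -, u, hu, hu'⟩ := hadj s hs
      have h1 := ih (by lia) u hu
      have h2 := hB _ u hu' z hz
      have h3 := hd.triangle x u z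
      rw [Finset.sum_range_succ]
      linarith
  have hxy := hdist L le_rfl y (by simpa [hg, hL] using hy)
  set J := range (L + 1) with hJ
  have hJle {i : ℕ} (hi : i ∈ J) : i ≤ L := by simp [hJ] at hi; lia
  let JG := J.filter fun i => g i ∈ Γ
  let JO := J.filter fun i => g i ∉ Γ
  have hsplit : ∑ i ∈ J, r (g i) = ∑ i ∈ JG, r (g i) +
      (∑ i ∈ JO with Even i, r (g i) + ∑ i ∈ JO with ¬ Even i, r (g i)) := by
    rw [Finset.sum_filter_add_sum_filter_not, Finset.sum_filter_add_sum_filter_not]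
  have himg (K : Finset ℕ) (hK : K ⊆ J) : ∑ p ∈ K.image g, r p = ∑ i ∈ K, r (g i) :=
    Finset.sum_image fun i hi j hj e => hinj (hK hi) (hK hj) e
  -- `K` is a parity class among the positions of unguessed sets with at least half of their radius
  -- sum. Positions of equal parity are not consecutive, so the sets are disjoint.
  have main (K : Finset ℕ) (hK : K ⊆ JO)
      (hpar : ∀ i ∈ K, ∀ j ∈ K, i < j → i + 2 ≤ j)
      (hsum : ∑ i ∈ JO with Even i, r (g i) + ∑ i ∈ JO with ¬ Even i, r (g i) ≤
        2 * ∑ i ∈ K, r (g i)) (hne : K.Nonempty ∨ JG.Nonempty) :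
    ∃ D : Finset ι, D ⊆ A \ Γ ∧ (D : Set ι).PairwiseDisjoint B ∧
      (∀ p ∈ D, ∀ z ∈ B p, Linked B A x z) ∧
      (∃ Γ' ⊆ Γ, (∀ p ∈ Γ', ∀ z ∈ B p, Linked B A x z) ∧
        d x y ≤ 4 * ∑ p ∈ D, r p + 2 * ∑ p ∈ Γ', r p ∧ (D.Nonempty ∨ Γ'.Nonempty)) := by
    have hKJ : K ⊆ J := hK.trans (filter_subset _ _)
    refine ⟨K.image g, ?_, ?_, ?_, JG.image g, ?_, ?_, ?_, ?_⟩
    · intro p hp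
      obtain ⟨i, hi, rfl⟩ := Finset.mem_image.1 hp
      have := Finset.mem_filter.1 (hK hi)
      exact Finset.mem_sdiff.2 ⟨hgA i (hJle this.1), this.2⟩
    · intro p hp q hq hpq
      obtain ⟨i, hi, rfl⟩ := Finset.mem_image.1 hp
      obtain ⟨j, hj, rfl⟩ := Finset.mem_image.1 hq
      rcases lt_trichotomy i j with h | h | h
      · exact (hfar i j (hpar i hi j hj h) (hJle (hKJ hj))).2
      · exact absurd (congrArg g h) hpq
      · exact (hfar j i (hpar j hj i hi h) (hJle (hKJ hi))).2.symm
    · intro p hp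
      obtain ⟨i, hi, rfl⟩ := Finset.mem_image.1 hp
      exact hlink i (hJle (hKJ hi))
    · intro p hp
      obtain ⟨i, hi, rfl⟩ := Finset.mem_image.1 hp
      exact (Finset.mem_filter.1 hi).2
    · intro p hp
      obtain ⟨i, hi, rfl⟩ := Finset.mem_image.1 hp
      exact hlink i (hJle (Finset.mem_filter.1 hi).1)
    · rw [himg K hKJ, himg JG (filter_subset _ _)]
      linarith
    · simpa using hne
  rcases le_total (∑ i ∈ JO with ¬ Even i, r (g i)) (∑ i ∈ JO with Even i, r (g i)) with h | h
  · refine main (JO.filter fun i => Even i) (filter_subset _ _) ?_ (by linarith) ?_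
    · intro i hi j hj hij
      obtain ⟨a, ha⟩ := (Finset.mem_filter.1 hi).2
      obtain ⟨b, hb⟩ := (Finset.mem_filter.1 hj).2
      lia
    · by_cases h0 : g 0 ∈ Γ
      · exact .inr ⟨0, by simp [JG, hJ, h0]⟩
      · exact .inl ⟨0, by simp [JO, hJ, h0]⟩
  -- One of the two families must be nonempty. If there are no odd positions, the even sum is zero
  -- as well, and the even positions can be taken: position 0 is among them or belongs to a guessed
  -- set.
  · by_cases h' : (JO.filter fun i => ¬ Even i).Nonempty
    · refine main (JO.filter fun i => ¬ Even i) (filter_subset _ _) ?_ (by linarith) (.inl h')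
      intro i hi j hj hij
      have hi := (Finset.mem_filter.1 hi).2
      have hj := (Finset.mem_filter.1 hj).2
      rw [Nat.not_even_iff_odd] at hi hj
      obtain ⟨a, ha⟩ := hi
      obtain ⟨b, hb⟩ := hj
      lia
    · rw [Finset.not_nonempty_iff_eq_empty] at h'
      rw [h', Finset.sum_empty] at h
      have hnn : 0 ≤ ∑ i ∈ JO with Even i, r (g i) := Finset.sum_nonneg fun _ _ => hr _
      refine main (JO.filter fun i => Even i) (filter_subset _ _) ?_ (by
        rw [h', Finset.sum_empty]; linarith) ?_
      · intro i hi j hj hij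
        obtain ⟨a, ha⟩ := (Finset.mem_filter.1 hi).2
        obtain ⟨b, hb⟩ := (Finset.mem_filter.1 hj).2
        lia
      · by_cases h0 : g 0 ∈ Γ
        · exact .inr ⟨0, by simp [JG, hJ, h0]⟩
        · exact .inl ⟨0, by simp [JO, hJ, h0]⟩

end Chains

/-! ### Classes of linked points and bounds on their diameters. -/

section Labels

variable {V ι : Type} [Fintype V] [DecidableEq V] [DecidableEq ι] {d : V → V → ℝ} {B : ι → Set V}
  {r : ι → ℝ} {A : Finset ι} {lab : V → V}

/-- `lab` selects a representative of every class of the equivalence relation `Linked B A`. -/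
structure IsLabelling (B : ι → Set V) (A : Finset ι) (lab : V → V) : Prop where
  idem : ∀ x, lab (lab x) = lab x
  eq_iff : ∀ x y, lab x = lab y ↔ Linked B A x y

/-- `W` bounds the diameter of every class of `lab`. -/
structure IsDiamBound (d : V → V → ℝ) (lab : V → V) (W : V → ℝ) : Prop where
  nonneg : ∀ v, 0 ≤ W v
  le : ∀ x y, lab x = lab y → d x y ≤ W (lab x)

/-- The bound for chains, applied to a pair of largest distance in each class. The sets it yields
stay inside the class, so the families of different classes can be united without losing
disjointness. The last clause keeps a witness for every class, which is needed to count the classes.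
-/
theorem IsLabelling.exists_disjoint (hlab : IsLabelling B A lab) (hd : IsDistance d)
    (hr : ∀ p, 0 ≤ r p) (hne : ∀ p, (B p).Nonempty)
    (hB : ∀ p, ∀ x ∈ B p, ∀ y ∈ B p, d x y ≤ 2 * r p) (hA : ∀ x, ∃ p ∈ A, x ∈ B p)
    (Γ : Finset ι) :
    ∃ (W : V → ℝ) (D : Finset ι), IsDiamBound d lab W ∧ D ⊆ A \ Γ ∧
      (D : Set ι).PairwiseDisjoint B ∧ ∑ v, W v ≤ 4 * ∑ p ∈ D, r p + 2 * ∑ p ∈ Γ, r p ∧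
      ∀ v, lab v = v → (∃ p ∈ D, ∀ z ∈ B p, lab z = v) ∨ ∃ p ∈ Γ, ∀ z ∈ B p, lab z = v := by
  have key (v : V) : ∃ (w : ℝ) (D Γ' : Finset ι), 0 ≤ w ∧
      (∀ x y, lab x = v → lab y = v → d x y ≤ w) ∧ D ⊆ A \ Γ ∧ (D : Set ι).PairwiseDisjoint B ∧
      Γ' ⊆ Γ ∧ (∀ p ∈ D, ∀ z ∈ B p, lab z = v) ∧ (∀ p ∈ Γ', ∀ z ∈ B p, lab z = v) ∧
      w ≤ 4 * ∑ p ∈ D, r p + 2 * ∑ p ∈ Γ', r p ∧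
      (lab v = v → D.Nonempty ∨ Γ'.Nonempty) := by
    by_cases hv : lab v = v
    · obtain ⟨q, hq, hmax⟩ := Finset.exists_max_image
        (univ.filter fun q : V × V => lab q.1 = v ∧ lab q.2 = v) (fun q => d q.1 q.2)
        ⟨(v, v), by simp [hv]⟩
      simp only [mem_filter, mem_univ, true_and] at hq hmax
      obtain ⟨D, hD, hdisj, hDl, Γ', hΓ, hΓl, hle, hor⟩ := Linked.exists_disjoint hd hr hB Γ
        ((hlab.eq_iff q.1 q.2).1 (hq.1.trans hq.2.symm)) (hA q.1)
      refine ⟨d q.1 q.2, D, Γ', hd.nonneg _ _, fun x y hx hy => hmax (x, y) ⟨hx, hy⟩, hD, hdisj,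
        hΓ, fun p hp z hz => ?_, fun p hp z hz => ?_, hle, fun _ => hor⟩
      · rw [← hq.1, eq_comm, hlab.eq_iff]; exact hDl p hp z hz
      · rw [← hq.1, eq_comm, hlab.eq_iff]; exact hΓl p hp z hz
    · refine ⟨0, ∅, ∅, le_rfl, fun x y hx => ?_, by simp, by simp, by simp, by simp, by simp,
        by simp, fun h => absurd h hv⟩
      exact absurd (by rw [← hx, hlab.idem]) hv
  choose W D Γ' hW hWd hD hdisj hΓ hDl hΓl hle hor using key
  have hsep {p : ι} {v w : V} (h1 : ∀ z ∈ B p, lab z = v) (h2 : ∀ z ∈ B p, lab z = w) : v = w := by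
    obtain ⟨z, hz⟩ := hne p
    rw [← h1 z hz, h2 z hz]
  refine ⟨W, univ.biUnion D, ⟨hW, fun x y h => hWd _ x y rfl h.symm⟩, ?_, ?_, ?_, ?_⟩
  · exact Finset.biUnion_subset.2 fun v _ => hD v
  · intro p hp q hq hpq
    obtain ⟨v, -, hp⟩ := Finset.mem_biUnion.1 hp
    obtain ⟨w, -, hq⟩ := Finset.mem_biUnion.1 hq
    by_cases e : v = w
    · subst e; exact hdisj v hp hq hpq
    · exact Set.disjoint_left.2 fun z hz hz' => e (by rw [← hDl v p hp z hz, hDl w q hq z hz'])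
  · have h1 : ∑ p ∈ univ.biUnion D, r p = ∑ v, ∑ p ∈ D v, r p := by
      refine Finset.sum_biUnion fun v _ w _ hvw => Finset.disjoint_left.2 fun p hp hp' => ?_
      exact hvw (hsep (hDl v p hp) (hDl w p hp'))
    have h2 : ∑ p ∈ univ.biUnion Γ', r p = ∑ v, ∑ p ∈ Γ' v, r p := by
      refine Finset.sum_biUnion fun v _ w _ hvw => Finset.disjoint_left.2 fun p hp hp' => ?_
      exact hvw (hsep (hΓl v p hp) (hΓl w p hp'))
    have h3 : ∑ p ∈ univ.biUnion Γ', r p ≤ ∑ p ∈ Γ, r p :=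
      Finset.sum_le_sum_of_subset_of_nonneg (Finset.biUnion_subset.2 fun v _ => hΓ v)
        fun p _ _ => hr p
    have h4 : ∑ v, W v ≤ ∑ v, (4 * ∑ p ∈ D v, r p + 2 * ∑ p ∈ Γ' v, r p) :=
      Finset.sum_le_sum fun v _ => hle v
    rw [Finset.sum_add_distrib, ← Finset.mul_sum, ← Finset.mul_sum] at h4
    linarith
  · intro v hv
    rcases hor v hv with ⟨p, hp⟩ | ⟨p, hp⟩
    · exact .inl ⟨p, Finset.mem_biUnion.2 ⟨v, mem_univ _, hp⟩, hDl v p hp⟩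
    · exact .inr ⟨p, hΓ v hp, hΓl v p hp⟩

/-- Every class contains a set of `D` or one of the clusters with index in `I`. -/
theorem card_roots_le {k : ℕ} {c : V → Fin k} {I : Finset (Fin k)} {D Γ : Finset ι}
    (hne : ∀ p, (B p).Nonempty) (hlab : IsLabelling B A lab) (hΓA : Γ ⊆ A)
    (hΓ : ∀ p ∈ Γ, ∃ i ∈ I, ∃ z ∈ B p, c z = i) (hI : ∀ i ∈ I, ∃ p ∈ Γ, ∀ z, c z = i → z ∈ B p)
    (h : ∀ v, lab v = v → (∃ p ∈ D, ∀ z ∈ B p, lab z = v) ∨ ∃ p ∈ Γ, ∀ z ∈ B p, lab z = v) :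
    (univ.filter fun v => lab v = v).card ≤ D.card + I.card := by
  classical
  -- A root is charged to a set of `D` in its class, or to an index in `I` whose cluster meets a
  -- guessed set in its class. Such a cluster lies in one set of `Γ`, hence in one class, so no two
  -- roots share a charge.
  have key (v : V) : ∃ a : ι ⊕ Fin k, lab v = v → a ∈ D.disjSum I ∧
      (∀ p, a = .inl p → ∀ z ∈ B p, lab z = v) ∧
      ∀ i, a = .inr i → ∃ z, c z = i ∧ lab z = v ∧ ∀ z', c z' = i → lab z' = lab z := by
    by_cases hv : lab v = v
    · rcases h v hv with ⟨p, hp, hz⟩ | ⟨p, hp, hz⟩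
      · exact ⟨.inl p, fun _ => ⟨by simpa using hp, by rintro _ ⟨⟩; exact hz, by simp⟩⟩
      · obtain ⟨i, hi, z, hzp, rfl⟩ := hΓ p hp
        refine ⟨.inr (c z), fun _ => ⟨by simpa using hi, by simp, ?_⟩⟩
        rintro _ ⟨⟩
        obtain ⟨q, hq, hcq⟩ := hI _ hi
        exact ⟨z, rfl, hz z hzp, fun z' hz' => (hlab.eq_iff _ _).2
          (.of_mem (hΓA hq) (hcq z' hz') (hcq z rfl))⟩
    · obtain ⟨⟨p⟩⟩ | hemp := em (Nonempty (ι ⊕ Fin k))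
      · exact ⟨p, fun h => absurd h hv⟩
      · rcases h (lab v) (hlab.idem v) with ⟨p, _⟩ | ⟨p, _⟩ <;> exact absurd ⟨.inl p⟩ hemp
  choose f hf using key
  rw [← Finset.card_disjSum]
  refine Finset.card_le_card_of_injOn f (fun v hv => (hf v (by simpa using hv)).1) ?_
  intro v hv w hw e
  simp only [coe_filter, mem_univ, true_and, Set.mem_ofPred_eq] at hv hw
  obtain ⟨-, h1, h2⟩ := hf v hv
  obtain ⟨-, h1', h2'⟩ := hf w hw
  rcases ha : f v with p | i
  · obtain ⟨z, hz⟩ := hne p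
    rw [← h1 p ha z hz, h1' p (e ▸ ha) z hz]
  · obtain ⟨z, hz, hzv, hz'⟩ := h2 i ha
    obtain ⟨z', hzi, hzw, -⟩ := h2' i (e ▸ ha)
    rw [← hzv, ← hzw, hz' z' hzi]

/-- Merging the classes that meet a set `B p` adds at most the diameter of this set. -/
theorem IsDiamBound.merge (hd : IsDistance d) {lab' : V → V} {W : V → ℝ} {p : ι} {ρ : ℝ}
    (hρ : 0 ≤ ρ) (hp : (B p).Nonempty) (hB : ∀ x ∈ B p, ∀ y ∈ B p, d x y ≤ ρ)
    (hlab : IsLabelling B A lab) (hlab' : IsLabelling B (insert p A) lab')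
    (hW : IsDiamBound d lab W) :
    ∃ W', IsDiamBound d lab' W' ∧ ∑ v, W' v ≤ ∑ v, W v + ρ := by
  classical
  let M : Finset V := univ.filter fun v => lab v = v ∧ ∃ z ∈ B p, lab z = v
  obtain ⟨z₀, hz₀⟩ := hp
  -- The new set only unites classes that meet it; `M` is the set of their roots.
  have hsplit (x y : V) (h : lab' x = lab' y) : lab x = lab y ∨ (lab x ∈ M ∧ lab y ∈ M) := by
    have hl := (hlab'.eq_iff x y).1 h
    clear h
    induction hl with
    | rel x y h =>
      obtain ⟨q, hq, hx, hy⟩ := h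
      rcases Finset.mem_insert.1 hq with rfl | hq
      · right
        simp only [M, mem_filter, mem_univ, true_and, hlab.idem]
        exact ⟨⟨x, hx, rfl⟩, y, hy, rfl⟩
      · exact .inl ((hlab.eq_iff _ _).2 (.of_mem hq hx hy))
    | refl => exact .inl rfl
    | symm x y _ ih => exact ih.imp Eq.symm And.symm
    | trans x y z _ _ ih ih' =>
      rcases ih with h | h
      · rwa [h]
      · rcases ih' with h' | h'
        · rw [← h']; exact .inr h
        · exact .inr ⟨h.1, h'.2⟩
  have hmono (x y : V) (h : lab x = lab y) : lab' x = lab' y :=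
    (hlab'.eq_iff _ _).2 (((hlab.eq_iff _ _).1 h).mono (Finset.subset_insert _ _))
  have hM (x : V) : lab x ∈ M ↔ lab' x = lab' z₀ := by
    constructor
    · intro h
      simp only [M, mem_filter, mem_univ, true_and] at h
      obtain ⟨-, z, hz, e⟩ := h
      rw [hmono x z e.symm]
      exact (hlab'.eq_iff _ _).2 (.of_mem (Finset.mem_insert_self _ _) hz hz₀)
    · intro h
      rcases hsplit x z₀ h with h | h
      · simp only [M, mem_filter, mem_univ, true_and, hlab.idem]
        exact ⟨z₀, hz₀, h.symm⟩
      · exact h.1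
  have hsum : 0 ≤ ∑ v ∈ M, W v := Finset.sum_nonneg fun v _ => hW.nonneg v
  -- representatives may have changed, so the bounds of the other classes are moved
  let W' : V → ℝ := fun v => (∑ u with lab u = u ∧ lab' u = v ∧ u ∉ M, W u) +
    if v = lab' z₀ then ∑ u ∈ M, W u + ρ else 0
  have hnn (v : V) : 0 ≤ ∑ u with lab u = u ∧ lab' u = v ∧ u ∉ M, W u :=
    Finset.sum_nonneg fun u _ => hW.nonneg u
  refine ⟨W', ⟨fun v => ?_, fun x y h => ?_⟩, ?_⟩
  · have := hnn v
    simp only [W']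
    split_ifs <;> linarith
  · have hx' : lab' (lab x) = lab' x := hmono _ _ (hlab.idem x)
    by_cases hx : lab x ∈ M
    · have hy : lab y ∈ M := (hM y).2 (h.symm.trans ((hM x).1 hx))
      have h1 := hnn (lab' x)
      simp only [W', if_pos ((hM x).1 hx)]
      by_cases e : lab x = lab y
      · have := hW.le x y e
        have := Finset.single_le_sum (f := W) (fun v _ => hW.nonneg v) hx
        linarith
      -- Two points of different old classes are joined by a path through the new set: from `x` to
      -- `zx` in its class, to `zy` in the set, and to `y` in its class.
      · obtain ⟨-, zx, hzx, ex⟩ := (Finset.mem_filter.1 hx).2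
        obtain ⟨-, zy, hzy, ey⟩ := (Finset.mem_filter.1 hy).2
        have h2 := hW.le x zx ex.symm
        have h3 := hW.le y zy ey.symm
        rw [hd.symm] at h3
        have h4 := hB zx hzx zy hzy
        have h5 := hd.triangle x zx y
        have h6 := hd.triangle zx zy y
        have h7 : W (lab x) + W (lab y) ≤ ∑ u ∈ M, W u := by
          rw [← Finset.sum_pair e]
          exact Finset.sum_le_sum_of_subset_of_nonneg (by
            intro u hu
            rcases Finset.mem_insert.1 hu with rfl | hu
            · exact hx
            · rwa [Finset.mem_singleton.1 hu]) fun v _ _ => hW.nonneg v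
        linarith
    · have e : lab x = lab y := (hsplit x y h).resolve_right fun h => hx h.1
      have h1 := hW.le x y e
      have h2 := Finset.single_le_sum (f := W)
        (s := univ.filter fun u => lab u = u ∧ lab' u = lab' x ∧ u ∉ M) (fun v _ => hW.nonneg v)
        (a := lab x) (by simp [hlab.idem, hx', hx])
      simp only [W', if_neg (fun h => hx ((hM x).2 h))]
      linarith
  · simp only [W']
    rw [Finset.sum_add_distrib, Finset.sum_ite_eq' univ, if_pos (mem_univ _)]
    -- Every unmerged root is counted for one new representative only.
    have h1 : ∑ v, ∑ u with lab u = u ∧ lab' u = v ∧ u ∉ M, W u ≤ ∑ u with u ∉ M, W u := by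
      rw [← Finset.sum_fiberwise (univ.filter fun u => u ∉ M) lab' W]
      refine Finset.sum_le_sum fun v _ => ?_
      refine Finset.sum_le_sum_of_subset_of_nonneg ?_ fun v _ _ => hW.nonneg v
      intro u hu
      simp only [mem_filter, mem_univ, true_and] at hu ⊢
      exact ⟨hu.2.2, hu.2.1⟩
    have h2 := Finset.sum_filter_add_sum_filter_not univ (fun u => u ∈ M) W
    rw [Finset.filter_mem_eq_inter, Finset.univ_inter] at h2
    linarith

end Labels

end Clustering

namespace Clustering

open Finset

/-! ### Weak duality with a multiplier for the number of clusters. -/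

section Dual

variable {V ι : Type} [Fintype V] [DecidableEq V] [DecidableEq ι] {d : V → V → ℝ} {B : ι → Set V}
  {r : ι → ℝ} {A : Finset ι} {lab : V → V}

/-- More sets link more points: `lab` is injective on the representatives of the coarser relation.
-/
theorem IsLabelling.card_roots_anti {A A' : Finset ι} (hA : A ⊆ A') {lab lab' : V → V}
    (h : IsLabelling B A lab) (h' : IsLabelling B A' lab') :
    (univ.filter fun v => lab' v = v).card ≤ (univ.filter fun v => lab v = v).card := by
  refine Finset.card_le_card_of_injOn lab (fun v _ => by simp [h.idem]) ?_
  intro v hv w hw e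
  simp only [coe_filter, mem_univ, true_and, Set.mem_ofPred_eq] at hv hw
  rw [← hv, ← hw, h'.eq_iff]
  exact ((h.eq_iff _ _).1 e).mono hA

open Classical in
/-- `σ p` is the slack of the dual constraint of the set `B p`, with the dual values `y` of the
points and the value `l` of the multiplier of the number of clusters; all radii are scaled
by `N`. -/
structure IsSlack (B : ι → Set V) (r : ι → ℝ) (N l : ℝ) (y : V → ℝ) (σ : ι → ℝ) : Prop where
  nonneg : ∀ x, 0 ≤ y x
  eq : ∀ p, σ p = N * r p + l - ∑ x with x ∈ B p, y x

/-- The clusters of `c` with index in `I` are contained in sets from `Γ`, the others in the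
sets `B (q i)`, which have radius at most `R`. -/
structure Fits {k : ℕ} (B : ι → Set V) (r : ι → ℝ) (c : V → Fin k) (I : Finset (Fin k))
    (Γ : Finset ι) (q : Fin k → ι) (R : ℝ) : Prop where
  meets : ∀ p ∈ Γ, ∃ i ∈ I, ∃ z ∈ B p, c z = i
  covers : ∀ i ∈ I, ∃ p ∈ Γ, ∀ z, c z = i → z ∈ B p
  mem : ∀ z, z ∈ B (q (c z))
  small : ∀ i ∉ I, r (q i) ≤ R

variable {N l R : ℝ} {y : V → ℝ} {σ : ι → ℝ} {k : ℕ} {c : V → Fin k} {I : Finset (Fin k)}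
  {D Γ : Finset ι} {q : Fin k → ι}

/-- Upper half of weak duality. Points of clusters in `I` lie in guessed sets and have value zero.
Any other cluster lies in a small set, whose dual constraint bounds the total value of the cluster.
-/
theorem IsSlack.sum_le (hs : IsSlack B r N l y σ) (hf : Fits B r c I Γ q R)
    (h0 : ∀ p, r p ≤ R → 0 ≤ σ p) (hy : ∀ x, ∀ p ∈ Γ, x ∈ B p → y x = 0) :
    ∑ x, y x ≤ ∑ i ∈ Iᶜ, (N * r (q i) + l) := by
  classical
  rw [← Finset.sum_fiberwise univ c y, ← Finset.sum_add_sum_compl I]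
  have h1 : ∑ i ∈ I, ∑ x with c x = i, y x = 0 := by
    refine Finset.sum_eq_zero fun i hi => Finset.sum_eq_zero fun x hx => ?_
    obtain ⟨p, hp, h⟩ := hf.covers i hi
    exact hy x p hp (h x (by simpa using hx))
  rw [h1, zero_add]
  refine Finset.sum_le_sum fun i hi => ?_
  have h2 := h0 _ (hf.small i (by simpa using hi))
  rw [hs.eq] at h2
  have h3 : ∑ x with c x = i, y x ≤ ∑ x with x ∈ B (q i), y x := by
    refine Finset.sum_le_sum_of_subset_of_nonneg ?_ fun x _ _ => hs.nonneg x
    intro x hx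
    simp only [mem_filter, mem_univ, true_and] at hx ⊢
    exact hx ▸ hf.mem x
  linarith

/-- Lower half of weak duality: almost tight disjoint sets collect the values of different points.
-/
theorem IsSlack.le_sum (hs : IsSlack B r N l y σ) (hD : (D : Set ι).PairwiseDisjoint B) {e : ℝ}
    (he : ∀ p ∈ D, σ p ≤ e) : ∑ p ∈ D, (N * r p + l - e) ≤ ∑ x, y x := by
  classical
  calc ∑ p ∈ D, (N * r p + l - e) ≤ ∑ p ∈ D, ∑ x with x ∈ B p, y x := by
        refine Finset.sum_le_sum fun p hp => ?_
        have := he p hp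
        rw [hs.eq] at this
        linarith
    _ = ∑ x ∈ D.biUnion fun p => univ.filter fun x => x ∈ B p, y x := by
        refine (Finset.sum_biUnion fun p hp p' hp' hne => ?_).symm
        refine Finset.disjoint_left.2 fun x hx hx' => ?_
        simp only [mem_filter, mem_univ, true_and] at hx hx'
        exact Set.disjoint_left.1 (hD hp hp' hne) hx hx'
    _ ≤ ∑ x, y x :=
        Finset.sum_le_sum_of_subset_of_nonneg (subset_univ _) fun x _ _ => hs.nonneg x

theorem card_le_of_pairwiseDisjoint (hne : ∀ p, (B p).Nonempty)
    (hD : (D : Set ι).PairwiseDisjoint B) : D.card ≤ Fintype.card V := by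
  choose f hf using hne
  refine Finset.card_le_card_of_injOn f (fun _ _ => mem_univ _) fun p hp p' hp' e => ?_
  by_contra hne
  exact Set.disjoint_left.1 (hD hp hp' hne) (hf p) (e ▸ hf p')

/-- If all sets of `A \ Γ` have slack at most `R`, and there are at least `k` classes, then the
diameters of the classes are bounded in terms of the radii of the sets `B (q i)`. -/
theorem IsLabelling.exists_diamBound (hlab : IsLabelling B A lab) (hd : IsDistance d)
    (hr : ∀ p, 0 ≤ r p) (hne : ∀ p, (B p).Nonempty)
    (hB : ∀ p, ∀ x ∈ B p, ∀ y ∈ B p, d x y ≤ 2 * r p) (hA : ∀ x, ∃ p ∈ A, x ∈ B p)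
    (hs : IsSlack B r (Fintype.card V) l y σ) (hf : Fits B r c I Γ q R) (hΓA : Γ ⊆ A)
    (hV : 0 < Fintype.card V) (hl : 0 ≤ l) (hR : 0 ≤ R)
    (h0 : ∀ p, r p ≤ R → 0 ≤ σ p) (hy : ∀ x, ∀ p ∈ Γ, x ∈ B p → y x = 0)
    (htight : ∀ p ∈ A \ Γ, σ p ≤ R) (hk : k ≤ (univ.filter fun v => lab v = v).card) :
    ∃ W, IsDiamBound d lab W ∧ ∑ v, W v ≤ 4 * (∑ i ∈ Iᶜ, r (q i) + R) + 2 * ∑ p ∈ Γ, r p := by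
  obtain ⟨W, D, hW, hDA, hD, hle, hroot⟩ := hlab.exists_disjoint hd hr hne hB hA Γ
  refine ⟨W, hW, hle.trans ?_⟩
  -- At least `k` classes force `D` to have at least as many sets as there are unguessed clusters,
  -- so the terms with the multiplier can be dropped.
  have h1 := card_roots_le hne hlab hΓA hf.meets hf.covers hroot
  have h2 := (hs.le_sum hD fun p hp => htight p (hDA hp)).trans (hs.sum_le hf h0 hy)
  have h3 : Iᶜ.card + I.card = k := by simp [Finset.card_compl_add_card I]
  have h4 := card_le_of_pairwiseDisjoint hne hD
  rw [Finset.sum_sub_distrib, Finset.sum_add_distrib, Finset.sum_add_distrib, ← Finset.mul_sum,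
    ← Finset.mul_sum, Finset.sum_const, Finset.sum_const, Finset.sum_const, nsmul_eq_mul,
    nsmul_eq_mul, nsmul_eq_mul] at h2
  have h5 : (Iᶜ.card : ℝ) * l ≤ D.card * l :=
    mul_le_mul_of_nonneg_right (by exact_mod_cast (by lia : Iᶜ.card ≤ D.card)) hl
  -- At most `n` disjoint sets have an error `R` each. As the radii are scaled by `n`, this amounts
  -- to a single `R` in the sum of the radii.
  have h6 : (D.card : ℝ) * R ≤ Fintype.card V * R :=
    mul_le_mul_of_nonneg_right (by exact_mod_cast h4) hR
  have h7 : (Fintype.card V : ℝ) * ∑ p ∈ D, r p ≤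
      Fintype.card V * (∑ i ∈ Iᶜ, r (q i) + R) := by linarith
  have h8 := le_of_mul_le_mul_left h7 (by exact_mod_cast hV)
  linarith

/-- With more than `k` classes of tight sets, the multiplier is bounded. -/
theorem IsLabelling.multiplier_le (hlab : IsLabelling B A lab) (hd : IsDistance d)
    (hr : ∀ p, 0 ≤ r p) (hne : ∀ p, (B p).Nonempty)
    (hB : ∀ p, ∀ x ∈ B p, ∀ y ∈ B p, d x y ≤ 2 * r p) (hA : ∀ x, ∃ p ∈ A, x ∈ B p)
    (hs : IsSlack B r (Fintype.card V) l y σ) (hf : Fits B r c I Γ q R) (hΓA : Γ ⊆ A)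
    (hl : 0 ≤ l)
    (h0 : ∀ p, r p ≤ R → 0 ≤ σ p) (hy : ∀ x, ∀ p ∈ Γ, x ∈ B p → y x = 0)
    (htight : ∀ p ∈ A \ Γ, σ p ≤ 0) (hk : k < (univ.filter fun v => lab v = v).card) :
    l ≤ Fintype.card V * ∑ i ∈ Iᶜ, r (q i) := by
  obtain ⟨W, D, -, hDA, hD, -, hroot⟩ := hlab.exists_disjoint hd hr hne hB hA Γ
  have h1 := card_roots_le hne hlab hΓA hf.meets hf.covers hroot
  have h2 := (hs.le_sum hD fun p hp => htight p (hDA hp)).trans (hs.sum_le hf h0 hy)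
  have h3 : Iᶜ.card + I.card = k := by simp [Finset.card_compl_add_card I]
  rw [Finset.sum_sub_distrib, Finset.sum_add_distrib, Finset.sum_add_distrib, ← Finset.mul_sum,
    ← Finset.mul_sum, Finset.sum_const, Finset.sum_const, Finset.sum_const, nsmul_eq_mul,
    nsmul_eq_mul, nsmul_eq_mul] at h2
  -- One class too many leaves one multiplier over, to be paid for by the radii of the solution.
  have h5 : ((Iᶜ.card : ℝ) + 1) * l ≤ D.card * l :=
    mul_le_mul_of_nonneg_right (by exact_mod_cast (by lia : Iᶜ.card + 1 ≤ D.card)) hl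
  have h6 : 0 ≤ (Fintype.card V : ℝ) * ∑ p ∈ D, r p :=
    mul_nonneg (by positivity) (Finset.sum_nonneg fun p _ => hr p)
  linarith

/-- If every cluster of `c` lies in a set of `A`, there are at most `k` classes. -/
theorem IsLabelling.card_roots_le_of_clusters (hlab : IsLabelling B A lab)
    (h : ∀ i, ∃ p ∈ A, ∀ z, c z = i → z ∈ B p) :
    (univ.filter fun v => lab v = v).card ≤ k := by
  rw [← Fintype.card_fin k]
  refine Finset.card_le_card_of_injOn c (fun _ _ => mem_univ _) fun v hv w hw e => ?_
  simp only [coe_filter, mem_univ, true_and, Set.mem_ofPred_eq] at hv hw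
  obtain ⟨p, hp, hz⟩ := h (c v)
  rw [← hv, ← hw, hlab.eq_iff]
  exact .of_mem hp (hz v rfl) (hz w e.symm)

end Dual

/-! ### Connected balls. -/

section Balls

variable {V : Type} {d : V → V → ℝ} {G : SimpleGraph V}

/-- The connected component of `p.1` in the ball around `p.1` with `p.2` on its boundary. -/
def connBall (d : V → V → ℝ) (G : SimpleGraph V) (p : V × V) : Set V :=
  {x | Relation.ReflTransGen (fun a b => G.Adj a b ∧ d p.1 b ≤ d p.1 p.2) p.1 x}

theorem fst_mem_connBall (p : V × V) : p.1 ∈ connBall d G p := .refl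

theorem connBall_nonempty (p : V × V) : (connBall d G p).Nonempty := ⟨p.1, .refl⟩

theorem dist_le_of_mem_connBall (hd : IsDistance d) {p : V × V} {x : V} (h : x ∈ connBall d G p) :
    d p.1 x ≤ d p.1 p.2 := by
  rcases Relation.ReflTransGen.cases_tail h with rfl | ⟨_, _, h⟩
  · rw [hd.self]; exact hd.nonneg _ _
  · exact h.2

theorem dist_le_of_mem_connBall₂ (hd : IsDistance d) (p : V × V) :
    ∀ x ∈ connBall d G p, ∀ y ∈ connBall d G p, d x y ≤ 2 * d p.1 p.2 := by
  intro x hx y hy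
  have h1 := dist_le_of_mem_connBall hd hx
  have h2 := dist_le_of_mem_connBall hd hy
  have h3 := hd.triangle x p.1 y
  rw [hd.symm x p.1] at h3
  linarith

theorem connected_induce {S : Set V} {v : V} (hv : v ∈ S)
    (h : ∀ x ∈ S, Relation.ReflTransGen (fun a b => G.Adj a b ∧ a ∈ S ∧ b ∈ S) v x) :
    (G.induce S).Connected := by
  have key (x : V) (hx : x ∈ S) : (G.induce S).Reachable ⟨v, hv⟩ ⟨x, hx⟩ := by
    have hvx := h x hx
    clear h
    induction hvx with
    | refl => exact .rfl
    | tail _ hab ih =>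
      refine (ih hab.2.1).trans (SimpleGraph.Adj.reachable ?_)
      exact hab.1
  rw [SimpleGraph.connected_iff]
  exact ⟨fun a b => (key a a.2).symm.trans (key b b.2), ⟨⟨v, hv⟩⟩⟩

theorem reflTransGen_of_connected_induce {S : Set V} (h : (G.induce S).Connected) {v x : V}
    (hv : v ∈ S) (hx : x ∈ S) :
    Relation.ReflTransGen (fun a b => G.Adj a b ∧ a ∈ S ∧ b ∈ S) v x := by
  have := (SimpleGraph.reachable_iff_reflTransGen _ _).1 (h.preconnected ⟨v, hv⟩ ⟨x, hx⟩)
  exact Relation.ReflTransGen.lift (Subtype.val) (fun a b hab => ⟨hab, a.2, b.2⟩) _ _ this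

/-- A path inside `S` never leaves the ball, so `S` lies in the component of the center. -/
theorem subset_connBall {S : Set V} (h : (G.induce S).Connected) {p : V × V} (hp : p.1 ∈ S)
    (hS : ∀ x ∈ S, d p.1 x ≤ d p.1 p.2) : S ⊆ connBall d G p := fun _ hx =>
  Relation.ReflTransGen.mono (fun _ b hab => ⟨hab.1, hS b hab.2.2⟩) _ _
    (reflTransGen_of_connected_induce h hp hx)

/-- Classes are connected in `G`: connected balls that intersect have a connected union, and all of
it has one label. -/
theorem IsLabelling.reflTransGen [DecidableEq V] {A : Finset (V × V)} {lab : V → V}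
    (hlab : IsLabelling (connBall d G) A lab) {x y : V} (h : lab x = lab y) :
    Relation.ReflTransGen (fun a b => G.Adj a b ∧ lab a = lab b) x y := by
  have symm : Std.Symm fun a b => G.Adj a b ∧ lab a = lab b := ⟨fun a b h => ⟨h.1.symm, h.2.symm⟩⟩
  have hl := (hlab.eq_iff x y).1 h
  clear h
  induction hl with
  | rel x y h =>
    obtain ⟨p, hp, hx, hy⟩ := h
    have key (z : V) (hz : z ∈ connBall d G p) :
        Relation.ReflTransGen (fun a b => G.Adj a b ∧ lab a = lab b) p.1 z := by
      have hz' : Relation.ReflTransGen _ _ _ := hz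
      clear hz
      induction hz' with
      | refl => exact .refl
      | tail h1 h2 ih =>
        exact ih.tail ⟨h2.1, (hlab.eq_iff _ _).2 (.of_mem hp h1 (h1.tail h2))⟩
    exact (symm_of _ (key x hx)).trans (key y hy)
  | refl => exact .refl
  | symm x y _ ih => exact symm_of _ ih
  | trans x y z _ _ ih ih' => exact ih.trans ih'

end Balls

end Clustering

/-! ### Memory layout, and the union of classes by relabelling. -/

namespace RAM

open Clustering

/-- The test `e = f`. -/
def Test.natEq (e f : NExp) : Test := .and (.natLe e f) (.natLe f e)

@[simp] theorem Test.holds_natEq (s : Store) (e f : NExp) :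
    (Test.natEq e f).Holds s ↔ e.eval s = f.eval s :=
  le_antisymm_iff.symm

variable {n k : ℕ} {d : Fin n → Fin n → ℝ} {G : SimpleGraph (Fin n)} {s : Store}

/-- The input, and the tables computed from it: the multiples of `n` in the natural array `3`,
the connected balls in the natural array `4`, the `n`-fold distances in the real array `1`. -/
structure Base (n k : ℕ) (d : Fin n → Fin n → ℝ) (G : SimpleGraph (Fin n)) (s : Store) :
    Prop where
  size : s.nat 0 0 0 = n
  num : s.nat 0 0 1 = k
  adj : ∀ x y : Fin n, 1 ≤ s.nat 1 x y ↔ G.Adj x y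
  dist : ∀ x y : Fin n, s.real 0 x y = d x y
  mul : ∀ x : Fin n, s.nat 3 x 0 = x * n
  scaled : ∀ x y : Fin n, s.real 1 x y = n * d x y
  ball : ∀ v w x : Fin n, 1 ≤ s.nat 4 (v * n + w) x ↔ x ∈ connBall d G (v, w)

/-- These arrays are fixed once the tables are there. The rest of the memory is working space.
Natural arrays: 5 marks points in guessed balls, 6 holds labels, 7 the current and 14 the best
clustering, 8 the grown set, 20 and 21 the current ball, 100 and above the guesses. Real arrays: 2
holds the slacks, 3 the number `R`, 5 and 7 the current and the best cost. -/
theorem Base.congr {s' : Store} (h : Base n k d G s) (h0 : s'.nat 0 = s.nat 0)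
    (h1 : s'.nat 1 = s.nat 1) (h3 : s'.nat 3 = s.nat 3) (h4 : s'.nat 4 = s.nat 4)
    (hr0 : s'.real 0 = s.real 0) (hr1 : s'.real 1 = s.real 1) : Base n k d G s' := by
  obtain ⟨a, b, c, e, f, g, i⟩ := h
  constructor <;> simpa only [h0, h1, h3, h4, hr0, hr1]

theorem Base.den {P : Stmt} (hP : ∀ a ∈ [0, 1, 3, 4], a ∉ P.natWrites)
    (hP' : ∀ a ∈ [0, 1], a ∉ P.realWrites) (h : Base n k d G s) : Base n k d G (P.den s) := by
  apply h.congr <;> first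
    | exact Stmt.den_nat_of_notMem (hP _ (by simp)) s
    | exact Stmt.den_real_of_notMem (hP' _ (by simp)) s

theorem Base.updateNat {a : ℕ} (ha : a ∉ [0, 1, 3, 4]) (h : Base n k d G s) (i j m : ℕ) :
    Base n k d G (s.updateNat a i j m) := by
  simp only [List.mem_cons, List.not_mem_nil, or_false, not_or] at ha
  apply h.congr <;> first
    | rfl
    | (apply Store.updateNat_nat_of_ne; lia)

/-- The first column of an array holds the function `f`. -/
def Rep (α : ℕ → ℕ → ℕ) (f : Fin n → Fin n) : Prop := ∀ x : Fin n, α x 0 = f x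

theorem Base.updateReal {a : ℕ} (ha : a ∉ [0, 1]) (h : Base n k d G s) (i j : ℕ) (x : ℝ) :
    Base n k d G (s.updateReal a i j x) := by
  simp only [List.mem_cons, List.not_mem_nil, or_false, not_or] at ha
  apply h.congr <;> first
    | rfl
    | (apply Store.updateReal_real_of_ne; lia)

theorem Rep.eq_iff {α : ℕ → ℕ → ℕ} {f : Fin n → Fin n} (h : Rep α f) (x y : Fin n) :
    α x 0 = α y 0 ↔ f x = f y := by
  rw [h, h, Fin.ext_iff]

/-! ### Merging the classes that meet a ball -/

/-- The row of the ball with center `var 20` and boundary point `var 21`. -/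
abbrev ballRow : NExp := .add (.cell 3 (.var 20) (.const 0)) (.var 21)

/-- `x` is in the ball with center `var 20` and boundary point `var 21`. -/
abbrev inBall (x : NExp) : Test := .natLe (.const 1) (.cell 4 ballRow x)

theorem Base.holds_inBall (h : Base n k d G s) {v w x : Fin n} {e : NExp}
    (hv : s.nat 20 0 0 = v) (hw : s.nat 21 0 0 = w) (hx : e.eval s = x) :
    (inBall e).Holds s ↔ x ∈ connBall d G (v, w) := by
  simp only [Test.Holds, NExp.eval, hv, hw, hx, h.mul, h.ball]

/-- Replace the label `var 10` by the label `var 11`. -/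
def relabel : Stmt :=
  .forN 23 (.ifThen (.natEq (.cell 6 (.var 23) (.const 0)) (.var 10))
    (.setNat 6 (.var 23) (.const 0) (.var 11)))

/-- Merge all classes that meet the ball with center `var 20` and boundary point `var 21`. -/
def unionBall : Stmt :=
  .forN 22 (.ifThen (inBall (.var 22))
    (.seq (.setNat 10 (.const 0) (.const 0) (.cell 6 (.var 22) (.const 0)))
    (.seq (.setNat 11 (.const 0) (.const 0) (.cell 6 (.var 20) (.const 0))) relabel)))

theorem den_relabel {lab : Fin n → Fin n} {l t : Fin n} (hn : s.nat 0 0 0 = n)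
    (hl : s.nat 10 0 0 = l) (ht : s.nat 11 0 0 = t) (hlab : Rep (s.nat 6) lab) :
    Rep ((relabel.den s).nat 6) fun y => if lab y = l then t else lab y := by
  have := Stmt.den_eq_forN relabel rfl (fun S s => s.nat 10 0 0 = l ∧ s.nat 11 0 0 = t ∧
    ∀ y : Fin n, s.nat 6 y 0 = ((if y ∈ S ∧ lab y = l then t else lab y : Fin n) : ℕ))
    (fun S s m h => h) ?_ hn ⟨hl, ht, fun y => by simpa using hlab y⟩
  · have h := this.2.2
    simp only [Finset.mem_univ, true_and] at h
    exact h
  · rintro S x s hxS hx ⟨hl, ht, hlab⟩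
    have hxl := hlab x
    simp only [hxS, false_and, if_false] at hxl
    simp only [Stmt.den, Test.holds_natEq, NExp.eval, hx, hl, ht, hxl, Fin.val_inj]
    split_ifs with hc
    · refine ⟨hl, ht, fun y => ?_⟩
      rw [Store.updateNat_nat_self, hlab]
      by_cases e : y = x
      · subst e; simp [hc]
      · simp [Fin.val_inj, e]
    · refine ⟨hl, ht, fun y => ?_⟩
      rw [hlab]
      by_cases e : y = x
      · subst e; simp [hc]
      · simp [e]

/-- Overwriting the label of `a` by that of `b` amounts to adding the pair `(a, b)` to the
generating relation. -/
theorem relabel_eq_iff {V : Type} [DecidableEq V] {lab : V → V} {ρ : V → V → Prop}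
    (h : ∀ x y, lab x = lab y ↔ Relation.EqvGen ρ x y) (a b x y : V) :
    ((if lab x = lab a then lab b else lab x) = if lab y = lab a then lab b else lab y) ↔
      Relation.EqvGen (fun x y => ρ x y ∨ (x = a ∧ y = b)) x y := by
  have hmono {x y : V} (hxy : lab x = lab y) :
      Relation.EqvGen (fun x y => ρ x y ∨ (x = a ∧ y = b)) x y :=
    Relation.EqvGen.mono (fun _ _ => Or.inl) _ _ ((h x y).1 hxy)
  have hab : Relation.EqvGen (fun x y => ρ x y ∨ (x = a ∧ y = b)) a b := .rel _ _ (.inr ⟨rfl, rfl⟩)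
  constructor
  · intro e
    split_ifs at e with hx hy hy
    · exact hmono (hx.trans hy.symm)
    · exact (hmono hx).trans _ _ _ (hab.trans _ _ _ (hmono e))
    · exact (hmono e).trans _ _ _ ((hab.symm _ _).trans _ _ _ ((hmono hy).symm _ _))
    · exact hmono e
  · intro e
    induction e with
    | rel x y e =>
      rcases e with e | ⟨rfl, rfl⟩
      · rw [(h x y).2 (.rel _ _ e)]
      · simp
    | refl => rfl
    | symm _ _ _ ih => exact ih.symm
    | trans _ _ _ _ _ ih ih' => exact ih.trans ih'

/-- It suffices to identify each point of the ball with its center: these pairs generate the same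
equivalence relation as all pairs of points of the ball. The invariant has the pairs of the points
processed so far. -/
theorem den_unionBall {v w : Fin n} {lab : Fin n → Fin n} {A : Finset (Fin n × Fin n)}
    (hs : Base n k d G s) (hv : s.nat 20 0 0 = v) (hw : s.nat 21 0 0 = w)
    (hr : Rep (s.nat 6) lab) (hlab : IsLabelling (connBall d G) A lab) :
    ∃ lab', Rep ((unionBall.den s).nat 6) lab' ∧
      IsLabelling (connBall d G) (insert (v, w) A) lab' := by
  have := Stmt.den_eq_forN unionBall rfl (fun S s => Base n k d G s ∧ s.nat 20 0 0 = v ∧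
    s.nat 21 0 0 = w ∧ ∃ lab, Rep (s.nat 6) lab ∧ (∀ x, lab (lab x) = lab x) ∧
      ∀ x y, lab x = lab y ↔ Relation.EqvGen (fun x y =>
        (∃ p ∈ A, x ∈ connBall d G p ∧ y ∈ connBall d G p) ∨
          x ∈ S ∧ x ∈ connBall d G (v, w) ∧ y = v) x y)
    (fun S s m h => ⟨h.1.updateNat (by decide) _ _ _, h.2⟩) ?_ hs.size
    ⟨hs, hv, hw, lab, hr, hlab.idem, by simpa [Linked] using hlab.eq_iff⟩
  · obtain ⟨-, -, -, lab', hr', hidem, heq⟩ := this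
    refine ⟨lab', hr', hidem, fun x y => (heq x y).trans ?_⟩
    constructor
    · intro h
      induction h with
      | rel x y h =>
        rcases h with ⟨p, hp, hx, hy⟩ | ⟨-, hx, rfl⟩
        · exact .of_mem (Finset.mem_insert_of_mem hp) hx hy
        · exact .of_mem (Finset.mem_insert_self _ _) hx (fst_mem_connBall _)
      | refl => exact .refl _
      | symm _ _ _ ih => exact .symm _ _ ih
      | trans _ _ _ _ _ ih ih' => exact .trans _ _ _ ih ih'
    · intro h
      induction h with
      | rel x y h =>
        obtain ⟨p, hp, hx, hy⟩ := h
        rcases Finset.mem_insert.1 hp with rfl | hp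
        · exact .trans _ _ _ (.rel _ _ (.inr ⟨Finset.mem_univ _, hx, rfl⟩))
            (.symm _ _ (.rel _ _ (.inr ⟨Finset.mem_univ _, hy, rfl⟩)))
        · exact .rel _ _ (.inl ⟨p, hp, hx, hy⟩)
      | refl => exact .refl _
      | symm _ _ _ ih => exact .symm _ _ ih
      | trans _ _ _ _ _ ih ih' => exact .trans _ _ _ ih ih'
  · rintro S x s hxS hx ⟨hs, hv, hw, lab, hr, hidem, heq⟩
    rw [Stmt.den_ifThen, hs.holds_inBall (e := .var 22) hv hw hx]
    split_ifs with hc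
    · set s' := (s.updateNat 10 0 0 (lab x)).updateNat 11 0 0 (lab v)
      have e : (Stmt.seq (.setNat 10 (.const 0) (.const 0) (.cell 6 (.var 22) (.const 0)))
          (.seq (.setNat 11 (.const 0) (.const 0) (.cell 6 (.var 20) (.const 0)))
            relabel)).den s = relabel.den s' := by
        simp [Stmt.den, NExp.eval, Store.updateNat_nat_of_ne, hx, hv, hr x, hr v, s']
      have hB : Base n k d G s' := (hs.updateNat (by decide) _ _ _).updateNat (by decide) _ _ _
      have hrel := den_relabel (s := s') (l := lab x) (t := lab v) hB.size rfl rfl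
        (show Rep (s'.nat 6) lab from hr)
      rw [e]
      refine ⟨hB.den (by decide) (by decide), ?_, ?_, _, hrel, fun y => ?_, fun y z => ?_⟩
      · rw [Stmt.den_nat_of_notMem (by decide)]; exact hv
      · rw [Stmt.den_nat_of_notMem (by decide)]; exact hw
      · by_cases h1 : lab y = lab x <;> by_cases h2 : lab v = lab x <;> simp [h1, h2, hidem]
      · rw [relabel_eq_iff heq x v y z]
        congr! 3 with a b
        simp only [Finset.mem_insert]
        constructor
        · rintro ((h | h) | ⟨rfl, rfl⟩)
          · exact .inl h
          · exact .inr ⟨.inr h.1, h.2⟩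
          · exact .inr ⟨.inl rfl, hc, rfl⟩
        · rintro (h | ⟨rfl | h, h'⟩)
          · exact .inl (.inl h)
          · exact .inr ⟨rfl, h'.2⟩
          · exact .inl (.inr ⟨h, h'⟩)
    · refine ⟨hs, hv, hw, lab, hr, hidem, fun y z => (heq y z).trans (iff_of_eq ?_)⟩
      congr 1
      funext a b
      simp only [Finset.mem_insert, eq_iff_iff]
      refine or_congr_right (and_congr_left fun h => ?_)
      constructor
      · exact .inr
      · rintro (rfl | h')
        · exact absurd h.1 hc
        · exact h'

end RAM

/-! ### Growing classes from their roots to obtain exactly `k` clusters. -/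

namespace Clustering

open Finset

variable {V : Type} [Fintype V] [DecidableEq V] {d : V → V → ℝ} {G : SimpleGraph V} {k : ℕ}
  {lab : V → V} {U : Finset V}

/-- `f` maps every point to the representative of its cluster; there are exactly `k` clusters,
and they are connected. -/
structure IsClustering (G : SimpleGraph V) (k : ℕ) (f : V → V) : Prop where
  idem : ∀ x, f (f x) = f x
  card : (univ.filter fun v => f v = v).card = k
  connected : ∀ v, f v = v → (G.induce {x | f x = v}).Connected

/-- The points of `U` can be reached from the roots of their classes inside `U`. -/
structure IsGrown (G : SimpleGraph V) (lab : V → V) (U : Finset V) : Prop where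
  roots : ∀ v, lab v = v → v ∈ U
  conn : ∀ x ∈ U, Relation.ReflTransGen
    (fun a b => G.Adj a b ∧ a ∈ U ∧ b ∈ U ∧ lab a = lab b) (lab x) x

theorem IsGrown.lab_mem (h : IsGrown G lab U) (hidem : ∀ x, lab (lab x) = lab x) (x : V) :
    lab x ∈ U := h.roots _ (hidem x)

/-- The root path of the neighbour `x` extends by one edge, so a grown part of a class is connected
at every moment. -/
theorem IsGrown.insert (h : IsGrown G lab U) {x y : V} (hx : x ∈ U) (hxy : G.Adj x y)
    (hl : lab x = lab y) : IsGrown G lab (insert y U) := by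
  have mono {a b : V} (hab : Relation.ReflTransGen
      (fun a b => G.Adj a b ∧ a ∈ U ∧ b ∈ U ∧ lab a = lab b) a b) : Relation.ReflTransGen
      (fun a b => G.Adj a b ∧ a ∈ Insert.insert y U ∧ b ∈ Insert.insert y U ∧ lab a = lab b) a b :=
    Relation.ReflTransGen.mono (fun _ _ h => ⟨h.1, mem_insert_of_mem h.2.1,
      mem_insert_of_mem h.2.2.1, h.2.2.2⟩) _ _ hab
  refine ⟨fun v hv => mem_insert_of_mem (h.roots v hv), fun z hz => ?_⟩
  rcases mem_insert.1 hz with rfl | hz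
  · rw [← hl]
    exact (mono (h.conn x hx)).tail ⟨hxy, mem_insert_of_mem hx, mem_insert_self _ _, hl⟩
  · exact mono (h.conn z hz)

theorem IsGrown.map_idem (hidem : ∀ x, lab (lab x) = lab x) (x : V) :
    (if (if x ∈ U then lab x else x) ∈ U then lab (if x ∈ U then lab x else x)
      else if x ∈ U then lab x else x) = if x ∈ U then lab x else x := by
  by_cases hx : x ∈ U <;> simp [hx, hidem]

/-- Points outside `U` form singletons. Starting from `n` singletons, each of the `m` points joined
to the roots lowers the number of clusters by one. -/
theorem IsGrown.isClustering (h : IsGrown G lab U) (hidem : ∀ x, lab (lab x) = lab x) {m : ℕ}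
    (hm : m + (univ.filter fun v => lab v = v).card = U.card) (hk : m + k = Fintype.card V) :
    IsClustering G k fun x => if x ∈ U then lab x else x := by
  refine ⟨IsGrown.map_idem hidem, ?_, fun v hv => connected_induce (v := v) hv fun x hx => ?_⟩
  · have e : (univ.filter fun v => (if v ∈ U then lab v else v) = v) =
        Uᶜ ∪ univ.filter fun v => lab v = v := by
      ext v
      by_cases hv : v ∈ U <;> simp [hv]
    rw [e, card_union_of_disjoint, card_compl]
    · have := Finset.card_le_univ U
      lia
    · refine disjoint_left.2 fun v hv hv' => ?_
      exact (mem_compl.1 hv) (h.roots v (by simpa using hv'))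
  · simp only [Set.mem_ofPred_eq] at hx
    by_cases hxU : x ∈ U
    · rw [if_pos hxU] at hx
      have := h.conn x hxU
      rw [hx] at this
      have hvl : lab v = v := by rw [← hx, hidem]
      have key (z : V) (hz : Relation.ReflTransGen
          (fun a b => G.Adj a b ∧ a ∈ U ∧ b ∈ U ∧ lab a = lab b) v z) :
          (z ∈ U ∧ lab z = v) ∧ Relation.ReflTransGen (fun a b => G.Adj a b ∧
            a ∈ {x | (if x ∈ U then lab x else x) = v} ∧
            b ∈ {x | (if x ∈ U then lab x else x) = v}) v z := by
        induction hz with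
        | refl => exact ⟨⟨h.roots v hvl, hvl⟩, .refl⟩
        | @tail a b h1 h2 ih =>
          obtain ⟨hab, ha, hb, hl⟩ := h2
          have hbv : lab b = v := hl.symm.trans ih.1.2
          refine ⟨⟨hb, hbv⟩, ih.2.tail ⟨hab, ?_, ?_⟩⟩
          · simp [ha, ih.1.2]
          · simp [hb, hbv]
      exact (key x this).2
    · rw [if_neg hxU] at hx
      rw [hx]

/-- A cluster is a part of a class or a singleton, so stopping early never increases a diameter. -/
theorem IsGrown.isDiamBound (hd : IsDistance d) (h : IsGrown G lab U)
    (hidem : ∀ x, lab (lab x) = lab x) {W : V → ℝ} (hW : IsDiamBound d lab W) :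
    IsDiamBound d (fun x => if x ∈ U then lab x else x) W := by
  refine ⟨hW.nonneg, fun x y hxy => ?_⟩
  by_cases hx : x ∈ U <;> by_cases hy : y ∈ U <;> simp only [hx, hy, if_true, if_false] at hxy ⊢
  · exact hW.le x y hxy
  · exact absurd (hxy ▸ h.lab_mem hidem x) hy
  · exact absurd (hxy ▸ h.lab_mem hidem y) hx
  · rw [hxy, hd.self]; exact hW.nonneg y

/-- Growth that gets stuck has exhausted the classes, because these are connected. -/
theorem IsGrown.eq_univ (h : IsGrown G lab U) (hidem : ∀ x, lab (lab x) = lab x)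
    (hconn : ∀ x, Relation.ReflTransGen (fun a b => G.Adj a b ∧ lab a = lab b) (lab x) x)
    (hU : ∀ x ∈ U, ∀ y, G.Adj x y ∧ lab x = lab y → y ∈ U) : U = univ := by
  refine eq_univ_of_forall fun x => ?_
  have hx := hconn x
  have h0 := h.lab_mem hidem x
  generalize lab x = v at hx h0
  induction hx with
  | refl => exact h0
  | tail _ h2 ih => exact hU _ ih _ h2

end Clustering

namespace RAM

open Clustering

variable {n k : ℕ} {d : Fin n → Fin n → ℝ} {G : SimpleGraph (Fin n)} {s : Store}

/-! ### From a labelling to a candidate solution -/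

/-- Mark the roots in the array `8`, and set the number `var 12` of joined points to zero. -/
def initJoin : Stmt :=
  .seq (.setNat 12 (.const 0) (.const 0) (.const 0))
    (.forN 22 (.seq (.setNat 8 (.var 22) (.const 0) (.const 0))
      (.ifThen (.natEq (.cell 6 (.var 22) (.const 0)) (.var 22))
        (.setNat 8 (.var 22) (.const 0) (.const 1)))))

/-- Join the point `var 23` to the marked point `var 22` of the same class, unless `n - k` points
have been joined. -/
def joinStep : Stmt :=
  .ifThen (.and (.natLe (.const 1) (.cell 8 (.var 22) (.const 0)))
      (.and (.not (.natLe (.const 1) (.cell 8 (.var 23) (.const 0))))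
      (.and (.natLe (.const 1) (.cell 1 (.var 22) (.var 23)))
      (.and (.natEq (.cell 6 (.var 22) (.const 0)) (.cell 6 (.var 23) (.const 0)))
        (.natLe (.add (.add (.var 12) (.cell 0 (.const 0) (.const 1))) (.const 1)) (.var 0))))))
    (.seq (.setNat 8 (.var 23) (.const 0) (.const 1))
      (.setNat 12 (.const 0) (.const 0) (.add (.var 12) (.const 1))))

/-- Write the representatives of the clusters to the array `7`. -/
def setIds : Stmt :=
  .forN 22 (.seq (.setNat 7 (.var 22) (.const 0) (.var 22))
    (.ifThen (.natLe (.const 1) (.cell 8 (.var 22) (.const 0)))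
      (.setNat 7 (.var 22) (.const 0) (.cell 6 (.var 22) (.const 0)))))

/-- Turn the labelling in the array `6` into a clustering in the array `7`. -/
def join : Stmt := .seq initJoin (.seq (.forN 24 (.forN 22 (.forN 23 joinStep))) setIds)

theorem den_initJoin {lab : Fin n → Fin n} (hs : Base n k d G s) (hr : Rep (s.nat 6) lab) :
    (initJoin.den s).nat 12 0 0 = 0 ∧
      ∀ x : Fin n, (initJoin.den s).nat 8 x 0 = if lab x = x then 1 else 0 := by
  have := Stmt.den_eq_forN
    (.forN 22 (.seq (.setNat 8 (.var 22) (.const 0) (.const 0))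
      (.ifThen (.natEq (.cell 6 (.var 22) (.const 0)) (.var 22))
        (.setNat 8 (.var 22) (.const 0) (.const 1))))) rfl (n := n)
    (fun S s => s.nat 12 0 0 = 0 ∧ Rep (s.nat 6) lab ∧
      ∀ x ∈ S, s.nat 8 x 0 = if lab x = x then 1 else 0)
    (fun S s m h => h) ?_ (s := s.updateNat 12 0 0 0) hs.size ⟨rfl, hr, by simp⟩
  · exact ⟨this.1, fun x => this.2.2 x (Finset.mem_univ x)⟩
  · rintro S x s hxS hx ⟨h12, hr, h⟩
    rw [Stmt.den, Stmt.den_ifThen]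
    simp only [Stmt.den, Test.holds_natEq, NExp.eval, hx]
    have e6 : (s.updateNat 8 x 0 0).nat 6 = s.nat 6 := rfl
    have e22 : (s.updateNat 8 x 0 0).nat 22 = s.nat 22 := rfl
    simp only [e6, e22, hx, hr x, Fin.val_inj]
    split_ifs with hc
    · refine ⟨h12, hr, fun y hy => ?_⟩
      rw [Store.updateNat_nat_self, Store.updateNat_nat_self]
      rcases Finset.mem_insert.1 hy with rfl | hy
      · simp [hc]
      · have : y ≠ x := fun e => hxS (e ▸ hy)
        simpa [Fin.val_inj, this] using h y hy
    · refine ⟨h12, hr, fun y hy => ?_⟩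
      rw [Store.updateNat_nat_self]
      rcases Finset.mem_insert.1 hy with rfl | hy
      · simp [hc]
      · have : y ≠ x := fun e => hxS (e ▸ hy)
        simpa [Fin.val_inj, this] using h y hy

theorem den_setIds {lab : Fin n → Fin n} {U : Finset (Fin n)} (hs : Base n k d G s)
    (hr : Rep (s.nat 6) lab) (hU : ∀ x : Fin n, s.nat 8 x 0 = if x ∈ U then 1 else 0) :
    Rep ((setIds.den s).nat 7) fun x => if x ∈ U then lab x else x := by
  have := Stmt.den_eq_forN setIds rfl (n := n)
    (fun S s => Rep (s.nat 6) lab ∧ (∀ x : Fin n, s.nat 8 x 0 = if x ∈ U then 1 else 0) ∧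
      ∀ x ∈ S, s.nat 7 x 0 = ((if x ∈ U then lab x else x : Fin n) : ℕ))
    (fun S s m h => h) ?_ hs.size ⟨hr, hU, by simp⟩
  · exact fun x => this.2.2 x (Finset.mem_univ x)
  · rintro S x s hxS hx ⟨hr, hU, h⟩
    rw [Stmt.den, Stmt.den_ifThen]
    simp only [Stmt.den, Test.Holds, NExp.eval, hx]
    have e6 : (s.updateNat 7 x 0 x).nat 6 = s.nat 6 := rfl
    have e8 : (s.updateNat 7 x 0 x).nat 8 = s.nat 8 := rfl
    have e22 : (s.updateNat 7 x 0 x).nat 22 = s.nat 22 := rfl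
    have hc : 1 ≤ (if x ∈ U then 1 else 0) ↔ x ∈ U := by split_ifs <;> simp [*]
    simp only [e6, e8, e22, hx, hr x, hU, hc]
    split_ifs with hc
    · refine ⟨hr, hU, fun y hy => ?_⟩
      rw [Store.updateNat_nat_self, Store.updateNat_nat_self]
      rcases Finset.mem_insert.1 hy with rfl | hy
      · simp [hc]
      · have : y ≠ x := fun e => hxS (e ▸ hy)
        simpa [Fin.val_inj, this] using h y hy
    · refine ⟨hr, hU, fun y hy => ?_⟩
      rw [Store.updateNat_nat_self]
      rcases Finset.mem_insert.1 hy with rfl | hy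
      · simp [hc]
      · have : y ≠ x := fun e => hxS (e ▸ hy)
        simpa [Fin.val_inj, this] using h y hy

/-- Growth stops after `n - k` joins, when `k` clusters are left, or when nothing can be joined. The
alternative `m = 0` allows for `k > n`, where the subtraction is truncated. -/
theorem den_join {lab : Fin n → Fin n} (hs : Base n k d G s) (hr : Rep (s.nat 6) lab) :
    ∃ (m : ℕ) (U : Finset (Fin n)), (join.den s).nat 12 0 0 = m ∧
      Rep ((join.den s).nat 7) (fun x => if x ∈ U then lab x else x) ∧ IsGrown G lab U ∧
      m + (Finset.univ.filter fun v => lab v = v).card = U.card ∧ (m = 0 ∨ m + k ≤ n) ∧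
      (n ≤ m + k ∨ ∀ x ∈ U, ∀ y, G.Adj x y ∧ lab x = lab y → y ∈ U) := by
  set roots := Finset.univ.filter fun v => lab v = v with hroots
  set s₁ := initJoin.den s with hs₁
  have hB₁ : Base n k d G s₁ := hs.den (by decide) (by decide)
  have hr₁ : Rep (s₁.nat 6) lab := by
    rw [hs₁, Stmt.den_nat_of_notMem (by decide)]; exact hr
  obtain ⟨h12, h8⟩ := den_initJoin hs hr
  have key := Stmt.den_saturate (n := n)
    (fun U s => Base n k d G s ∧ Rep (s.nat 6) lab ∧
      (∀ x : Fin n, s.nat 8 x 0 = if x ∈ U then 1 else 0) ∧ IsGrown G lab U ∧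
      s.nat 12 0 0 + roots.card = U.card ∧ (s.nat 12 0 0 = 0 ∨ s.nat 12 0 0 + k ≤ n))
    -- The size of the grown set after `n - k` joins.
    (fun x y => G.Adj x y ∧ lab x = lab y) (roots.card + (n - k))
    (a := 24) (b := 22) (c := 23) (P := joinStep)
    (fun U s v m hv h => by
      rcases hv with rfl | rfl | rfl <;> exact ⟨h.1.updateNat (by decide) _ _ _, h.2⟩)
    (fun U s h => h.1.size) (by decide) (by decide) ?_ (U₀ := roots) (s := s₁)
    ⟨hB₁, hr₁, by simpa [hroots] using h8, ⟨by simp [hroots], fun x hx => by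
      rw [(Finset.mem_filter.1 hx).2]⟩, by rw [hs₁, h12, zero_add], .inl h12⟩
  · obtain ⟨U, ⟨hB, hrU, hU, hgr, hm, hmk⟩, -, hor⟩ := key
    set s₂ := (Stmt.forN 24 (.forN 22 (.forN 23 joinStep))).den s₁ with hs₂
    have e : join.den s = setIds.den s₂ := rfl
    refine ⟨s₂.nat 12 0 0, U, ?_, ?_, hgr, hm, hmk, hor.imp_left (by lia)⟩
    · rw [e, Stmt.den_nat_of_notMem (by decide)]
    · rw [e]
      exact den_setIds hB hrU hU
  · rintro U x y s hx hy ⟨hB, hr, hU, hgr, hm, hmk⟩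
    have hhold : (Test.and (.natLe (.const 1) (.cell 8 (.var 22) (.const 0)))
      (.and (.not (.natLe (.const 1) (.cell 8 (.var 23) (.const 0))))
      (.and (.natLe (.const 1) (.cell 1 (.var 22) (.var 23)))
      (.and (.natEq (.cell 6 (.var 22) (.const 0)) (.cell 6 (.var 23) (.const 0)))
        (.natLe (.add (.add (.var 12) (.cell 0 (.const 0) (.const 1))) (.const 1))
          (.var 0)))))).Holds s ↔
        x ∈ U ∧ y ∉ U ∧ G.Adj x y ∧ lab x = lab y ∧ s.nat 12 0 0 + k + 1 ≤ n := by
      have h1 (z : Fin n) : 1 ≤ (if z ∈ U then 1 else 0) ↔ z ∈ U := by split_ifs <;> simp [*]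
      simp only [Test.Holds, NExp.eval, hx, hy, hU, h1, hB.adj, Test.holds_natEq, hr.eq_iff,
        hB.num, hB.size]
    rw [joinStep, Stmt.den_ifThen, hhold]
    split_ifs with hc
    · obtain ⟨hxU, hyU, hadj, hl, hlt⟩ := hc
      refine ⟨insert y U, ?_, .inr ⟨hxU, ⟨hadj, hl⟩, rfl⟩, fun _ _ => .inl (by simp)⟩
      have e : (Stmt.seq (.setNat 8 (.var 23) (.const 0) (.const 1))
          (.setNat 12 (.const 0) (.const 0) (.add (.var 12) (.const 1)))).den s =
          (s.updateNat 8 y 0 1).updateNat 12 0 0 (s.nat 12 0 0 + 1) := by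
        simp [Stmt.den, NExp.eval, Store.updateNat_nat_of_ne, hy]
      rw [e]
      refine ⟨(hB.updateNat (by decide) _ _ _).updateNat (by decide) _ _ _, hr, fun z => ?_,
        hgr.insert hxU hadj hl, ?_, .inr ?_⟩
      · rw [Store.updateNat_nat_of_ne _ (by decide), Store.updateNat_nat_self, hU]
        by_cases e : z = y <;> simp [e, Fin.val_inj]
      · rw [Store.updateNat_nat_self, Finset.card_insert_of_notMem hyU]
        simp; lia
      · rw [Store.updateNat_nat_self]
        simp; lia
    · refine ⟨U, ⟨hB, hr, hU, hgr, hm, hmk⟩, .inl rfl, fun hxU hR => ?_⟩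
      by_contra hcon
      push Not at hcon
      exact hc ⟨hxU, hcon.1, hR.1, hR.2, by lia⟩

/-- Compute the sum of the diameters of the clusters in the array `7`. -/
def clusterDiam : Stmt :=
  .forN 22 (.forN 23 (.ifThen (.and (.natEq (.cell 7 (.var 22) (.const 0)) (.var 24))
      (.and (.natEq (.cell 7 (.var 23) (.const 0)) (.var 24))
        (.not (.realLe (.cell 0 (.var 22) (.var 23)) (.var 6)))))
    (.setReal 6 (.const 0) (.const 0) (.cell 0 (.var 22) (.var 23)))))

/-- The cost `var 5` of the clustering in the array `7`. -/
def computeCost : Stmt :=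
  .seq (.setReal 5 (.const 0) (.const 0) .zero)
    (.forN 24 (.seq (.setReal 6 (.const 0) (.const 0) .zero)
      (.seq clusterDiam (.setReal 5 (.const 0) (.const 0) (.add (.var 5) (.var 6))))))

theorem den_clusterDiam {f : Fin n → Fin n} {v : Fin n} (hs : Base n k d G s)
    (hf : Rep (s.nat 7) f) (hv : s.nat 24 0 0 = v) (h6 : s.real 6 0 0 = 0) :
    0 ≤ (clusterDiam.den s).real 6 0 0 ∧
      (∀ x y, f x = v → f y = v → d x y ≤ (clusterDiam.den s).real 6 0 0) ∧
      ∀ W, IsDiamBound d f W → (clusterDiam.den s).real 6 0 0 ≤ W v := by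
  have := Stmt.den_eq_forN₂ clusterDiam rfl (by decide) (by decide)
    (fun S s => Base n k d G s ∧ Rep (s.nat 7) f ∧ s.nat 24 0 0 = v ∧ 0 ≤ s.real 6 0 0 ∧
      (∀ p ∈ S, f p.1 = v → f p.2 = v → d p.1 p.2 ≤ s.real 6 0 0) ∧
      ∀ W, IsDiamBound d f W → s.real 6 0 0 ≤ W v)
    (fun S s u m hu h => by
      rcases hu with rfl | rfl <;> exact ⟨h.1.updateNat (by decide) _ _ _, h.2⟩)
    (fun S s h => h.1.size) ?_
    ⟨hs, hf, hv, h6.ge, by simp, fun W hW => h6 ▸ hW.nonneg v⟩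
  · exact ⟨this.2.2.2.1, fun x y => this.2.2.2.2.1 (x, y) (Finset.mem_univ _),
      this.2.2.2.2.2⟩
  · rintro S x y s - hx hy ⟨hs, hf, hv, h0, hS, hW⟩
    rw [Stmt.den_ifThen]
    simp only [Test.Holds, Test.holds_natEq, NExp.eval, RExp.eval, hx, hy, hv, hf x, hf y,
      Fin.val_inj, hs.dist]
    split_ifs with hc
    · have e : (Stmt.setReal 6 (.const 0) (.const 0) (.cell 0 (.var 22) (.var 23))).den s =
          s.updateReal 6 0 0 (d x y) := by
        simp [Stmt.den, NExp.eval, RExp.eval, hx, hy, hs.dist]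
      have e6 : (s.updateReal 6 0 0 (d x y)).real 6 0 0 = d x y := by
        simp [Store.updateReal_real_self]
      rw [e, e6]
      push Not at hc
      refine ⟨hs.updateReal (by decide) _ _ _, hf, hv, h0.trans hc.2.2.le, fun p hp h1 h2 => ?_,
        fun W hW => ?_⟩
      · rcases Finset.mem_insert.1 hp with rfl | hp
        · exact le_rfl
        · exact (hS p hp h1 h2).trans hc.2.2.le
      · rw [← hc.1]
        exact hW.le x y (hc.1.trans hc.2.1.symm)
    · refine ⟨hs, hf, hv, h0, fun p hp h1 h2 => ?_, hW⟩
      rcases Finset.mem_insert.1 hp with rfl | hp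
      · by_contra hcon
        exact hc ⟨h1, h2, hcon⟩
      · exact hS p hp h1 h2

/-- The computed cost is the sum of the least diameter bounds, hence at most the sum of any `W` that
the analysis provides; the program need not know `W`. -/
theorem den_computeCost {f : Fin n → Fin n} (hs : Base n k d G s) (hf : Rep (s.nat 7) f) :
    ∃ M, IsDiamBound d f M ∧ (computeCost.den s).real 5 0 0 = ∑ v, M v ∧
      ∀ W, IsDiamBound d f W → ∑ v, M v ≤ ∑ v, W v := by
  have := Stmt.den_eq_forN
    (.forN 24 (.seq (.setReal 6 (.const 0) (.const 0) .zero)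
      (.seq clusterDiam (.setReal 5 (.const 0) (.const 0) (.add (.var 5) (.var 6)))))) rfl
    (n := n) (fun S s => Base n k d G s ∧ Rep (s.nat 7) f ∧ ∃ M : Fin n → ℝ,
      s.real 5 0 0 = ∑ v ∈ S, M v ∧ (∀ v, 0 ≤ M v) ∧
      (∀ v ∈ S, ∀ x y, f x = v → f y = v → d x y ≤ M v) ∧
      ∀ v ∈ S, ∀ W, IsDiamBound d f W → M v ≤ W v)
    (fun S s m h => ⟨h.1.updateNat (by decide) _ _ _, h.2⟩) ?_ (s := s.updateReal 5 0 0 0) hs.size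
    ⟨hs.updateReal (by decide) _ _ _, hf, 0, by simp [Store.updateReal_real_self]⟩
  · obtain ⟨-, -, M, hM, h0, hle, hW⟩ := this
    exact ⟨M, ⟨h0, fun x y h => hle _ (Finset.mem_univ _) x y rfl h.symm⟩, hM, fun W h =>
      Finset.sum_le_sum fun v hv => hW v hv W h⟩
  · rintro S v s hvS hv ⟨hs, hf, M, hM, h0, hle, hW⟩
    set s₁ := s.updateReal 6 0 0 0 with hs₁
    have hB₁ : Base n k d G s₁ := hs.updateReal (by decide) _ _ _
    obtain ⟨g0, g1, g2⟩ := den_clusterDiam (s := s₁) (v := v) hB₁ hf hv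
      (by simp [hs₁, Store.updateReal_real_self])
    have e5 : (clusterDiam.den s₁).real 5 = s.real 5 := by
      rw [Stmt.den_real_of_notMem (by decide), hs₁, Store.updateReal_real_of_ne _ (by decide)]
    have e : (Stmt.seq (.setReal 6 (.const 0) (.const 0) .zero)
      (.seq clusterDiam (.setReal 5 (.const 0) (.const 0) (.add (.var 5) (.var 6))))).den s =
      (clusterDiam.den s₁).updateReal 5 0 0 (s.real 5 0 0 + (clusterDiam.den s₁).real 6 0 0) := by
      rw [← e5]; rfl
    rw [e]
    have hM' : ∑ u ∈ S, Function.update M v ((clusterDiam.den s₁).real 6 0 0) u =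
        ∑ u ∈ S, M u :=
      Finset.sum_congr rfl fun u hu => Function.update_of_ne (by rintro rfl; exact hvS hu) _ _
    refine ⟨(hB₁.den (by decide) (by decide)).updateReal (by decide) _ _ _, ?_,
      Function.update M v ((clusterDiam.den s₁).real 6 0 0), ?_, fun u => ?_, fun u hu => ?_,
      fun u hu => ?_⟩
    · rw [Store.updateReal_nat, Stmt.den_nat_of_notMem (by decide)]; exact hf
    · rw [Store.updateReal_real_self, Finset.sum_insert hvS, hM', hM]
      simp [add_comm]
    · by_cases e : u = v
      · subst e; simpa using g0
      · simpa [e] using h0 u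
    · by_cases e : u = v
      · subst e; simpa using g1
      · simpa [e] using hle u ((Finset.mem_insert.1 hu).resolve_left e)
    · by_cases e : u = v
      · subst e; simpa using g2
      · simpa [e] using hW u ((Finset.mem_insert.1 hu).resolve_left e)

/-- Keep the clustering in the array `7` if it has `k` clusters and is cheaper than the best
clustering so far, which is in the array `14`, with cost `var 7`; `var 13` tells whether there
is one. -/
def accept : Stmt :=
  .ifThen (.and (.natEq (.add (.var 12) (.cell 0 (.const 0) (.const 1))) (.var 0))
      (.not (.and (.natLe (.const 1) (.var 13)) (.realLe (.var 7) (.var 5)))))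
    (.seq (.setReal 7 (.const 0) (.const 0) (.var 5))
    (.seq (.setNat 13 (.const 0) (.const 0) (.const 1))
      (.forN 22 (.setNat 14 (.var 22) (.const 0) (.cell 7 (.var 22) (.const 0))))))

/-- Evaluate the labelling in the array `6`. -/
def evaluate : Stmt := .seq join (.seq computeCost accept)

/-- The best clustering so far, if there is one, is feasible and has cost at most `var 7`. -/
def BestFeasible (n k : ℕ) (d : Fin n → Fin n → ℝ) (G : SimpleGraph (Fin n)) (s : Store) : Prop :=
  1 ≤ s.nat 13 0 0 → ∃ (f : Fin n → Fin n) (M : Fin n → ℝ), Rep (s.nat 14) f ∧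
    IsClustering G k f ∧ IsDiamBound d f M ∧ ∑ v, M v ≤ s.real 7 0 0

/-- The best clustering so far exists and has cost at most `b`. -/
def Achieved (b : ℝ) (s : Store) : Prop := 1 ≤ s.nat 13 0 0 ∧ s.real 7 0 0 ≤ b

theorem den_copyBest {f : Fin n → Fin n} (hs : Base n k d G s) (hf : Rep (s.nat 7) f) :
    Rep (((Stmt.forN 22 (.setNat 14 (.var 22) (.const 0)
      (.cell 7 (.var 22) (.const 0)))).den s).nat 14) f := by
  have := Stmt.den_forN (n := n) (v := 22)
    (P := .setNat 14 (.var 22) (.const 0) (.cell 7 (.var 22) (.const 0)))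
    (fun S s => Rep (s.nat 7) f ∧ ∀ x ∈ S, s.nat 14 x 0 = f x) (fun S s m h => h) ?_ hs.size
    ⟨hf, by simp⟩
  · exact fun x => this.2 x (Finset.mem_univ x)
  · rintro S x s hxS hx ⟨hf, h⟩
    refine ⟨hf, fun y hy => ?_⟩
    simp only [Stmt.den, NExp.eval, hx, hf x, Store.updateNat_nat_self]
    rcases Finset.mem_insert.1 hy with rfl | hy
    · simp
    · have : y ≠ x := fun e => hxS (e ▸ hy)
      simpa [Fin.val_inj, this] using h y hy

/-- The first two parts hold for every labelling and make useless labellings harmless. The third is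
the gain from a labelling with connected classes, at most `k` of them: growth turns it into exactly
`k` clusters that obey the same diameter bound. -/
theorem den_evaluate {lab : Fin n → Fin n} (hd : IsDistance d) (hs : Base n k d G s)
    (hr : Rep (s.nat 6) lab) (hidem : ∀ x, lab (lab x) = lab x) (hbest : BestFeasible n k d G s) :
    BestFeasible n k d G (evaluate.den s) ∧
      (∀ b, Achieved b s → Achieved b (evaluate.den s)) ∧
      ((∀ x, Relation.ReflTransGen (fun a b => G.Adj a b ∧ lab a = lab b) (lab x) x) →
        (Finset.univ.filter fun v => lab v = v).card ≤ k → k ≤ n →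
        ∀ W, IsDiamBound d lab W → Achieved (∑ v, W v) (evaluate.den s)) := by
  obtain ⟨m, U, h12, h7, hgr, hcard, hm, hor⟩ := den_join hs hr
  set s₁ := join.den s with hs₁
  have hB₁ : Base n k d G s₁ := hs.den (by decide) (by decide)
  obtain ⟨M, hM, h5, hmin⟩ := den_computeCost hB₁ h7
  set s₂ := computeCost.den s₁ with hs₂
  have hB₂ : Base n k d G s₂ := hB₁.den (by decide) (by decide)
  have e12 : s₂.nat 12 0 0 = m := by rw [hs₂, Stmt.den_nat_of_notMem (by decide), h12]
  have e13 : s₂.nat 13 = s.nat 13 := by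
    rw [hs₂, Stmt.den_nat_of_notMem (by decide), hs₁, Stmt.den_nat_of_notMem (by decide)]
  have e14 : s₂.nat 14 = s.nat 14 := by
    rw [hs₂, Stmt.den_nat_of_notMem (by decide), hs₁, Stmt.den_nat_of_notMem (by decide)]
  have f7 : s₂.real 7 = s.real 7 := by
    rw [hs₂, Stmt.den_real_of_notMem (by decide), hs₁, Stmt.den_real_of_notMem (by decide)]
  have e7 : Rep (s₂.nat 7) fun x => if x ∈ U then lab x else x := by
    rw [hs₂, Stmt.den_nat_of_notMem (by decide)]; exact h7
  have hev : evaluate.den s = accept.den s₂ := rfl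
  -- If growth was not stopped early, all points are joined, and having at most `k` roots means at
  -- least `n - k` joins.
  have hfinal (hc : ∀ x, Relation.ReflTransGen (fun a b => G.Adj a b ∧ lab a = lab b) (lab x) x)
      (hroots : (Finset.univ.filter fun v => lab v = v).card ≤ k) (hk : k ≤ n) : m + k = n := by
    have : n ≤ m + k := by
      rcases hor with h | h
      · exact h
      · have hU := hgr.eq_univ hidem hc h
        rw [hU, Finset.card_univ, Fintype.card_fin] at hcard
        lia
    lia
  rw [hev, accept, Stmt.den_ifThen]
  simp only [Test.Holds, Test.holds_natEq, NExp.eval, RExp.eval, e12, hB₂.num, hB₂.size, e13, f7,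
    h5]
  split_ifs with hc
  · obtain ⟨hmk, hbetter⟩ := hc
    set s₃ := (s₂.updateReal 7 0 0 (∑ v, M v)).updateNat 13 0 0 1 with hs₃
    have e : (Stmt.seq (.setReal 7 (.const 0) (.const 0) (.var 5))
      (.seq (.setNat 13 (.const 0) (.const 0) (.const 1))
        (.forN 22 (.setNat 14 (.var 22) (.const 0) (.cell 7 (.var 22) (.const 0)))))).den s₂ =
      (Stmt.forN 22 (.setNat 14 (.var 22) (.const 0) (.cell 7 (.var 22) (.const 0)))).den s₃ := by
      rw [hs₃, ← h5]; rfl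
    have hB₃ : Base n k d G s₃ := (hB₂.updateReal (by decide) _ _ _).updateNat (by decide) _ _ _
    have hcopy := den_copyBest (s := s₃) hB₃ e7
    have r7 : ((Stmt.forN 22 (.setNat 14 (.var 22) (.const 0)
        (.cell 7 (.var 22) (.const 0)))).den s₃).real 7 0 0 = ∑ v, M v := by
      rw [Stmt.den_real_of_notMem (by decide), hs₃]
      simp [Store.updateReal_real_self]
    have n13 : ((Stmt.forN 22 (.setNat 14 (.var 22) (.const 0)
        (.cell 7 (.var 22) (.const 0)))).den s₃).nat 13 0 0 = 1 := by
      rw [Stmt.den_nat_of_notMem (by decide), hs₃]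
      simp [Store.updateNat_nat_self]
    rw [e]
    refine ⟨fun _ => ⟨_, M, hcopy, hgr.isClustering hidem hcard (by simpa using hmk), hM, r7.ge⟩,
      fun b hb => ⟨n13.ge, ?_⟩, fun _ _ _ W hW => ⟨n13.ge, ?_⟩⟩
    · rw [r7]
      by_contra hcon
      push Not at hcon
      exact hbetter ⟨hb.1, hb.2.trans hcon.le⟩
    · rw [r7]
      exact hmin W (hgr.isDiamBound hd hidem hW)
  · refine ⟨?_, fun b hb => ?_, fun hconn hroots hk W hW => ?_⟩
    · rw [BestFeasible, e13, e14, f7]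
      exact hbest
    · rw [Achieved, e13, f7]
      exact hb
    · have := hfinal hconn hroots hk
      rw [not_and, not_not] at hc
      have := hc this
      rw [Achieved, e13, f7]
      exact ⟨this.1, this.2.trans (hmin W (hgr.isDiamBound hd hidem hW))⟩

end RAM

namespace Clustering

/-- Serves to count the classes of families for which the program has not computed labels. -/
theorem exists_isLabelling {V ι : Type} (B : ι → Set V) (A : Finset ι) :
    ∃ lab : V → V, IsLabelling B A lab := by
  let S : Setoid V := ⟨Linked B A, Relation.EqvGen.is_equivalence _⟩
  have hout (x : V) : (Quotient.mk S (Quotient.mk S x).out) = Quotient.mk S x :=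
    Quotient.out_eq _
  refine ⟨fun x => (Quotient.mk S x).out, fun x => by simp only [hout], fun x y => ?_⟩
  rw [Quotient.out_inj, Quotient.eq]
  exact Iff.rfl

end Clustering

namespace RAM

open Clustering

variable {n k : ℕ} {d : Fin n → Fin n → ℝ} {G : SimpleGraph (Fin n)} {s : Store}

/-! ### The guessed balls -/

/-- Run `P` with the `j`-th guessed ball in the variables `20` and `21`. -/
def atGuess (j : ℕ) (P : Stmt) : Stmt :=
  .seq (.setNat 20 (.const 0) (.const 0) (.var (100 + 2 * j)))
    (.seq (.setNat 21 (.const 0) (.const 0) (.var (101 + 2 * j))) P)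

/-- Run `P` for the guessed balls `0, …, m`. -/
def forGuesses (P : Stmt) : ℕ → Stmt
  | 0 => atGuess 0 P
  | m + 1 => .seq (forGuesses P m) (atGuess (m + 1) P)

/-- The store holds the guesses `g 0, …, g m`. -/
def HasGuesses (g : ℕ → Fin n × Fin n) (m : ℕ) (s : Store) : Prop :=
  ∀ j ≤ m, s.nat (100 + 2 * j) 0 0 = (g j).1 ∧ s.nat (101 + 2 * j) 0 0 = (g j).2

theorem mem_natWrites_forGuesses {P : Stmt} {m a : ℕ} (h : a ∈ (forGuesses P m).natWrites) :
    a = 20 ∨ a = 21 ∨ a ∈ P.natWrites := by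
  induction m with
  | zero => simpa [forGuesses, atGuess, Stmt.natWrites] using h
  | succ m ih =>
    simp only [forGuesses, atGuess, Stmt.natWrites, List.mem_append, List.mem_singleton] at h ih
    tauto

theorem realWrites_forGuesses {P : Stmt} {m a : ℕ} (h : a ∈ (forGuesses P m).realWrites) :
    a ∈ P.realWrites := by
  induction m with
  | zero => simpa [forGuesses, atGuess, Stmt.realWrites] using h
  | succ m ih =>
    simp only [forGuesses, atGuess, Stmt.realWrites, List.mem_append, List.not_mem_nil,
      false_or] at h ih
    tauto

theorem wellFormed_forGuesses {P : Stmt} (hP : P.WellFormed) (m : ℕ) :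
    (forGuesses P m).WellFormed := by
  induction m with
  | zero => simpa [forGuesses, atGuess, Stmt.WellFormed] using hP
  | succ m ih => simp [forGuesses, atGuess, Stmt.WellFormed, hP, ih]

theorem HasGuesses.den {g : ℕ → Fin n × Fin n} {m : ℕ} (h : HasGuesses g m s) {P : Stmt}
    (hP : ∀ a ∈ P.natWrites, a < 100) : HasGuesses g m (P.den s) := by
  intro j hj
  rw [Stmt.den_nat_of_notMem (fun h => absurd (hP _ h) (by lia)),
    Stmt.den_nat_of_notMem (fun h => absurd (hP _ h) (by lia))]
  exact h j hj

/-- The guesses as a set. -/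
def guesses (g : ℕ → Fin n × Fin n) (m : ℕ) : Finset (Fin n × Fin n) :=
  (Finset.range (m + 1)).image g

theorem guesses_succ (g : ℕ → Fin n × Fin n) (m : ℕ) :
    guesses g (m + 1) = insert (g (m + 1)) (guesses g m) := by
  rw [guesses, Finset.range_add_one, Finset.image_insert, guesses]

/-- The rule for `forGuesses`. -/
theorem den_forGuesses (I : Finset (Fin n × Fin n) → Store → Prop) {P : Stmt}
    {g : ℕ → Fin n × Fin n} {m : ℕ} (hP : ∀ a ∈ P.natWrites, a < 100)
    (hI : ∀ S s a x, a = 20 ∨ a = 21 → I S s → I S (s.updateNat a 0 0 x))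
    (step : ∀ S p s, s.nat 20 0 0 = (p.1 : ℕ) → s.nat 21 0 0 = (p.2 : ℕ) → I S s →
      I (insert p S) (P.den s))
    (hg : HasGuesses g m s) (h : I ∅ s) : I (guesses g m) ((forGuesses P m).den s) := by
  have one (S : Finset (Fin n × Fin n)) (j : ℕ) (hj : j ≤ m) (s : Store) (hg : HasGuesses g m s)
      (h : I S s) : I (insert (g j) S) ((atGuess j P).den s) := by
    have e : (atGuess j P).den s =
        P.den ((s.updateNat 20 0 0 (g j).1).updateNat 21 0 0 (g j).2) := by
      simp only [atGuess, Stmt.den, NExp.eval]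
      rw [Store.updateNat_nat_of_ne _ (by lia), (hg j hj).1, (hg j hj).2]
    rw [e]
    exact step _ _ _ rfl rfl (hI _ _ _ _ (.inr rfl) (hI _ _ _ _ (.inl rfl) h))
  have hw (a m : ℕ) (h : a ∈ (forGuesses P m).natWrites) : a < 100 := by
    rcases mem_natWrites_forGuesses h with rfl | rfl | h
    · lia
    · lia
    · exact hP a h
  have key (i : ℕ) (hi : i ≤ m) : I (guesses g i) ((forGuesses P i).den s) := by
    induction i with
    | zero => simpa [guesses, forGuesses] using one ∅ 0 hi s hg h
    | succ i ih =>
      rw [guesses_succ]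
      exact one _ _ hi _ (hg.den fun a => hw a i) (ih (by lia))
  exact key m le_rfl

/-- Mark the points of the ball with center `var 20` and boundary point `var 21`. -/
def markBall : Stmt := .forN 22 (.ifThen (inBall (.var 22)) (.setNat 5 (.var 22) (.const 0)
  (.const 1)))

/-- Mark the points that are in a guessed ball. -/
def markCovered (m : ℕ) : Stmt :=
  .seq (.forN 22 (.setNat 5 (.var 22) (.const 0) (.const 0))) (forGuesses markBall m)

theorem den_markCovered {g : ℕ → Fin n × Fin n} {m : ℕ} (hs : Base n k d G s)
    (hg : HasGuesses g m s) (x : Fin n) : 1 ≤ ((markCovered m).den s).nat 5 x 0 ↔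
      ∃ p ∈ guesses g m, x ∈ connBall d G p := by
  set C : Stmt := .forN 22 (.setNat 5 (.var 22) (.const 0) (.const 0)) with hC
  have h0 : ∀ x : Fin n, (C.den s).nat 5 x 0 = 0 := by
    have := Stmt.den_eq_forN C rfl (n := n) (fun S s => ∀ x ∈ S, s.nat 5 x 0 = 0)
      (fun S s m h => h) ?_ hs.size (by simp)
    · exact fun x => this x (Finset.mem_univ x)
    · rintro S x s - hx h y hy
      simp only [Stmt.den, NExp.eval, hx, Store.updateNat_nat_self]
      rcases Finset.mem_insert.1 hy with rfl | hy
      · simp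
      · simp [h y hy]
  have e : (markCovered m).den s = (forGuesses markBall m).den (C.den s) := rfl
  rw [e]
  have := den_forGuesses (g := g) (m := m) (s := C.den s) (P := markBall)
    (fun S s => Base n k d G s ∧ ∀ x : Fin n, 1 ≤ s.nat 5 x 0 ↔ ∃ p ∈ S, x ∈ connBall d G p)
    (by decide)
    (fun S s a x ha h => by
      rcases ha with rfl | rfl <;> exact ⟨h.1.updateNat (by decide) _ _ _, h.2⟩) ?_
    (hg.den (by decide)) ⟨hs.den (by decide) (by decide), by simp [h0]⟩
  · exact this.2 x
  · rintro S ⟨v, w⟩ s hv hw ⟨hs, h⟩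
    refine ⟨hs.den (by decide) (by decide), ?_⟩
    have := Stmt.den_eq_forN markBall rfl (n := n) (fun T s => Base n k d G s ∧
      s.nat 20 0 0 = v ∧ s.nat 21 0 0 = w ∧
      ∀ x : Fin n, 1 ≤ s.nat 5 x 0 ↔ (∃ p ∈ S, x ∈ connBall d G p) ∨
        x ∈ T ∧ x ∈ connBall d G (v, w)) (fun S s m h => ⟨h.1.updateNat (by decide) _ _ _, h.2⟩)
      ?_ hs.size ⟨hs, hv, hw, by simpa using h⟩
    · intro x
      rw [this.2.2.2 x, Finset.exists_mem_insert]
      simp [or_comm]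
    · rintro T x s hxT hx ⟨hs, hv, hw, h⟩
      rw [Stmt.den_ifThen, hs.holds_inBall (e := .var 22) hv hw hx]
      split_ifs with hc
      · refine ⟨hs.updateNat (by decide) _ _ _, hv, hw, fun y => ?_⟩
        simp only [Stmt.den, NExp.eval, hx, Store.updateNat_nat_self, and_true, Fin.val_inj]
        by_cases e : y = x
        · simp [e, hc]
        · simp only [e, if_false, h, Finset.mem_insert, false_or]
      · refine ⟨hs, hv, hw, fun y => ?_⟩
        rw [h]
        by_cases e : y = x
        · simp [e, hc, hxT]
        · simp [e]

/-- The discrete labelling. -/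
def initLabels : Stmt := .forN 22 (.setNat 6 (.var 22) (.const 0) (.var 22))

theorem den_initLabels (hs : Base n k d G s) :
    Rep ((initLabels.den s).nat 6) (fun x : Fin n => x) := by
  have := Stmt.den_eq_forN initLabels rfl (n := n) (fun S s => ∀ x ∈ S, s.nat 6 x 0 = x)
    (fun S s m h => h) ?_ hs.size (by simp)
  · exact fun x => this x (Finset.mem_univ x)
  · rintro S x s - hx h y hy
    simp only [Stmt.den, NExp.eval, hx, Store.updateNat_nat_self]
    rcases Finset.mem_insert.1 hy with rfl | hy
    · simp
    · by_cases e : y = x <;> simp [e, h y hy, Fin.val_inj]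

theorem isLabelling_empty {V ι : Type} (B : ι → Set V) :
    IsLabelling B ∅ (fun x => x) := by
  refine ⟨fun _ => rfl, fun x y => ⟨fun h => h ▸ .refl _, fun h => ?_⟩⟩
  induction h with
  | rel x y h => simp at h
  | refl => rfl
  | symm _ _ _ ih => exact ih.symm
  | trans _ _ _ _ _ ih ih' => exact ih.trans ih'

/-- Every stage starts afresh from singletons and the guessed balls, since balls that were tight
before need not remain tight. -/
theorem den_labelGuesses {g : ℕ → Fin n × Fin n} {m : ℕ} (hs : Base n k d G s)
    (hg : HasGuesses g m s) : ∃ lab, Rep (((forGuesses unionBall m).den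
      (initLabels.den s)).nat 6) lab ∧ IsLabelling (connBall d G) (guesses g m) lab := by
  have := den_forGuesses (g := g) (m := m) (s := initLabels.den s) (P := unionBall) (fun S s =>
    Base n k d G s ∧ ∃ lab, Rep (s.nat 6) lab ∧ IsLabelling (connBall d G) S lab) (by decide)
    (fun S s a x ha h => by
      rcases ha with rfl | rfl <;> exact ⟨h.1.updateNat (by decide) _ _ _, h.2⟩) ?_
    (hg.den (by decide)) ⟨hs.den (by decide) (by decide), _, den_initLabels hs,
      isLabelling_empty _⟩
  · exact this.2
  · rintro S ⟨v, w⟩ s hv hw ⟨hs, lab, hr, hlab⟩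
    exact ⟨hs.den (by decide) (by decide), den_unionBall hs hv hw hr hlab⟩

/-! ### Tight balls -/

/-- The entry `p` of the slack table. -/
def slackOf (s : Store) (p : Fin n × Fin n) : ℝ := s.real 2 p.1 p.2

/-- The ball with center `var 20` and boundary point `var 21` has radius at most `var 3`. -/
abbrev isSmall : Test := .realLe (.cell 0 (.var 20) (.var 21)) (.var 3)

/-- The ball with center `var 20` and boundary point `var 21` is small and tight. -/
abbrev isTight : Test := .and isSmall (.realLe (.cell 2 (.var 20) (.var 21)) .zero)

open Classical in
/-- The small tight balls. -/
noncomputable def tight (d : Fin n → Fin n → ℝ) (R : ℝ) (σ : Fin n × Fin n → ℝ) :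
    Finset (Fin n × Fin n) :=
  Finset.univ.filter fun p => d p.1 p.2 ≤ R ∧ σ p ≤ 0

theorem mem_tight {R : ℝ} {σ : Fin n × Fin n → ℝ} {p : Fin n × Fin n} :
    p ∈ tight d R σ ↔ d p.1 p.2 ≤ R ∧ σ p ≤ 0 := by simp [tight]

theorem Base.holds_isTight (hs : Base n k d G s) {v w : Fin n} (hv : s.nat 20 0 0 = v)
    (hw : s.nat 21 0 0 = w) {σ : Fin n × Fin n → ℝ} (hσ : slackOf s = σ) :
    isTight.Holds s ↔ (v, w) ∈ tight d (s.real 3 0 0) σ := by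
  subst hσ
  simp only [mem_tight, Test.Holds, RExp.eval, NExp.eval, hv, hw, hs.dist, slackOf]

/-- Merge the classes that meet small tight balls. -/
def labelTight : Stmt := .forN 20 (.forN 21 (.ifThen isTight unionBall))

/-- Merge the classes that meet small tight balls one by one, and evaluate all labellings. -/
def labelTightEval : Stmt := .forN 20 (.forN 21 (.ifThen isTight (.seq unionBall evaluate)))

theorem den_labelTight {lab : Fin n → Fin n} {A : Finset (Fin n × Fin n)} (hs : Base n k d G s)
    (hr : Rep (s.nat 6) lab) (hlab : IsLabelling (connBall d G) A lab) :
    ∃ lab', Rep ((labelTight.den s).nat 6) lab' ∧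
      IsLabelling (connBall d G) (A ∪ tight d (s.real 3 0 0) (slackOf s)) lab' := by
  have := Stmt.den_eq_forN₂ labelTight rfl (by decide) (by decide) (fun S s' => Base n k d G s' ∧
    s'.real = s.real ∧ ∃ lab, Rep (s'.nat 6) lab ∧
      IsLabelling (connBall d G) (A ∪ tight d (s.real 3 0 0) (slackOf s) ∩ S) lab)
    (fun S s u m hu h => by
      rcases hu with rfl | rfl <;> exact ⟨h.1.updateNat (by decide) _ _ _, h.2⟩)
    (fun S s h => h.1.size) ?_ ⟨hs, rfl, lab, hr, by simpa using hlab⟩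
  · simpa using this.2.2
  · rintro S v w s' - hv hw ⟨hs, hreal, lab, hr, hlab⟩
    have hσ : (slackOf s' : Fin n × Fin n → ℝ) = slackOf s := by
      funext p; rw [slackOf, hreal, slackOf]
    rw [Stmt.den_ifThen, hs.holds_isTight hv hw hσ, hreal]
    split_ifs with hc
    · refine ⟨hs.den (by decide) (by decide), ?_, ?_⟩
      · funext a
        rw [Stmt.den_real_of_notMem (P := unionBall)
          (by simp [unionBall, relabel, Stmt.realWrites]),
          hreal]
      · obtain ⟨lab', hr', hlab'⟩ := den_unionBall hs hv hw hr hlab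
        refine ⟨lab', hr', ?_⟩
        rwa [Finset.inter_insert_of_mem hc, Finset.union_insert]
    · rw [Finset.inter_insert_of_notMem hc]
      exact ⟨hs, hreal, lab, hr, hlab⟩

/-- The number of classes. -/
abbrev numClasses (lab : Fin n → Fin n) : ℕ := (Finset.univ.filter fun v => lab v = v).card

/-- The crossing argument. With more than `k` classes before, either this persists to the end, or
one ball lowers the number to at most `k`. In the second case the labelling before that ball obeys
the assumed bound, and the next one is evaluated. The bound `b` is universally quantified because
only the analysis knows it. -/
theorem den_labelTightEval (hd : IsDistance d) {lab : Fin n → Fin n}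
    {A : Finset (Fin n × Fin n)} (hs : Base n k d G s) (hr : Rep (s.nat 6) lab)
    (hlab : IsLabelling (connBall d G) A lab) (hbest : BestFeasible n k d G s)
    {R : ℝ} (hR : s.real 3 0 0 = R) {T : Finset (Fin n × Fin n)}
    (hT : T = tight d R (slackOf s)) :
    BestFeasible n k d G (labelTightEval.den s) ∧
      (∀ b, Achieved b s → Achieved b (labelTightEval.den s)) ∧
      ∀ b, k ≤ n → (Achieved b s ∨ k < numClasses lab) →
        (∀ A' lab', A ⊆ A' → A' ⊆ A ∪ T → IsLabelling (connBall d G) A' lab' →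
          k < numClasses lab' → ∃ W, IsDiamBound d lab' W ∧ ∑ v, W v + 2 * R ≤ b) →
        Achieved b (labelTightEval.den s) ∨
          ∃ lab', IsLabelling (connBall d G) (A ∪ T) lab' ∧ k < numClasses lab' := by
  have := Stmt.den_eq_forN₂ labelTightEval rfl (by decide) (by decide) (fun S s' =>
    Base n k d G s' ∧ s'.real 2 = s.real 2 ∧ s'.real 3 = s.real 3 ∧ BestFeasible n k d G s' ∧
    (∀ b, Achieved b s → Achieved b s') ∧
    ∃ lab', Rep (s'.nat 6) lab' ∧ IsLabelling (connBall d G) (A ∪ T ∩ S) lab' ∧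
    ∀ b, k ≤ n → (Achieved b s ∨ k < numClasses lab) →
      (∀ A' lab', A ⊆ A' → A' ⊆ A ∪ T → IsLabelling (connBall d G) A' lab' →
        k < numClasses lab' → ∃ W, IsDiamBound d lab' W ∧ ∑ v, W v + 2 * R ≤ b) →
      Achieved b s' ∨ k < numClasses lab')
    (fun S s u m hu h => by
      rcases hu with rfl | rfl <;> exact ⟨h.1.updateNat (by decide) _ _ _, h.2⟩)
    (fun S s h => h.1.size) ?_
    ⟨hs, rfl, rfl, hbest, fun _ h => h, lab, hr, by simpa using hlab, fun b _ h _ => h⟩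
  · obtain ⟨-, -, -, hbest', hach, lab', -, hlab', h⟩ := this
    refine ⟨hbest', hach, fun b hk h1 h2 => (h b hk h1 h2).imp_right fun h => ⟨lab', ?_, h⟩⟩
    simpa using hlab'
  · rintro S v w s' - hv hw ⟨hs, h2, h3, hbest, hach, lab', hr, hlab', hb⟩
    have hσ : (slackOf s' : Fin n × Fin n → ℝ) = slackOf s := by
      funext p; rw [slackOf, h2, slackOf]
    rw [Stmt.den_ifThen, hs.holds_isTight hv hw hσ, h3, hR, ← hT]
    split_ifs with hc
    · set s₁ := unionBall.den s' with hs₁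
      have hB₁ : Base n k d G s₁ := hs.den (by decide) (by decide)
      obtain ⟨lab₁, hr₁, hlab₁⟩ := den_unionBall hs hv hw hr hlab'
      have e13 : s₁.nat 13 = s'.nat 13 := by rw [hs₁, Stmt.den_nat_of_notMem (by decide)]
      have e14 : s₁.nat 14 = s'.nat 14 := by rw [hs₁, Stmt.den_nat_of_notMem (by decide)]
      have e7 : s₁.real 7 = s'.real 7 := by rw [hs₁, Stmt.den_real_of_notMem (by decide)]
      have hbest₁ : BestFeasible n k d G s₁ := by
        rw [BestFeasible, e13, e14, e7]; exact hbest
      have hach₁ (b : ℝ) : Achieved b s₁ ↔ Achieved b s' := by rw [Achieved, Achieved, e13, e7]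
      obtain ⟨g1, g2, g3⟩ := den_evaluate hd hB₁ hr₁ hlab₁.idem hbest₁
      have e : (Stmt.seq unionBall evaluate).den s' = evaluate.den s₁ := rfl
      rw [e]
      refine ⟨hB₁.den (by decide) (by decide), ?_, ?_, g1,
        fun b h => g2 b ((hach₁ b).2 (hach b h)), lab₁, ?_, ?_, fun b hk hor hH => ?_⟩
      · rw [Stmt.den_real_of_notMem (by decide), hs₁, Stmt.den_real_of_notMem (by decide), h2]
      · rw [Stmt.den_real_of_notMem (by decide), hs₁, Stmt.den_real_of_notMem (by decide), h3]
      · rw [Stmt.den_nat_of_notMem (by decide)]; exact hr₁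
      · rwa [Finset.inter_insert_of_mem hc, Finset.union_insert]
      · rcases hb b hk hor hH with h | h
        · exact .inl (g2 b ((hach₁ b).2 h))
        · by_contra hcon
          push Not at hcon
          obtain ⟨W, hW, hle⟩ := hH _ lab' Finset.subset_union_left
            (Finset.union_subset_union_right Finset.inter_subset_left) hlab' h
          have hsmall : d v w ≤ R := (mem_tight.1 (hT ▸ hc)).1
          -- The ball of the crossing is small, so its diameter is at most `2 * R`, which the
          -- assumed bound has in reserve.
          obtain ⟨W', hW', hle'⟩ := hW.merge hd (p := (v, w)) (ρ := 2 * d v w)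
            (by have := hd.nonneg v w; linarith) (connBall_nonempty _)
            (dist_le_of_mem_connBall₂ hd _) hlab' hlab₁
          have := g3 (fun x => hlab₁.reflTransGen (hlab₁.idem x)) hcon.2 hk W' hW'
          exact hcon.1 ⟨this.1, this.2.trans (by linarith)⟩
    · rw [Finset.inter_insert_of_notMem hc]
      exact ⟨hs, h2, h3, hbest, hach, lab', hr, hlab', hb⟩

end RAM

namespace RAM

open Clustering

variable {n k : ℕ} {d : Fin n → Fin n → ℝ} {G : SimpleGraph (Fin n)} {s : Store}

/-! ### Raising the dual values -/

/-- Add the number `var 3` to all slacks. -/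
def raiseMultiplier : Stmt :=
  .forN 20 (.forN 21 (.setReal 2 (.var 20) (.var 21) (.add (.cell 2 (.var 20) (.var 21)) (.var 3))))

/-- Decrease `var 4` to the least slack of a small ball that contains `var 24`. -/
def minSlack : Stmt :=
  .forN 20 (.forN 21 (.ifThen (.and isSmall (.and (inBall (.var 24))
    (.not (.realLe (.var 4) (.cell 2 (.var 20) (.var 21))))))
    (.setReal 4 (.const 0) (.const 0) (.cell 2 (.var 20) (.var 21)))))

/-- Subtract `var 4` from the slacks of the balls that contain `var 24`. -/
def subSlack : Stmt :=
  .forN 20 (.forN 21 (.ifThen (inBall (.var 24))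
    (.setReal 2 (.var 20) (.var 21) (.sub (.cell 2 (.var 20) (.var 21)) (.var 4)))))

/-- Raise the dual value of `var 24` as far as possible, if this point is not marked. -/
def raisePoint : Stmt :=
  .ifThen (.not (.natLe (.const 1) (.cell 5 (.var 24) (.const 0))))
    (.seq (.setReal 4 (.const 0) (.const 0) (.cell 2 (.var 24) (.var 24)))
      (.seq minSlack subSlack))

/-- Raise the multiplier by `var 3`, then the dual values of the points as far as possible. -/
def raise : Stmt := .seq raiseMultiplier (.forN 24 raisePoint)

theorem den_raiseMultiplier (hs : Base n k d G s) (p : Fin n × Fin n) :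
    slackOf (raiseMultiplier.den s) p = slackOf s p + s.real 3 0 0 := by
  have := Stmt.den_eq_forN₂ raiseMultiplier rfl (by decide) (by decide) (fun S s' =>
    Base n k d G s' ∧ s'.real 3 = s.real 3 ∧ ∀ p : Fin n × Fin n, slackOf s' p =
      if p ∈ S then slackOf s p + s.real 3 0 0 else slackOf s p)
    (fun S s u m hu h => by
      rcases hu with rfl | rfl <;> exact ⟨h.1.updateNat (by decide) _ _ _, h.2⟩)
    (fun S s h => h.1.size) ?_ ⟨hs, rfl, by simp⟩
  · simpa using this.2.2 p
  · rintro S v w s' hvw hv hw ⟨hs, h3, h⟩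
    refine ⟨hs.updateReal (by decide) _ _ _, h3, fun q => ?_⟩
    have h' := h (v, w)
    rw [if_neg hvw] at h'
    simp only [Stmt.den, NExp.eval, RExp.eval, hv, hw, h3]
    by_cases e : q = (v, w)
    · subst e
      rw [if_pos (Finset.mem_insert_self _ _), ← h']
      simp [slackOf, Store.updateReal_real_self]
    · have : ¬ ((q.1 : ℕ) = v ∧ (q.2 : ℕ) = w) := fun h =>
        e (Prod.ext (Fin.ext h.1) (Fin.ext h.2))
      simp only [Finset.mem_insert, e, false_or]
      rw [← h q]
      simp [slackOf, Store.updateReal_real_self, this]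

/-- The start value must be the slack of an admissible ball, so that the minimum is attained and
some ball becomes tight. -/
theorem den_minSlack {x : Fin n} (hs : Base n k d G s) (hx : s.nat 24 0 0 = x)
    (h4 : ∃ p : Fin n × Fin n, d p.1 p.2 ≤ s.real 3 0 0 ∧ x ∈ connBall d G p ∧
      slackOf s p = s.real 4 0 0) :
    (∃ p : Fin n × Fin n, d p.1 p.2 ≤ s.real 3 0 0 ∧ x ∈ connBall d G p ∧
      slackOf s p = (minSlack.den s).real 4 0 0) ∧
    ∀ p : Fin n × Fin n, d p.1 p.2 ≤ s.real 3 0 0 → x ∈ connBall d G p →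
      (minSlack.den s).real 4 0 0 ≤ slackOf s p := by
  have := Stmt.den_eq_forN₂ minSlack rfl (by decide) (by decide) (fun S s' =>
    Base n k d G s' ∧ s'.nat 24 0 0 = x ∧ s'.real 3 = s.real 3 ∧ s'.real 2 = s.real 2 ∧
    (∃ p : Fin n × Fin n, d p.1 p.2 ≤ s.real 3 0 0 ∧ x ∈ connBall d G p ∧
      slackOf s p = s'.real 4 0 0) ∧
    ∀ p ∈ S, d p.1 p.2 ≤ s.real 3 0 0 → x ∈ connBall d G p → s'.real 4 0 0 ≤ slackOf s p)
    (fun S s u m hu h => by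
      rcases hu with rfl | rfl <;> exact ⟨h.1.updateNat (by decide) _ _ _, h.2⟩)
    (fun S s h => h.1.size) ?_ ⟨hs, hx, rfl, rfl, h4, by simp⟩
  · exact ⟨this.2.2.2.2.1, fun p => this.2.2.2.2.2 p (Finset.mem_univ p)⟩
  · rintro S v w s' - hv hw ⟨hs, hx, h3, h2, hex, hle⟩
    have hhold : (Test.and isSmall (.and (inBall (.var 24))
        (.not (.realLe (.var 4) (.cell 2 (.var 20) (.var 21)))))).Holds s' ↔
        d v w ≤ s.real 3 0 0 ∧ x ∈ connBall d G (v, w) ∧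
          slackOf s (v, w) < s'.real 4 0 0 := by
      have := hs.holds_inBall (e := .var 24) hv hw hx
      simp only [Test.Holds] at this ⊢
      rw [this]
      simp only [RExp.eval, NExp.eval, hv, hw, hs.dist, h3, h2, slackOf, not_le]
    rw [Stmt.den_ifThen, hhold]
    split_ifs with hc
    · have e : (Stmt.setReal 4 (.const 0) (.const 0) (.cell 2 (.var 20) (.var 21))).den s' =
          s'.updateReal 4 0 0 (slackOf s (v, w)) := by
        simp [Stmt.den, RExp.eval, NExp.eval, hv, hw, h2, slackOf]
      have e4 : (s'.updateReal 4 0 0 (slackOf s (v, w))).real 4 0 0 = slackOf s (v, w) := by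
        simp [Store.updateReal_real_self]
      rw [e, e4]
      refine ⟨hs.updateReal (by decide) _ _ _, hx, h3, h2, ⟨(v, w), hc.1, hc.2.1, rfl⟩,
        fun p hp h1 h2 => ?_⟩
      rcases Finset.mem_insert.1 hp with rfl | hp
      · exact le_rfl
      · exact hc.2.2.le.trans (hle p hp h1 h2)
    · refine ⟨hs, hx, h3, h2, hex, fun p hp h1 h2 => ?_⟩
      rcases Finset.mem_insert.1 hp with rfl | hp
      · by_contra hcon
        exact hc ⟨h1, h2, not_le.1 hcon⟩
      · exact hle p hp h1 h2

open Classical in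
theorem den_subSlack {x : Fin n} (hs : Base n k d G s) (hx : s.nat 24 0 0 = x)
    (p : Fin n × Fin n) : slackOf (subSlack.den s) p =
      if x ∈ connBall d G p then slackOf s p - s.real 4 0 0 else slackOf s p := by
  have := Stmt.den_eq_forN₂ subSlack rfl (by decide) (by decide) (fun S s' =>
    Base n k d G s' ∧ s'.nat 24 0 0 = x ∧ s'.real 4 = s.real 4 ∧
    ∀ p : Fin n × Fin n, slackOf s' p =
      if p ∈ S ∧ x ∈ connBall d G p then slackOf s p - s.real 4 0 0 else slackOf s p)
    (fun S s u m hu h => by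
      rcases hu with rfl | rfl <;> exact ⟨h.1.updateNat (by decide) _ _ _, h.2⟩)
    (fun S s h => h.1.size) ?_ ⟨hs, hx, rfl, by simp⟩
  · simpa using this.2.2.2 p
  · rintro S v w s' hvw hv hw ⟨hs, hx, h4, h⟩
    have h' := h (v, w)
    rw [if_neg (fun h => hvw h.1)] at h'
    rw [Stmt.den_ifThen, hs.holds_inBall (e := .var 24) hv hw hx]
    split_ifs with hc
    · have e : (Stmt.setReal 2 (.var 20) (.var 21)
          (.sub (.cell 2 (.var 20) (.var 21)) (.var 4))).den s' =
          s'.updateReal 2 v w (slackOf s (v, w) - s.real 4 0 0) := by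
        rw [← h']
        simp [Stmt.den, RExp.eval, NExp.eval, hv, hw, h4, slackOf]
      rw [e]
      refine ⟨hs.updateReal (by decide) _ _ _, hx, h4, fun q => ?_⟩
      by_cases e : q = (v, w)
      · subst e
        simp [slackOf, Store.updateReal_real_self, hc]
      · have hne : ¬ ((q.1 : ℕ) = v ∧ (q.2 : ℕ) = w) := fun h =>
          e (Prod.ext (Fin.ext h.1) (Fin.ext h.2))
        simp only [Finset.mem_insert, e, false_or]
        rw [← h q]
        simp [slackOf, Store.updateReal_real_self, hne]
    · refine ⟨hs, hx, h4, fun q => ?_⟩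
      rw [h]
      by_cases e : q = (v, w)
      · subst e; simp [hc]
      · simp [e]

/-- The slacks `σ` are those of a feasible dual solution with multiplier `l`, for the sets of
radius at most `R`, in which the points of the balls in `Γ` have value zero. -/
structure DualFeasible (d : Fin n → Fin n → ℝ) (G : SimpleGraph (Fin n))
    (Γ : Finset (Fin n × Fin n)) (R l : ℝ) (y : Fin n → ℝ) (σ : Fin n × Fin n → ℝ) :
    Prop where
  slack : IsSlack (connBall d G) (fun p => d p.1 p.2) n l y σ
  nonneg : ∀ p : Fin n × Fin n, d p.1 p.2 ≤ R → 0 ≤ σ p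
  zero : ∀ x, ∀ p ∈ Γ, x ∈ connBall d G p → y x = 0

/-- Every point that is not in a ball in `Γ` is in a small tight ball. -/
def Saturated (d : Fin n → Fin n → ℝ) (G : SimpleGraph (Fin n)) (Γ : Finset (Fin n × Fin n))
    (R : ℝ) (σ : Fin n × Fin n → ℝ) (x : Fin n) : Prop :=
  (∃ p ∈ Γ, x ∈ connBall d G p) ∨ ∃ p ∈ tight d R σ, x ∈ connBall d G p

/-- Raising by the least slack keeps the constraints of all small balls and makes the minimizing
ball tight. Larger balls may be violated, which is harmless since they are never used unless
guessed. Points in guessed balls are skipped and keep the value zero. -/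
theorem den_raisePoint (hd : IsDistance d) {x : Fin n} {Γ : Finset (Fin n × Fin n)} {R l : ℝ}
    {y : Fin n → ℝ} (hs : Base n k d G s) (hx : s.nat 24 0 0 = x) (hR : s.real 3 0 0 = R)
    (hR0 : 0 ≤ R) (hcov : ∀ x : Fin n, 1 ≤ s.nat 5 x 0 ↔ ∃ p ∈ Γ, x ∈ connBall d G p)
    (hy : DualFeasible d G Γ R l y (slackOf s)) :
    ∃ y', DualFeasible d G Γ R l y' (slackOf (raisePoint.den s)) ∧
      (∀ p, d p.1 p.2 ≤ R →
        slackOf (raisePoint.den s) p ≤ slackOf (n := n) s p) ∧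
      Saturated d G Γ R (slackOf (raisePoint.den s)) x := by
  classical
  have hhold : (Test.not (.natLe (.const 1) (.cell 5 (.var 24) (.const 0)))).Holds s ↔
      ¬ ∃ p ∈ Γ, x ∈ connBall d G p := by
    rw [← hcov]; simp only [Test.Holds, NExp.eval, hx]
  rw [raisePoint, Stmt.den_ifThen, hhold]
  split_ifs with hc
  · exact ⟨y, hy, fun _ _ => le_rfl, .inl hc⟩
  set s₁ := s.updateReal 4 0 0 (slackOf s (x, x)) with hs₁
  have hB₁ : Base n k d G s₁ := hs.updateReal (by decide) _ _ _
  have hσ₁ : (slackOf s₁ : Fin n × Fin n → ℝ) = slackOf s := rfl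
  have h3₁ : s₁.real 3 0 0 = R := hR
  have h4₁ : s₁.real 4 0 0 = slackOf s (x, x) := by simp [hs₁, Store.updateReal_real_self]
  -- The ball `(x, x)` has radius zero, so there is always a small ball to start with.
  obtain ⟨⟨q, hqR, hqx, hq⟩, hmin⟩ := den_minSlack (s := s₁) hB₁ hx
    ⟨(x, x), by rw [h3₁]; simpa [hd.self] using hR0, fst_mem_connBall _, by rw [hσ₁, h4₁]⟩
  set s₂ := minSlack.den s₁ with hs₂
  have hB₂ : Base n k d G s₂ := hB₁.den (by decide) (by decide)
  have hx₂ : s₂.nat 24 0 0 = x := by rw [hs₂, Stmt.den_nat_of_notMem (by decide)]; exact hx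
  have hσ₂ : (slackOf s₂ : Fin n × Fin n → ℝ) = slackOf s := by
    funext p
    rw [slackOf, hs₂, Stmt.den_real_of_notMem (by decide)]; rfl
  have hsub := den_subSlack hB₂ hx₂
  set δ := s₂.real 4 0 0
  rw [h3₁, hσ₁] at hmin
  rw [h3₁] at hqR
  rw [hσ₁] at hq
  have hδ : 0 ≤ δ := hq ▸ hy.nonneg q hqR
  have e : (Stmt.seq (.setReal 4 (.const 0) (.const 0) (.cell 2 (.var 24) (.var 24)))
      (.seq minSlack subSlack)).den s = subSlack.den s₂ := by
    simp [Stmt.den, hs₂, hs₁, NExp.eval, RExp.eval, hx, slackOf]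
  rw [e]
  simp only [hσ₂] at hsub
  refine ⟨Function.update y x (y x + δ), ⟨⟨fun z => ?_, fun p => ?_⟩, fun p hp => ?_,
    fun z p hp hz => ?_⟩, fun p _ => ?_, .inr ⟨q, mem_tight.2 ⟨hqR, ?_⟩, hqx⟩⟩
  · by_cases e : z = x
    · subst e
      have := hy.slack.nonneg z
      simp only [Function.update_self]
      linarith
    · simpa [e] using hy.slack.nonneg z
  · rw [hsub, hy.slack.eq]
    split_ifs with hxp
    · have hmem : x ∈ Finset.univ.filter fun x => x ∈ connBall d G p := by simpa using hxp
      rw [Finset.sum_update_of_mem hmem, Finset.sum_eq_add_sum_sdiff_singleton_of_mem hmem y]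
      ring
    · rw [Finset.sum_update_of_notMem (by simpa using hxp)]
  · rw [hsub]
    split_ifs with hxp
    · linarith [hmin p hp hxp]
    · exact hy.nonneg p hp
  · have : z ≠ x := by rintro rfl; exact hc ⟨p, hp, hz⟩
    rw [Function.update_of_ne this]
    exact hy.zero z p hp hz
  · rw [hsub]
    split_ifs
    · linarith
    · exact le_rfl
  · rw [hsub, if_pos hqx, hq, sub_self]

theorem Saturated.mono {Γ : Finset (Fin n × Fin n)} {R : ℝ} {σ σ' : Fin n × Fin n → ℝ}
    {x : Fin n} (h : Saturated d G Γ R σ x) (hσ : ∀ p, d p.1 p.2 ≤ R → σ' p ≤ σ p) :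
    Saturated d G Γ R σ' x := by
  refine h.imp_right fun ⟨p, hp, hx⟩ => ⟨p, ?_, hx⟩
  rw [mem_tight] at hp ⊢
  exact ⟨hp.1, (hσ p hp.1).trans hp.2⟩

/-- The multiplier adds `R` to each slack, and raising points only lowers the slacks of small balls.
Hence the slack grows by at most `R`, and a point that is saturated once stays so. -/
theorem den_raise (hd : IsDistance d) {Γ : Finset (Fin n × Fin n)} {R l : ℝ}
    {y : Fin n → ℝ} (hs : Base n k d G s) (hR : s.real 3 0 0 = R)
    (hR0 : 0 ≤ R) (hcov : ∀ x : Fin n, 1 ≤ s.nat 5 x 0 ↔ ∃ p ∈ Γ, x ∈ connBall d G p)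
    (hy : DualFeasible d G Γ R l y (slackOf s)) :
    ∃ y', DualFeasible d G Γ R (l + R) y' (slackOf (raise.den s)) ∧
      (∀ p, d p.1 p.2 ≤ R → slackOf (raise.den s) p ≤ slackOf (n := n) s p + R) ∧
      ∀ x, Saturated d G Γ R (slackOf (raise.den s)) x := by
  set s₁ := raiseMultiplier.den s with hs₁
  have hB₁ : Base n k d G s₁ := hs.den (by decide) (by decide)
  have hσ₁ : ∀ p : Fin n × Fin n, slackOf s₁ p = slackOf s p + R := fun p => by
    rw [den_raiseMultiplier hs, hR]
  have hR₁ : s₁.real 3 0 0 = R := by rw [hs₁, Stmt.den_real_of_notMem (by decide), hR]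
  have hcov₁ (x : Fin n) : 1 ≤ s₁.nat 5 x 0 ↔ ∃ p ∈ Γ, x ∈ connBall d G p := by
    rw [hs₁, Stmt.den_nat_of_notMem (by decide)]; exact hcov x
  have e : raise.den s = (Stmt.forN 24 raisePoint).den s₁ := rfl
  have := Stmt.den_eq_forN (.forN 24 raisePoint) rfl (fun S s' => Base n k d G s' ∧
    s'.real 3 0 0 = R ∧ (∀ x : Fin n, 1 ≤ s'.nat 5 x 0 ↔ ∃ p ∈ Γ, x ∈ connBall d G p) ∧
    ∃ y', DualFeasible d G Γ R (l + R) y' (slackOf s') ∧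
      (∀ p : Fin n × Fin n, d p.1 p.2 ≤ R → slackOf s' p ≤ slackOf s p + R) ∧
      ∀ x ∈ S, Saturated d G Γ R (slackOf s') x)
    (fun S s m h => ⟨h.1.updateNat (by decide) _ _ _, h.2⟩) ?_ hB₁.size
    ⟨hB₁, hR₁, hcov₁, y, ⟨⟨hy.slack.nonneg, fun p => ?_⟩, fun p hp => ?_, hy.zero⟩,
      fun p _ => (hσ₁ p).le, by simp⟩
  · obtain ⟨-, -, -, y', h1, h2, h3⟩ := this
    exact ⟨y', h1, h2, fun x => h3 x (Finset.mem_univ x)⟩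
  · rintro S x s' - hx ⟨hs, hR, hcov, y', h1, h2, h3⟩
    obtain ⟨y'', g1, g2, g3⟩ := den_raisePoint hd hs hx hR hR0 hcov h1
    refine ⟨hs.den (by decide) (by decide), ?_, ?_, y'', g1,
      fun p hp => (g2 p hp).trans (h2 p hp), fun z hz => ?_⟩
    · rw [Stmt.den_real_of_notMem (by decide), hR]
    · rw [Stmt.den_nat_of_notMem (by decide)]; exact hcov
    · rcases Finset.mem_insert.1 hz with rfl | hz
      · exact g3
      · exact (h3 z hz).mono g2
  · rw [hσ₁, hy.slack.eq]; ring
  · rw [hσ₁]; have := hy.nonneg p hp; linarith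

/-! ### Stages -/

/-- The hypotheses under which the guessed balls `Γ` lead to a clustering of cost at most `b`. -/
structure GoodGuess {k : ℕ} (d : Fin n → Fin n → ℝ) (G : SimpleGraph (Fin n)) (c : Fin n → Fin k)
    (I : Finset (Fin k)) (q : Fin k → Fin n × Fin n) (Γ : Finset (Fin n × Fin n)) (R b : ℝ) :
    Prop where
  fits : Fits (connBall d G) (fun p => d p.1 p.2) c I Γ q R
  nonempty : I.Nonempty
  pos : 0 < n
  le : k ≤ n
  bound : 4 * (∑ i ∈ Iᶜ, d (q i).1 (q i).2 + R) + 2 * ∑ p ∈ Γ, d p.1 p.2 + 2 * R ≤ b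

/-- The invariant of the stages: after `t` stages, the dual solution is maximal, and a clustering
of cost at most `b` has been found unless the tight balls have more than `k` classes. -/
def StageInv (k : ℕ) (d : Fin n → Fin n → ℝ) (G : SimpleGraph (Fin n))
    (Γ : Finset (Fin n × Fin n)) (R b : ℝ) (t : ℕ) (s : Store) : Prop :=
  ∃ y, DualFeasible d G Γ R (t * R) y (slackOf s) ∧
    (∀ x, Saturated d G Γ R (slackOf s) x) ∧
    (Achieved b s ∨ (t = 0 ∧ y = 0) ∨ ∃ lab,
      IsLabelling (connBall d G) (Γ ∪ tight d R (slackOf s)) lab ∧ k < numClasses lab)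

/-- One stage: merge the classes of the tight balls, raise the dual values, and add the new tight
balls one by one. -/
def stage (m : ℕ) : Stmt :=
  .seq initLabels (.seq (forGuesses unionBall m) (.seq labelTight (.seq evaluate
    (.seq raise labelTightEval))))

theorem Saturated.exists_mem {Γ A : Finset (Fin n × Fin n)} {R : ℝ} {σ : Fin n × Fin n → ℝ}
    {x : Fin n} (h : Saturated d G Γ R σ x) (hA : Γ ∪ tight d R σ ⊆ A) :
    ∃ p ∈ A, x ∈ connBall d G p := by
  rcases h with ⟨p, hp, hx⟩ | ⟨p, hp, hx⟩
  · exact ⟨p, hA (Finset.mem_union_left _ hp), hx⟩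
  · exact ⟨p, hA (Finset.mem_union_right _ hp), hx⟩

/-- The first labelling has cost at most `b`. -/
theorem GoodGuess.exists_diamBound_zero {c : Fin n → Fin k} {I : Finset (Fin k)}
    {q : Fin k → Fin n × Fin n} {Γ : Finset (Fin n × Fin n)} {R b : ℝ}
    (h : GoodGuess d G c I q Γ R b) (hd : IsDistance d) (hR : 0 ≤ R) {σ : Fin n × Fin n → ℝ}
    (hy : IsSlack (connBall d G) (fun p => d p.1 p.2) n 0 0 σ)
    (hsat : ∀ x, Saturated d G Γ R σ x) {lab : Fin n → Fin n}
    (hlab : IsLabelling (connBall d G) (Γ ∪ tight d R σ) lab) :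
    ∃ W, IsDiamBound d lab W ∧ ∑ v, W v ≤ b := by
  obtain ⟨W, D, hW, hD, -, hle, -⟩ := hlab.exists_disjoint hd (fun p => hd.nonneg p.1 p.2)
    connBall_nonempty (dist_le_of_mem_connBall₂ hd) (fun x => (hsat x).exists_mem subset_rfl) Γ
  refine ⟨W, hW, hle.trans (le_trans ?_ h.bound)⟩
  -- With zero values and zero multiplier the slack is `n` times the radius, so tight balls have
  -- radius zero and only the guessed balls count.
  have h1 : ∑ p ∈ D, d p.1 p.2 ≤ 0 := by
    refine Finset.sum_nonpos fun p hp => ?_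
    have hpt : p ∈ tight d R σ := by
      have := Finset.mem_sdiff.1 (hD hp)
      exact (Finset.mem_union.1 this.1).resolve_left this.2
    have h2 := (mem_tight.1 hpt).2
    rw [hy.eq] at h2
    simp only [Pi.zero_apply, Finset.sum_const_zero, add_zero, sub_zero] at h2
    have hn : (0 : ℝ) < n := by exact_mod_cast h.pos
    exact nonpos_of_mul_nonpos_right h2 hn
  have h2 : 0 ≤ ∑ i ∈ Iᶜ, d (q i).1 (q i).2 := Finset.sum_nonneg fun i _ => hd.nonneg _ _
  linarith

/-- More than `k` classes would bound the multiplier by `n` times the radii of the unguessed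
clusters. As `I` is nonempty, there are at most `n - 1` of these, each of radius at most `R`, which
is less than the multiplier `n * n * R` allows. -/
theorem GoodGuess.achieved {c : Fin n → Fin k} {I : Finset (Fin k)}
    {q : Fin k → Fin n × Fin n} {Γ : Finset (Fin n × Fin n)} {R b : ℝ}
    (h : GoodGuess d G c I q Γ R b) (hd : IsDistance d) (hR : 0 ≤ R)
    (hs : StageInv k d G Γ R b (n * n) s) : Achieved b s := by
  classical
  obtain ⟨y, hy, hsat, hor⟩ := hs
  have hn : (0 : ℝ) < n := by exact_mod_cast h.pos
  rcases hor with hor | ⟨h0, -⟩ | ⟨lab, hlab, hk⟩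
  · exact hor
  · have := h.pos
    exact absurd h0 (by positivity)
  exfalso
  -- For `R = 0` the multiplier never grows. But then every cluster lies in a guessed ball or in a
  -- tight ball of radius zero, so there are at most `k` classes.
  rcases hR.eq_or_lt with rfl | hRpos
  · refine absurd hk (not_lt.2 (hlab.card_roots_le_of_clusters (c := c) fun i => ?_))
    by_cases hi : i ∈ I
    · obtain ⟨p, hp, hz⟩ := h.fits.covers i hi
      exact ⟨p, Finset.mem_union_left _ hp, hz⟩
    · refine ⟨q i, Finset.mem_union_right _ (mem_tight.2 ⟨h.fits.small i hi, ?_⟩), fun z hz => ?_⟩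
      · have h1 := h.fits.small i hi
        rw [hy.slack.eq, mul_zero]
        have h2 : (n : ℝ) * d (q i).1 (q i).2 ≤ 0 := mul_nonpos_of_nonneg_of_nonpos hn.le h1
        have h3 : 0 ≤ ∑ x with x ∈ connBall d G (q i), y x :=
          Finset.sum_nonneg fun x _ => hy.slack.nonneg x
        linarith
      · exact hz ▸ h.fits.mem z
  · have hslack : IsSlack (connBall d G) (fun p => d p.1 p.2) (Fintype.card (Fin n))
        (((n * n : ℕ) : ℝ) * R) y (slackOf s) := by simpa using hy.slack
    have h1 := hlab.multiplier_le hd (fun p => hd.nonneg p.1 p.2) connBall_nonempty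
      (dist_le_of_mem_connBall₂ hd) (fun x => (hsat x).exists_mem subset_rfl) hslack
      h.fits Finset.subset_union_left (by positivity) hy.nonneg hy.zero (fun p hp => by
        have := Finset.mem_sdiff.1 hp
        exact (mem_tight.1 ((Finset.mem_union.1 this.1).resolve_left this.2)).2) hk
    have h2 : ∑ i ∈ Iᶜ, d (q i).1 (q i).2 ≤ Iᶜ.card * R := by
      rw [← nsmul_eq_mul]
      exact Finset.sum_le_card_nsmul _ _ _ fun i hi => h.fits.small i (by simpa using hi)
    have h3 : Iᶜ.card + 1 ≤ n := by
      have := Finset.card_compl_add_card I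
      rw [Fintype.card_fin] at this
      have := h.nonempty.card_pos
      have := h.le
      lia
    have h4 : ((Iᶜ.card : ℝ) + 1) * R ≤ n * R :=
      mul_le_mul_of_nonneg_right (by exact_mod_cast h3) hRpos.le
    rw [Fintype.card_fin, Nat.cast_mul, mul_assoc] at h1
    have h5 := le_of_mul_le_mul_left h1 hn
    linarith

theorem stage_natWrites (m : ℕ) : ∀ a ∈ (stage m).natWrites,
    a ∉ [0, 1, 3, 4, 5, 30, 31] ∧ a < 100 := by
  have h1 : ∀ a ∈ initLabels.natWrites ++ (labelTight.natWrites ++ (evaluate.natWrites ++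
      (raise.natWrites ++ (labelTightEval.natWrites ++ (20 :: 21 :: unionBall.natWrites))))),
      a ∉ [0, 1, 3, 4, 5, 30, 31] ∧ a < 100 := by decide
  intro a ha
  apply h1
  simp only [stage, Stmt.natWrites, List.mem_append] at ha
  simp only [List.mem_append, List.mem_cons]
  have := @mem_natWrites_forGuesses unionBall m a
  tauto

theorem stage_realWrites (m : ℕ) : ∀ a ∈ (stage m).realWrites, a ∉ [0, 1, 3] := by
  have h1 : ∀ a ∈ initLabels.realWrites ++ (labelTight.realWrites ++ (evaluate.realWrites ++
      (raise.realWrites ++ (labelTightEval.realWrites ++ unionBall.realWrites)))),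
      a ∉ [0, 1, 3] := by decide
  intro a ha
  apply h1
  simp only [stage, Stmt.realWrites, List.mem_append] at ha
  simp only [List.mem_append]
  have := @realWrites_forGuesses unionBall m a
  tauto

/-- The labelling starts from the balls in `A`, the guessed ones and those tight before the raise.
They cover all points, and after the raise those outside `Γ` have slack at most `R`. So every family
between `A` and its union with the new tight balls satisfies the hypotheses of
`IsLabelling.exists_diamBound` for the new dual solution. -/
theorem den_stage (hd : IsDistance d) {g : ℕ → Fin n × Fin n} {m : ℕ} {R : ℝ}
    (hs : Base n k d G s) (hg : HasGuesses g m s) (hR : s.real 3 0 0 = R) (hR0 : 0 ≤ R)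
    (hcov : ∀ x : Fin n, 1 ≤ s.nat 5 x 0 ↔ ∃ p ∈ guesses g m, x ∈ connBall d G p)
    (hbest : BestFeasible n k d G s) :
    BestFeasible n k d G ((stage m).den s) ∧
      (∀ b, Achieved b s → Achieved b ((stage m).den s)) ∧
      ∀ b (c : Fin n → Fin k) I q, GoodGuess d G c I q (guesses g m) R b →
        ∀ t, StageInv k d G (guesses g m) R b t s →
          StageInv k d G (guesses g m) R b (t + 1) ((stage m).den s) := by
  set Γ := guesses g m with hΓ
  -- labelling of the guessed balls
  obtain ⟨lab₁, hr₁, hlab₁⟩ := den_labelGuesses hs hg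
  set s₁ := (forGuesses unionBall m).den (initLabels.den s) with hs₁
  have hw₁ (a : ℕ) (ha : a ≠ 20 ∧ a ≠ 21 ∧ a ∉ unionBall.natWrites ∧ a ∉ initLabels.natWrites) :
      s₁.nat a = s.nat a := by
    rw [hs₁, Stmt.den_nat_of_notMem (fun h => ?_), Stmt.den_nat_of_notMem ha.2.2.2]
    rcases mem_natWrites_forGuesses h with h | h | h
    · exact ha.1 h
    · exact ha.2.1 h
    · exact ha.2.2.1 h
  have hreal₁ : s₁.real = s.real := by
    funext a
    rw [hs₁, Stmt.den_real_of_notMem (fun h => ?_), Stmt.den_real_of_notMem (by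
      simp [initLabels, Stmt.realWrites])]
    have := realWrites_forGuesses h
    simp [unionBall, relabel, Stmt.realWrites] at this
  have hB₁ : Base n k d G s₁ := hs.congr (hw₁ 0 (by decide)) (hw₁ 1 (by decide))
    (hw₁ 3 (by decide)) (hw₁ 4 (by decide)) (by rw [hreal₁]) (by rw [hreal₁])
  have hσ₁ : (slackOf s₁ : Fin n × Fin n → ℝ) = slackOf s := by
    funext p; rw [slackOf, hreal₁, slackOf]
  -- the tight balls
  obtain ⟨lab₂, hr₂, hlab₂⟩ := den_labelTight hB₁ hr₁ hlab₁
  rw [hreal₁, hR, hσ₁] at hlab₂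
  set A := Γ ∪ tight d R (slackOf s) with hA
  set s₂ := labelTight.den s₁ with hs₂
  have hB₂ : Base n k d G s₂ := hB₁.den (by decide) (by decide)
  have hreal₂ : s₂.real = s.real := by
    funext a
    rw [hs₂, Stmt.den_real_of_notMem (by
      simp [labelTight, unionBall, relabel, Stmt.realWrites]), hreal₁]
  have e13₂ : s₂.nat 13 = s.nat 13 :=
    (Stmt.den_nat_of_notMem (P := labelTight) (by decide) s₁).trans (hw₁ 13 (by decide))
  have e14₂ : s₂.nat 14 = s.nat 14 :=
    (Stmt.den_nat_of_notMem (P := labelTight) (by decide) s₁).trans (hw₁ 14 (by decide))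
  have hbest₂ : BestFeasible n k d G s₂ := by
    rw [BestFeasible, hreal₂, e13₂, e14₂]
    exact hbest
  have hach₂ (b : ℝ) (h : Achieved b s) : Achieved b s₂ := by
    rw [Achieved, hreal₂, e13₂]
    exact h
  obtain ⟨hbest₃, hach₃, hev⟩ := den_evaluate hd hB₂ hr₂ hlab₂.idem hbest₂
  set s₃ := evaluate.den s₂ with hs₃
  have hB₃ : Base n k d G s₃ := hB₂.den (by decide) (by decide)
  have hσ₃ : (slackOf s₃ : Fin n × Fin n → ℝ) = slackOf s := by
    funext p
    rw [slackOf, hs₃, Stmt.den_real_of_notMem (by decide), hreal₂, slackOf]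
  have hR₃ : s₃.real 3 0 0 = R := by
    rw [hs₃, Stmt.den_real_of_notMem (by decide), hreal₂, hR]
  have hcov₃ (x : Fin n) : 1 ≤ s₃.nat 5 x 0 ↔ ∃ p ∈ Γ, x ∈ connBall d G p := by
    rw [hs₃, Stmt.den_nat_of_notMem (by decide), hs₂, Stmt.den_nat_of_notMem (by decide),
      hw₁ 5 (by decide)]
    exact hcov x
  have hr₃ : Rep (s₃.nat 6) lab₂ := by
    rw [hs₃, Stmt.den_nat_of_notMem (by decide)]; exact hr₂
  -- the dual values
  set s₄ := raise.den s₃ with hs₄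
  have hB₄ : Base n k d G s₄ := hB₃.den (by decide) (by decide)
  have hR₄ : s₄.real 3 0 0 = R := by rw [hs₄, Stmt.den_real_of_notMem (by decide), hR₃]
  have hr₄ : Rep (s₄.nat 6) lab₂ := by
    rw [hs₄, Stmt.den_nat_of_notMem (by decide)]; exact hr₃
  have e13₄ : s₄.nat 13 = s₃.nat 13 := Stmt.den_nat_of_notMem (P := raise) (by decide) s₃
  have e14₄ : s₄.nat 14 = s₃.nat 14 := Stmt.den_nat_of_notMem (P := raise) (by decide) s₃
  have e7₄ : s₄.real 7 = s₃.real 7 := Stmt.den_real_of_notMem (P := raise) (by decide) s₃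
  have hbest₄ : BestFeasible n k d G s₄ := by
    rw [BestFeasible, e13₄, e14₄, e7₄]
    exact hbest₃
  have hach₄ (b : ℝ) : Achieved b s₄ ↔ Achieved b s₃ := by
    rw [Achieved, e13₄, e7₄, Achieved]
  obtain ⟨hbest₅, hach₅, hchain⟩ := den_labelTightEval hd hB₄ hr₄ hlab₂ hbest₄ hR₄ rfl
  have hσ₅ : (slackOf (labelTightEval.den s₄) : Fin n × Fin n → ℝ) = slackOf s₄ := by
    funext p
    rw [slackOf, Stmt.den_real_of_notMem (by decide), slackOf]
  have e : (stage m).den s = labelTightEval.den s₄ := rfl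
  rw [e]
  refine ⟨hbest₅, fun b h => hach₅ b ((hach₄ b).2 (hach₃ b (hach₂ b h))), ?_⟩
  rintro b c I q hgood t ⟨y, hy, hsat, hor⟩
  obtain ⟨y', hy', hσ', hsat'⟩ := den_raise hd hB₃ hR₃ hR0 hcov₃ (hσ₃.symm ▸ hy)
  rw [← hs₄] at hy' hσ' hsat'
  have ht : (t : ℝ) * R + R = ((t + 1 : ℕ) : ℝ) * R := by push_cast; ring
  rw [ht] at hy'
  -- Only before the first stage can there be at most `k` classes without success so far. The
  -- evaluation of the first labelling covers this case.
  have hstart : Achieved b s₄ ∨ k < numClasses lab₂ := by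
    rw [hach₄]
    rcases hor with h | ⟨rfl, rfl⟩ | ⟨lab, hlab, hk⟩
    · exact .inl (hach₃ b (hach₂ b h))
    · by_contra hcon
      push Not at hcon
      have hsl := hy.slack
      rw [Nat.cast_zero, zero_mul] at hsl
      obtain ⟨W, hW, hle⟩ := hgood.exists_diamBound_zero hd hR0 hsl hsat hlab₂
      have := hev (fun x => hlab₂.reflTransGen (hlab₂.idem x)) hcon.2 hgood.le W hW
      exact hcon.1 ⟨this.1, this.2.trans hle⟩
    · exact .inr (hk.trans_le (hlab₂.card_roots_anti subset_rfl hlab))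
  have hbound (A' : Finset (Fin n × Fin n)) (lab' : Fin n → Fin n) (hAA' : A ⊆ A')
      (hA'A : A' ⊆ A ∪ tight d R (slackOf s₄)) (hlab' : IsLabelling (connBall d G) A' lab')
      (hk : k < numClasses lab') : ∃ W, IsDiamBound d lab' W ∧ ∑ v, W v + 2 * R ≤ b := by
    have hslack : IsSlack (connBall d G) (fun p => d p.1 p.2) (Fintype.card (Fin n))
        (((t + 1 : ℕ) : ℝ) * R) y' (slackOf s₄) := by simpa using hy'.slack
    have htight (p) (hp : p ∈ A' \ Γ) : slackOf s₄ p ≤ R := by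
      obtain ⟨hp, hpΓ⟩ := Finset.mem_sdiff.1 hp
      rcases Finset.mem_union.1 (hA'A hp) with hp | hp
      · have := mem_tight.1 ((Finset.mem_union.1 hp).resolve_left hpΓ)
        have h2 := hσ' p this.1
        rw [hσ₃] at h2
        linarith [this.2]
      · exact (mem_tight.1 hp).2.trans hR0
    obtain ⟨W, hW, hle⟩ := hlab'.exists_diamBound hd (fun p => hd.nonneg p.1 p.2)
      connBall_nonempty (dist_le_of_mem_connBall₂ hd)
      (fun x => (hsat x).exists_mem hAA') hslack hgood.fits
      (Finset.subset_union_left.trans hAA') (by simpa using hgood.pos) (by positivity) hR0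
      hy'.nonneg hy'.zero htight hk.le
    exact ⟨W, hW, by linarith [hgood.bound]⟩
  refine ⟨y', hσ₅.symm ▸ hy', hσ₅.symm ▸ hsat', ?_⟩
  rw [hσ₅]
  rcases hchain b hgood.le hstart hbound with h | ⟨lab', hlab', hk⟩
  · exact .inl h
  -- The next stage keeps only the balls that are tight for the new dual solution; dropping the
  -- others cannot lower the number of classes.
  · obtain ⟨lab'', hlab''⟩ := exists_isLabelling (connBall d G) (Γ ∪ tight d R (slackOf s₄))
    refine .inr (.inr ⟨lab'', hlab'', hk.trans_le (hlab''.card_roots_anti ?_ hlab')⟩)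
    exact Finset.union_subset_union_left Finset.subset_union_left

end RAM

namespace RAM

open Clustering

variable {n k : ℕ} {d : Fin n → Fin n → ℝ} {G : SimpleGraph (Fin n)} {s : Store}

/-! ### All guesses -/

/-- The slacks of the dual solution zero. -/
def initSlack : Stmt :=
  .forN 20 (.forN 21 (.setReal 2 (.var 20) (.var 21) (.cell 1 (.var 20) (.var 21))))

theorem den_initSlack (hs : Base n k d G s) (p : Fin n × Fin n) :
    slackOf (initSlack.den s) p = n * d p.1 p.2 := by
  have := Stmt.den_eq_forN₂ initSlack rfl (by decide) (by decide) (fun S s' =>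
    Base n k d G s' ∧ ∀ p ∈ S, slackOf s' p = n * d p.1 p.2)
    (fun S s u m hu h => by
      rcases hu with rfl | rfl <;> exact ⟨h.1.updateNat (by decide) _ _ _, h.2⟩)
    (fun S s h => h.1.size) ?_ ⟨hs, by simp⟩
  · exact this.2 p (Finset.mem_univ p)
  · rintro S v w s' - hv hw ⟨hs, h⟩
    refine ⟨hs.updateReal (by decide) _ _ _, fun q hq => ?_⟩
    simp only [Stmt.den, NExp.eval, RExp.eval, hv, hw, hs.scaled]
    by_cases e : q = (v, w)
    · subst e
      simp [slackOf, Store.updateReal_real_self]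
    · have hne : ¬ ((q.1 : ℕ) = v ∧ (q.2 : ℕ) = w) := fun h =>
        e (Prod.ext (Fin.ext h.1) (Fin.ext h.2))
      rw [← h q ((Finset.mem_insert.1 hq).resolve_left e)]
      simp [slackOf, Store.updateReal_real_self, hne]

/-- Run all stages for the guessed balls. -/
def core (m : ℕ) : Stmt :=
  .seq initSlack (.seq (.setReal 3 (.const 0) (.const 0) (.cell 0 (.var 100) (.var 101)))
    (.seq (markCovered m) (.forN 30 (.forN 31 (stage m)))))

theorem HasGuesses.updateNat {g : ℕ → Fin n × Fin n} {m : ℕ} (h : HasGuesses g m s) {a : ℕ}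
    (ha : a < 100) (i j x : ℕ) : HasGuesses g m (s.updateNat a i j x) := by
  intro l hl
  rw [Store.updateNat_nat_of_ne _ (by lia), Store.updateNat_nat_of_ne _ (by lia)]
  exact h l hl

theorem core_natWrites (m : ℕ) : ∀ a ∈ (core m).natWrites, a ∉ [0, 1, 3, 4] ∧ a < 100 := by
  have h1 : ∀ a ∈ 30 :: 31 :: 22 :: 5 :: 20 :: 21 :: (initSlack.natWrites ++ markBall.natWrites),
      a ∉ [0, 1, 3, 4] ∧ a < 100 := by decide
  intro a ha
  by_cases h : a ∈ (stage m).natWrites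
  · have := stage_natWrites m a h
    refine ⟨fun h => this.1 ?_, this.2⟩
    simp only [List.mem_cons, List.not_mem_nil, or_false] at h ⊢
    tauto
  · apply h1
    simp only [core, markCovered, Stmt.natWrites, List.mem_append, List.mem_cons,
      List.not_mem_nil, or_false, false_or] at ha ⊢
    have := @mem_natWrites_forGuesses markBall m a
    tauto

theorem core_realWrites (m : ℕ) : ∀ a ∈ (core m).realWrites, a ∉ [0, 1] := by
  have h1 : ∀ a ∈ 3 :: (initSlack.realWrites ++ markBall.realWrites), a ∉ [0, 1] := by decide
  intro a ha
  by_cases h : a ∈ (stage m).realWrites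
  · have := stage_realWrites m a h
    simp only [List.mem_cons, List.not_mem_nil, or_false] at this ⊢
    tauto
  · apply h1
    simp only [core, markCovered, Stmt.realWrites, List.mem_append, List.mem_cons,
      List.not_mem_nil, or_false, false_or] at ha ⊢
    have := @realWrites_forGuesses markBall m a
    tauto

theorem den_core (hd : IsDistance d) {g : ℕ → Fin n × Fin n} {m : ℕ} (hs : Base n k d G s)
    (hg : HasGuesses g m s) (hbest : BestFeasible n k d G s) :
    BestFeasible n k d G ((core m).den s) ∧
      (∀ b, Achieved b s → Achieved b ((core m).den s)) ∧
      ∀ b (c : Fin n → Fin k) I q,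
        GoodGuess d G c I q (guesses g m) (d (g 0).1 (g 0).2) b → Achieved b ((core m).den s) := by
  set Γ := guesses g m with hΓ
  set R := d (g 0).1 (g 0).2 with hR
  have hR0 : 0 ≤ R := hd.nonneg _ _
  set s₁ := (initSlack.den s).updateReal 3 0 0 R with hs₁
  have hB₁ : Base n k d G s₁ :=
    (hs.den (P := initSlack) (by decide) (by decide)).updateReal (by decide) _ _ _
  have hg₁ : HasGuesses g m s₁ := hg.den (P := initSlack) (by decide)
  have hσ₁ (p : Fin n × Fin n) : slackOf s₁ p = n * d p.1 p.2 := den_initSlack hs p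
  have hw₁ (a : ℕ) (ha : a ∉ initSlack.natWrites) : s₁.nat a = s.nat a :=
    Stmt.den_nat_of_notMem ha s
  have e7₁ : s₁.real 7 = s.real 7 := Stmt.den_real_of_notMem (P := initSlack) (by decide) s
  have hR₁ : s₁.real 3 0 0 = R := by simp [hs₁, Store.updateReal_real_self]
  set s₂ := (markCovered m).den s₁ with hs₂
  have hw₂ (a : ℕ) (ha : a ∉ [5, 20, 21, 22]) : s₂.nat a = s₁.nat a := by
    refine Stmt.den_nat_of_notMem (fun h => ha ?_) s₁
    have := @mem_natWrites_forGuesses markBall m a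
    simp only [markCovered, markBall, Stmt.natWrites, List.mem_append, List.mem_cons,
      List.not_mem_nil, or_false] at h this ⊢
    tauto
  have hreal₂ : s₂.real = s₁.real := by
    funext a
    refine Stmt.den_real_of_notMem (fun h => ?_) s₁
    have := @realWrites_forGuesses markBall m a
    simp only [markCovered, markBall, Stmt.realWrites, List.mem_append, List.not_mem_nil,
      false_or] at h this
    exact this h
  have hB₂ : Base n k d G s₂ := hB₁.congr (hw₂ 0 (by decide)) (hw₂ 1 (by decide))
    (hw₂ 3 (by decide)) (hw₂ 4 (by decide)) (by rw [hreal₂]) (by rw [hreal₂])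
  have hg₂ : HasGuesses g m s₂ := by
    intro j hj
    rw [hw₂ _ (by simp; lia), hw₂ _ (by simp; lia)]
    exact hg₁ j hj
  have hcov₂ := den_markCovered hB₁ hg₁
  rw [← hs₂] at hcov₂
  have hbest₂ : BestFeasible n k d G s₂ := by
    rw [BestFeasible, hw₂ 13 (by decide), hw₂ 14 (by decide), hreal₂, hw₁ 13 (by decide),
      hw₁ 14 (by decide), e7₁]
    exact hbest
  have hach₂ (b : ℝ) (h : Achieved b s) : Achieved b s₂ := by
    rw [Achieved, hw₂ 13 (by decide), hreal₂, hw₁ 13 (by decide), e7₁]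
    exact h
  have e : (core m).den s = (Stmt.forN 30 (.forN 31 (stage m))).den s₂ := by
    have e1 : ((initSlack.den s).nat 100 0 0 = (g 0).1) ∧
        (initSlack.den s).nat 101 0 0 = (g 0).2 := hg.den (P := initSlack) (by decide) 0 (by lia)
    have e2 : (initSlack.den s).real 0 (g 0).1 (g 0).2 = R :=
      (hs.den (P := initSlack) (by decide) (by decide)).dist _ _
    rw [hs₂, hs₁, ← e2, ← e1.1, ← e1.2]
    rfl
  rw [e]
  have hloop := Stmt.den_eq_forN₂ (.forN 30 (.forN 31 (stage m))) rfl (by decide)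
    (fun h => (stage_natWrites m _ h).1 (by decide)) (fun S s' =>
    Base n k d G s' ∧ HasGuesses g m s' ∧ s'.real 3 0 0 = R ∧
    (∀ x : Fin n, 1 ≤ s'.nat 5 x 0 ↔ ∃ p ∈ Γ, x ∈ connBall d G p) ∧ BestFeasible n k d G s' ∧
    (∀ b, Achieved b s → Achieved b s') ∧
    ∀ b (c : Fin n → Fin k) I q, GoodGuess d G c I q Γ R b →
      StageInv k d G Γ R b S.card s')
    (fun S s u m hu h => by
      rcases hu with rfl | rfl <;>
        exact ⟨h.1.updateNat (by decide) _ _ _, h.2.1.updateNat (by decide) _ _ _, h.2.2⟩)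
    (fun S s h => h.1.size) ?_ (s := s₂)
    ⟨hB₂, hg₂, by rw [hreal₂, hR₁], hcov₂, hbest₂, hach₂, fun b c I q hgood => ?_⟩
  · obtain ⟨-, -, -, -, h1, h2, h3⟩ := hloop
    refine ⟨h1, h2, fun b c I q hgood => hgood.achieved hd hR0 ?_⟩
    simpa using h3 b c I q hgood
  · rintro S v w s' hvw - - ⟨hs, hg, hR, hcov, hbest, hach, hgood⟩
    obtain ⟨h1, h2, h3⟩ := den_stage hd hs hg hR hR0 hcov hbest
    refine ⟨hs.den (fun a ha h => (stage_natWrites m a h).1 ?_)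
      (fun a ha h => stage_realWrites m a h ?_), hg.den fun a h => (stage_natWrites m a h).2, ?_,
      ?_, h1, fun b h => h2 b (hach b h), fun b c I q h => ?_⟩
    · simp only [List.mem_cons, List.not_mem_nil, or_false] at ha ⊢; tauto
    · simp only [List.mem_cons, List.not_mem_nil, or_false] at ha ⊢; tauto
    · rw [Stmt.den_real_of_notMem (fun h => stage_realWrites m _ h (by decide)), hR]
    · rw [Stmt.den_nat_of_notMem (fun h => (stage_natWrites m _ h).1 (by decide))]
      exact hcov
    · rw [Finset.card_insert_of_notMem hvw]
      exact h3 b c I q h _ (hgood b c I q h)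
  · have hσ (p : Fin n × Fin n) : slackOf s₂ p = n * d p.1 p.2 := by
      rw [slackOf, hreal₂]; exact hσ₁ p
    -- The zero solution is feasible, and it is saturated because the balls `(x, x)` of radius zero
    -- are tight.
    refine ⟨0, ⟨⟨fun _ => le_rfl, fun p => ?_⟩, fun p _ => ?_, fun _ _ _ _ => rfl⟩,
      fun x => .inr ⟨(x, x), mem_tight.2 ⟨?_, ?_⟩, fst_mem_connBall _⟩, .inr (.inl ⟨?_, rfl⟩)⟩
    · rw [hσ]; simp
    · rw [hσ]; exact mul_nonneg (by positivity) (hd.nonneg _ _)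
    · simpa [hd.self] using hR0
    · rw [hσ]; simp [hd.self]
    · simp

/-- Run all stages for all guesses of the balls below `j`. -/
def guessLoops (m : ℕ) : ℕ → Stmt
  | 0 => core m
  | j + 1 => .forN (100 + 2 * j) (.forN (101 + 2 * j) (guessLoops m j))

theorem guessLoops_natWrites (m j : ℕ) :
    ∀ a ∈ (guessLoops m j).natWrites, a ∉ [0, 1, 3, 4] ∧ a < 100 + 2 * j := by
  induction j with
  | zero => exact core_natWrites m
  | succ j ih =>
    intro a ha
    simp only [guessLoops, Stmt.natWrites, List.mem_cons] at ha
    rcases ha with rfl | rfl | ha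
    · simp; lia
    · simp; lia
    · exact ⟨(ih a ha).1, by have := (ih a ha).2; lia⟩

theorem guessLoops_realWrites (m j : ℕ) : ∀ a ∈ (guessLoops m j).realWrites, a ∉ [0, 1] := by
  induction j with
  | zero => exact core_realWrites m
  | succ j ih => exact ih

theorem Base.guessLoops {m j : ℕ} (h : Base n k d G s) : Base n k d G ((guessLoops m j).den s) :=
  h.den (fun a ha h => (guessLoops_natWrites m j a h).1 ha)
    (fun a ha h => guessLoops_realWrites m j a h ha)

theorem BestFeasible.updateNat (h : BestFeasible n k d G s) {a : ℕ} (h13 : 13 ≠ a) (h14 : 14 ≠ a)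
    (i j m : ℕ) : BestFeasible n k d G (s.updateNat a i j m) := by
  rw [BestFeasible, Store.updateNat_nat_of_ne _ h13, Store.updateNat_nat_of_ne _ h14]
  exact h

theorem Achieved.updateNat {b : ℝ} (h : Achieved b s) {a : ℕ} (h13 : 13 ≠ a)
    (i j m : ℕ) : Achieved b (s.updateNat a i j m) := by
  rw [Achieved, Store.updateNat_nat_of_ne _ h13]
  exact h

/-- The loops run through all values of the guesses below `j`, so success is claimed for every
sequence `g'` that agrees with the stored one from `j` on. A success is never lost, since later runs
can only improve the best clustering. -/
theorem den_guessLoops (hd : IsDistance d) {m : ℕ} (j : ℕ) {g : ℕ → Fin n × Fin n}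
    (hs : Base n k d G s)
    (hg : ∀ i, j ≤ i → i ≤ m → s.nat (100 + 2 * i) 0 0 = (g i).1 ∧
      s.nat (101 + 2 * i) 0 0 = (g i).2) (hbest : BestFeasible n k d G s) :
    BestFeasible n k d G ((guessLoops m j).den s) ∧
      (∀ b, Achieved b s → Achieved b ((guessLoops m j).den s)) ∧
      ∀ g', (∀ i, j ≤ i → i ≤ m → g' i = g i) → ∀ b (c : Fin n → Fin k) I q,
        GoodGuess d G c I q (guesses g' m) (d (g' 0).1 (g' 0).2) b →
          Achieved b ((guessLoops m j).den s) := by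
  induction j generalizing s g with
  | zero =>
    obtain ⟨h1, h2, h3⟩ := den_core hd hs (fun i hi => hg i (Nat.zero_le i) hi) hbest
    refine ⟨h1, h2, fun g' hg' b c I q hgood => h3 b c I q ?_⟩
    have e : guesses g' m = guesses g m :=
      Finset.image_congr fun i hi => hg' i (Nat.zero_le i) (by simp at hi; lia)
    rwa [e, hg' 0 le_rfl (Nat.zero_le m)] at hgood
  | succ j ih =>
    have := Stmt.den_eq_forN₂ (guessLoops m (j + 1)) rfl (by lia)
      (fun h => by have := (guessLoops_natWrites m j _ h).2; lia) (fun S s' =>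
      Base n k d G s' ∧ (∀ i, j + 1 ≤ i → i ≤ m → s'.nat (100 + 2 * i) 0 0 = (g i).1 ∧
        s'.nat (101 + 2 * i) 0 0 = (g i).2) ∧ BestFeasible n k d G s' ∧
      (∀ b, Achieved b s → Achieved b s') ∧
      ∀ g', (∀ i, j + 1 ≤ i → i ≤ m → g' i = g i) → g' j ∈ S → ∀ b (c : Fin n → Fin k) I q,
        GoodGuess d G c I q (guesses g' m) (d (g' 0).1 (g' 0).2) b → Achieved b s')
      ?_ (fun S s h => h.1.size) ?_ ⟨hs, hg, hbest, fun _ h => h, by simp⟩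
    · obtain ⟨-, -, h1, h2, h3⟩ := this
      exact ⟨h1, h2, fun g' hg' => h3 g' hg' (Finset.mem_univ _)⟩
    · rintro S s' u x hu ⟨h1, h2, h3, h4, h5⟩
      have hu' : 100 ≤ u ∧ u < 102 + 2 * j := by lia
      refine ⟨h1.updateNat (by simp; lia) _ _ _, fun i hi hi' => ?_,
        h3.updateNat (by lia) (by lia) _ _ _, fun b h => (h4 b h).updateNat (by lia) _ _ _,
        fun g' hg' hgS b c I q h => (h5 g' hg' hgS b c I q h).updateNat (by lia) _ _ _⟩
      rw [Store.updateNat_nat_of_ne _ (by lia), Store.updateNat_nat_of_ne _ (by lia)]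
      exact h2 i hi hi'
    · rintro S v w s' - hv hw ⟨h1, h2, h3, h4, h5⟩
      obtain ⟨i1, i2, i3⟩ := ih (s := s') (g := Function.update g j (v, w)) h1
        (fun i hi hi' => by
          by_cases e : i = j
          · subst e; simpa using ⟨hv, hw⟩
          · rw [Function.update_of_ne e]
            exact h2 i (by lia) hi') h3
      refine ⟨h1.guessLoops, fun i hi hi' => ?_, i1, fun b h => i2 b (h4 b h),
        fun g' hg' hgS b c I q h => ?_⟩
      · rw [Stmt.den_nat_of_notMem (fun h => by have := (guessLoops_natWrites m j _ h).2; lia),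
          Stmt.den_nat_of_notMem (fun h => by have := (guessLoops_natWrites m j _ h).2; lia)]
        exact h2 i hi hi'
      · rcases Finset.mem_insert.1 hgS with hgj | hgS
        · refine i3 g' (fun i hi hi' => ?_) b c I q h
          by_cases e : i = j
          · subst e; simpa using hgj
          · rw [Function.update_of_ne e]
            exact hg' i (by lia) hi'
        · exact i2 b (h5 g' hg' hgS b c I q h)

/-! ### Tables -/

/-- The multiples of `n` in the array `3`. -/
def mulTable : Stmt :=
  .forN 20 (.forN 21 (.ifThen (.natLe (.add (.var 21) (.const 1)) (.var 20))
    (.setNat 3 (.var 20) (.const 0) (.add (.cell 3 (.var 20) (.const 0)) (.var 0)))))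

/-- The distances, multiplied by `n`, in the real array `1`. -/
def scaleTable : Stmt :=
  .forN 20 (.forN 21 (.forN 22 (.setReal 1 (.var 20) (.var 21)
    (.add (.cell 1 (.var 20) (.var 21)) (.cell 0 (.var 20) (.var 21))))))

/-- Add the neighbour `var 23` of `var 22` to the ball, if it is close to its center. -/
def ballStep : Stmt :=
  .ifThen (.and (inBall (.var 22)) (.and (.natLe (.const 1) (.cell 1 (.var 22) (.var 23)))
    (.realLe (.cell 0 (.var 20) (.var 23)) (.cell 0 (.var 20) (.var 21)))))
    (.setNat 4 ballRow (.var 23) (.const 1))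

/-- The connected ball with center `var 20` and boundary point `var 21`. -/
def fillBall : Stmt :=
  .seq (.setNat 4 ballRow (.var 20) (.const 1)) (.forN 24 (.forN 22 (.forN 23 ballStep)))

/-- The connected balls in the array `4`. -/
def ballTable : Stmt := .forN 20 (.forN 21 fillBall)

/-- The input. -/
structure Input (n k : ℕ) (d : Fin n → Fin n → ℝ) (G : SimpleGraph (Fin n)) (s : Store) :
    Prop where
  size : s.nat 0 0 0 = n
  num : s.nat 0 0 1 = k
  adj : ∀ x y : Fin n, 1 ≤ s.nat 1 x y ↔ G.Adj x y
  dist : ∀ x y : Fin n, s.real 0 x y = d x y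

theorem Input.congr {s' : Store} (h : Input n k d G s) (h0 : s'.nat 0 = s.nat 0)
    (h1 : s'.nat 1 = s.nat 1) (hr0 : s'.real 0 = s.real 0) : Input n k d G s' := by
  obtain ⟨a, b, c, e⟩ := h
  constructor <;> simpa only [h0, h1, hr0]

end RAM

namespace RAM

open Clustering

variable {n k : ℕ} {d : Fin n → Fin n → ℝ} {G : SimpleGraph (Fin n)} {s : Store}

theorem Input.den {P : Stmt} (hP : ∀ a ∈ [0, 1], a ∉ P.natWrites) (hP' : 0 ∉ P.realWrites)
    (h : Input n k d G s) : Input n k d G (P.den s) :=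
  h.congr (Stmt.den_nat_of_notMem (hP _ (by simp)) s) (Stmt.den_nat_of_notMem (hP _ (by simp)) s)
    (Stmt.den_real_of_notMem hP' s)

/-- In the absence of multiplication, `n` is added to the entry of `x` once for each smaller number;
the invariant counts these pairs. -/
theorem den_mulTable (hs : s.nat 0 0 0 = n) (h3 : ∀ x : Fin n, s.nat 3 x 0 = 0) (x : Fin n) :
    (mulTable.den s).nat 3 x 0 = x * n := by
  have := Stmt.den_eq_forN₂ mulTable rfl (n := n) (by decide) (by decide) (fun S s' =>
    s'.nat 0 0 0 = n ∧
      ∀ x : Fin n, s'.nat 3 x 0 = (S.filter fun p => p.1 = x ∧ p.2 < p.1).card * n)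
    (fun S s u m hu h => by rcases hu with rfl | rfl <;> exact h) (fun S s h => h.1) ?_
    ⟨hs, by simpa using h3⟩
  · rw [this.2 x]
    have : (Finset.univ.filter fun p : Fin n × Fin n => p.1 = x ∧ p.2 < p.1) =
        {x} ×ˢ Finset.Iio x := by
      ext ⟨a, b⟩
      simp only [Finset.mem_filter, Finset.mem_univ, true_and, Finset.mem_product,
        Finset.mem_singleton, Finset.mem_Iio]
      exact and_congr_right fun e => by rw [e]
    rw [this]; simp
  · rintro S v w s' hvw hv hw ⟨hs, h⟩
    rw [Stmt.den_ifThen]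
    simp only [Test.Holds, NExp.eval, hv, hw, Nat.add_one_le_iff, Fin.val_fin_lt]
    split_ifs with hc
    · simp only [Stmt.den, NExp.eval, hv, hs]
      refine ⟨hs, fun y => ?_⟩
      rw [Store.updateNat_nat_self, h v, Finset.filter_insert]
      by_cases e : v = y
      · subst e
        simp [Finset.card_insert_of_notMem, hvw, hc, add_mul]
      · simp [h, e, Fin.val_inj, Ne.symm e]
    · refine ⟨hs, fun y => ?_⟩
      rw [h, Finset.filter_insert, if_neg (by simp [hc])]

theorem den_scaleTable (hs : Input n k d G s) (h1 : ∀ x y : Fin n, s.real 1 x y = 0)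
    (x y : Fin n) : (scaleTable.den s).real 1 x y = n * d x y := by
  have := Stmt.den_eq_forN₂ scaleTable rfl (n := n) (by decide) (by decide) (fun S s' =>
    Input n k d G s' ∧ ∀ p : Fin n × Fin n,
      s'.real 1 p.1 p.2 = if p ∈ S then n * d p.1 p.2 else 0)
    (fun S s u m hu h => by
      rcases hu with rfl | rfl <;> exact ⟨h.1.congr rfl rfl rfl, h.2⟩)
    (fun S s h => h.1.size) ?_ ⟨hs, by simpa using fun a b => h1 a b⟩
  · simpa using this.2 (x, y)
  · rintro S v w s' hvw hv hw ⟨hs, h⟩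
    have := Stmt.den_forN (n := n) (v := 22)
      (P := .setReal 1 (.var 20) (.var 21)
        (.add (.cell 1 (.var 20) (.var 21)) (.cell 0 (.var 20) (.var 21))))
      (fun T s => Input n k d G s ∧ s.nat 20 0 0 = v ∧ s.nat 21 0 0 = w ∧
        ∀ p : Fin n × Fin n, s.real 1 p.1 p.2 =
          if p = (v, w) then T.card * d v w else if p ∈ S then n * d p.1 p.2 else 0)
      (fun S s m h => ⟨h.1.congr rfl rfl rfl, h.2⟩) ?_ hs.size
      ⟨hs, hv, hw, fun p => ?_⟩
    · refine ⟨this.1, fun p => ?_⟩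
      rw [this.2.2.2 p]
      by_cases e : p = (v, w) <;> simp [e]
    · rintro T z s' hz - ⟨hs, hv, hw, h⟩
      have hvw' := h (v, w)
      simp only [if_true] at hvw'
      simp only [Stmt.den, NExp.eval, RExp.eval, hv, hw, hs.dist, hvw']
      refine ⟨hs.congr rfl rfl rfl, hv, hw, fun p => ?_⟩
      rw [Store.updateReal_real_self, Finset.card_insert_of_notMem hz]
      by_cases e : p = (v, w)
      · simp [e]; ring
      · have hne : ¬ ((p.1 : ℕ) = v ∧ (p.2 : ℕ) = w) := fun h =>
          e (Prod.ext (Fin.ext h.1) (Fin.ext h.2))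
        rw [if_neg hne, h, if_neg e, if_neg e]
    · rw [h p]
      by_cases e : p = (v, w) <;> simp [e, hvw]

/-- Arrays have two indices, while the table of balls needs three, so center and boundary point
share the row index. -/
theorem row_injective {v w v' w' : Fin n} (h : (v * n + w : ℕ) = v' * n + w') :
    v = v' ∧ w = w' := by
  have hn : 0 < n := v.pos
  have h1 := congrArg (· / n) h
  have h2 := congrArg (· % n) h
  simp only [Nat.mod_eq_of_lt, Fin.is_lt, mul_comm _ n, Nat.mul_add_div hn, Nat.div_eq_of_lt,
    add_zero, Nat.mul_add_mod] at h1 h2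
  exact ⟨Fin.ext h1, Fin.ext h2⟩

/-- The connected ball is the closure of its center under steps to close neighbours. The second part
says that filling one row leaves the others alone. -/
theorem den_fillBall {v w : Fin n} (hs : Input n k d G s)
    (h3 : ∀ x : Fin n, s.nat 3 x 0 = x * n) (hv : s.nat 20 0 0 = v) (hw : s.nat 21 0 0 = w)
    (h4 : ∀ x : Fin n, s.nat 4 (v * n + w) x = 0) :
    (∀ x : Fin n, 1 ≤ (fillBall.den s).nat 4 (v * n + w) x ↔ x ∈ connBall d G (v, w)) ∧
      ∀ q : Fin n × Fin n, q ≠ (v, w) → ∀ x : Fin n,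
        (fillBall.den s).nat 4 (q.1 * n + q.2) x = s.nat 4 (q.1 * n + q.2) x := by
  have hrow {q : Fin n × Fin n} (hq : q ≠ (v, w)) : (q.1 * n + q.2 : ℕ) ≠ v * n + w := fun h =>
    hq (Prod.ext (row_injective h).1 (row_injective h).2)
  have key := Stmt.den_saturate (n := n)
    (fun U s' => Input n k d G s' ∧ (∀ x : Fin n, s'.nat 3 x 0 = x * n) ∧
      s'.nat 20 0 0 = v ∧ s'.nat 21 0 0 = w ∧
      (∀ x : Fin n, 1 ≤ s'.nat 4 (v * n + w) x ↔ x ∈ U) ∧ (∀ x ∈ U, x ∈ connBall d G (v, w)) ∧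
      ∀ q : Fin n × Fin n, q ≠ (v, w) → ∀ x : Fin n,
        s'.nat 4 (q.1 * n + q.2) x = s.nat 4 (q.1 * n + q.2) x)
    -- A set of `n + 1` points does not exist, so the search runs until the set is closed.
    (fun x y => G.Adj x y ∧ d v y ≤ d v w) (n + 1) (a := 24) (b := 22) (c := 23) (P := ballStep)
    (fun U s u m hu h => by
      rcases hu with rfl | rfl | rfl <;> exact ⟨h.1.congr rfl rfl rfl, h.2⟩)
    (fun U s h => h.1.size) (by decide) (by decide) ?_ (U₀ := {v})
    (s := s.updateNat 4 (v * n + w) v 1)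
    ⟨hs.congr rfl rfl rfl, h3, hv, hw, fun x => ?_, fun x hx => by
      rw [Finset.mem_singleton.1 hx]; exact fst_mem_connBall (v, w), fun q hq x => ?_⟩
  · obtain ⟨U, ⟨-, -, -, -, hU, hUb, hq⟩, hvU, hcl⟩ := key
    have e : fillBall.den s = (Stmt.forN 24 (.forN 22 (.forN 23 ballStep))).den
        (s.updateNat 4 (v * n + w) v 1) := by
      rw [← h3 v, ← hw, ← hv]; rfl
    rw [← e] at hU hq
    refine ⟨fun x => (hU x).trans ⟨hUb x, fun hx => ?_⟩, hq⟩
    have hcl := hcl.resolve_left fun h => by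
      have := U.card_le_univ
      rw [Fintype.card_fin] at this
      lia
    have hx' : Relation.ReflTransGen _ _ _ := hx
    clear hx
    induction hx' with
    | refl => exact hvU (by simp)
    | tail _ hab ih => exact hcl _ ih _ hab
  · rintro U x y s' hx hy ⟨hs, h3, hv, hw, hU, hUb, hq⟩
    have hhold : (Test.and (inBall (.var 22))
        (.and (.natLe (.const 1) (.cell 1 (.var 22) (.var 23)))
        (.realLe (.cell 0 (.var 20) (.var 23)) (.cell 0 (.var 20) (.var 21))))).Holds s' ↔
        x ∈ U ∧ G.Adj x y ∧ d v y ≤ d v w := by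
      simp only [Test.Holds, NExp.eval, RExp.eval, hx, hy, hv, hw, h3, hU, hs.adj, hs.dist]
    rw [ballStep, Stmt.den_ifThen, hhold]
    split_ifs with hc
    · refine ⟨insert y U, ?_, .inr ⟨hc.1, hc.2, rfl⟩, fun _ _ => .inl (by simp)⟩
      simp only [Stmt.den, NExp.eval, hv, hw, hy, h3]
      refine ⟨hs.congr rfl rfl rfl, h3, hv, hw, fun z => ?_, fun z hz => ?_, fun q hne z => ?_⟩
      · rw [Store.updateNat_nat_self]
        by_cases e : z = y <;> simp [e, Fin.val_inj, hU]
      · rcases Finset.mem_insert.1 hz with rfl | hz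
        · exact Relation.ReflTransGen.tail (hUb x hc.1) hc.2
        · exact hUb z hz
      · rw [Store.updateNat_nat_self, if_neg fun h => hrow hne h.1, hq q hne]
    · exact ⟨U, ⟨hs, h3, hv, hw, hU, hUb, hq⟩, .inl rfl, fun h1 h2 => absurd ⟨h1, h2⟩ hc⟩
  · rw [Store.updateNat_nat_self]
    by_cases e : x = v <;> simp [e, Fin.val_inj, h4]
  · rw [Store.updateNat_nat_self, if_neg fun h => hrow hq h.1]

theorem den_ballTable (hs : Input n k d G s) (h3 : ∀ x : Fin n, s.nat 3 x 0 = x * n)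
    (h4 : ∀ v w x : Fin n, s.nat 4 (v * n + w) x = 0) (v w x : Fin n) :
    1 ≤ (ballTable.den s).nat 4 (v * n + w) x ↔ x ∈ connBall d G (v, w) := by
  have := Stmt.den_eq_forN₂ ballTable rfl (n := n) (by decide) (by decide) (fun S s' =>
    Input n k d G s' ∧ (∀ x : Fin n, s'.nat 3 x 0 = x * n) ∧ ∀ q : Fin n × Fin n,
      (q ∈ S → ∀ x : Fin n, 1 ≤ s'.nat 4 (q.1 * n + q.2) x ↔ x ∈ connBall d G q) ∧
      (q ∉ S → ∀ x : Fin n, s'.nat 4 (q.1 * n + q.2) x = 0))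
    (fun S s u m hu h => by
      rcases hu with rfl | rfl <;> exact ⟨h.1.congr rfl rfl rfl, h.2⟩)
    (fun S s h => h.1.size) ?_ ⟨hs, h3, fun q => ⟨by simp, fun _ => h4 q.1 q.2⟩⟩
  · exact (this.2.2 (v, w)).1 (Finset.mem_univ _) x
  · rintro S v w s' hvw hv hw ⟨hs, h3, h⟩
    obtain ⟨h1, h2⟩ := den_fillBall hs h3 hv hw ((h (v, w)).2 hvw)
    refine ⟨hs.den (by decide) (by decide), fun x => ?_, fun q => ?_⟩
    · rw [Stmt.den_nat_of_notMem (by decide), h3]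
    · by_cases e : q = (v, w)
      · subst e
        simpa using h1
      · simpa only [Finset.mem_insert, e, false_or, h2 q e] using h q

/-- Compute the tables. -/
def tables : Stmt := .seq mulTable (.seq scaleTable ballTable)

theorem Input.base (hs : Input n k d G s) (h3 : ∀ x : Fin n, s.nat 3 x 0 = 0)
    (h1 : ∀ x y : Fin n, s.real 1 x y = 0) (h4 : ∀ v w x : Fin n, s.nat 4 (v * n + w) x = 0) :
    Base n k d G (tables.den s) := by
  set s₁ := mulTable.den s with hs₁
  have hI₁ : Input n k d G s₁ := hs.den (by decide) (by decide)
  have e1 : s₁.real 1 = s.real 1 := Stmt.den_real_of_notMem (by decide) s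
  have e4 : s₁.nat 4 = s.nat 4 := Stmt.den_nat_of_notMem (by decide) s
  set s₂ := scaleTable.den s₁ with hs₂
  have hI₂ : Input n k d G s₂ := hI₁.den (by decide) (by decide)
  have e4' : s₂.nat 4 = s.nat 4 := by rw [← e4, hs₂, Stmt.den_nat_of_notMem (by decide)]
  have e3 : s₂.nat 3 = s₁.nat 3 := Stmt.den_nat_of_notMem (by decide) s₁
  have hm (x : Fin n) : s₂.nat 3 x 0 = x * n := by rw [e3]; exact den_mulTable hs.size h3 x
  have hI₃ : Input n k d G (ballTable.den s₂) := hI₂.den (by decide) (by decide)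
  exact
    { size := hI₃.size
      num := hI₃.num
      adj := hI₃.adj
      dist := hI₃.dist
      mul := fun x => by
        change (ballTable.den s₂).nat 3 x 0 = _
        rw [Stmt.den_nat_of_notMem (by decide), hm]
      scaled := fun x y => by
        change (ballTable.den s₂).real 1 x y = _
        rw [Stmt.den_real_of_notMem (by decide)]
        exact den_scaleTable hI₁ (by rwa [e1]) x y
      ball := den_ballTable hI₂ hm (by rwa [e4']) }

end RAM

/-! ### Diameters, and clusterings as feasible solutions. -/

namespace Clustering

open Finset

section Cost

variable {V : Type} {k : ℕ} {d : V → V → ℝ}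

theorem le_diam [Finite V] (S : Set V) {x y : V} (hx : x ∈ S) (hy : y ∈ S) : d x y ≤ diam d S :=
  le_ciSup (f := fun p : S × S => d p.1 p.2) (Set.finite_range _).bddAbove (⟨x, hx⟩, ⟨y, hy⟩)

theorem exists_eq_diam [Finite V] {S : Set V} (hS : S.Nonempty) :
    ∃ x ∈ S, ∃ y ∈ S, d x y = diam d S := by
  have := hS.to_subtype
  obtain ⟨p, hp⟩ := exists_eq_ciSup_of_finite (f := fun p : S × S => d p.1 p.2)
  exact ⟨p.1, p.1.2, p.2, p.2.2, hp⟩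

variable [Fintype V] [DecidableEq V] {G : SimpleGraph V}

/-- A clustering with numbered representatives is a feasible solution. -/
theorem IsClustering.exists_connectedFeasible {f : V → V} {M : V → ℝ} (hf : IsClustering G k f)
    (hM : IsDiamBound d f M) {idx : V → ℕ} (hlt : ∀ v, f v = v → idx v < k)
    (hinj : ∀ v w, f v = v → f w = w → idx v = idx w → v = w) :
    ∃ c : V → Fin k, (∀ x, (c x : ℕ) = idx (f x)) ∧ ConnectedFeasible G c ∧
      msdCost d c ≤ ∑ v, M v := by
  set roots := univ.filter fun v => f v = v with hroots
  have hfr (v : roots) : f v = v := (mem_filter.1 v.2).2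
  let e : roots → Fin k := fun v => ⟨idx v, hlt v (hfr v)⟩
  have he : Function.Bijective e := by
    rw [Fintype.bijective_iff_injective_and_card]
    refine ⟨fun v w h => Subtype.ext (hinj v w (hfr v) (hfr w) (congrArg Fin.val h)), ?_⟩
    rw [Fintype.card_coe, hf.card, Fintype.card_fin]
  let c : V → Fin k := fun x => ⟨idx (f x), hlt _ (hf.idem x)⟩
  have hc (v : roots) : cluster c (e v) = {x | f x = v} := by
    ext x
    refine ⟨fun h => ?_, fun h => ?_⟩
    · exact hinj _ _ (hf.idem x) (hfr v) (congrArg Fin.val (show c x = e v from h))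
    · exact Fin.ext (congrArg idx h)
  refine ⟨c, fun x => rfl, fun i => ?_, ?_⟩
  · obtain ⟨v, rfl⟩ := he.2 i
    rw [hc]
    exact hf.connected v (hfr v)
  · rw [msdCost, ← he.sum_comp]
    calc ∑ v, diam d (cluster c (e v)) ≤ ∑ v : roots, M v := by
          refine Finset.sum_le_sum fun v _ => Real.iSup_le (fun p => ?_) (hM.nonneg _)
          have h1 : (p.1 : V) ∈ {x | f x = v} := hc v ▸ p.1.2
          have h2 : (p.2 : V) ∈ {x | f x = v} := hc v ▸ p.2.2
          have h1' : f p.1 = v := h1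
          rw [← h1']
          exact hM.le _ _ (h1'.trans (Eq.symm h2))
      _ = ∑ v ∈ roots, M v := Finset.sum_coe_sort roots M
      _ ≤ ∑ v, M v := Finset.sum_le_univ_sum_of_nonneg hM.nonneg

end Cost

end Clustering

/-! ### Numbering the clusters and writing the output. -/

namespace RAM

open Clustering

variable {n k : ℕ} {d : Fin n → Fin n → ℝ} {G : SimpleGraph (Fin n)} {s : Store}

/-- Number the representatives of the best clustering. -/
def number : Stmt :=
  .seq (.setNat 15 (.const 0) (.const 0) (.const 0))
    (.forN 22 (.ifThen (.natEq (.cell 14 (.var 22) (.const 0)) (.var 22))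
      (.seq (.setNat 16 (.var 22) (.const 0) (.var 15))
        (.setNat 15 (.const 0) (.const 0) (.add (.var 15) (.const 1))))))

/-- Output the numbers of the representatives. -/
def writeOut : Stmt :=
  .forN 22 (.setNat 2 (.var 22) (.const 0) (.cell 16 (.cell 14 (.var 22) (.const 0)) (.const 0)))

theorem den_number (hs : s.nat 0 0 0 = n) {f : Fin n → Fin n} (hf : Rep (s.nat 14) f) :
    (∀ v : Fin n, f v = v →
      (number.den s).nat 16 v 0 < (Finset.univ.filter fun v => f v = v).card) ∧
    ∀ v w : Fin n, f v = v → f w = w →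
      (number.den s).nat 16 v 0 = (number.den s).nat 16 w 0 → v = w := by
  have := Stmt.den_eq_forN
    (.forN 22 (.ifThen (.natEq (.cell 14 (.var 22) (.const 0)) (.var 22))
      (.seq (.setNat 16 (.var 22) (.const 0) (.var 15))
        (.setNat 15 (.const 0) (.const 0) (.add (.var 15) (.const 1)))))) rfl (n := n)
    (fun S s => Rep (s.nat 14) f ∧ s.nat 15 0 0 = (S.filter fun v => f v = v).card ∧
      (∀ v ∈ S, f v = v → s.nat 16 v 0 < s.nat 15 0 0) ∧
      ∀ v ∈ S, ∀ w ∈ S, f v = v → f w = w → s.nat 16 v 0 = s.nat 16 w 0 → v = w)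
    (fun S s m h => h) ?_ (s := s.updateNat 15 0 0 0) hs ⟨hf, rfl, by simp, by simp⟩
  · obtain ⟨-, h1, h2, h3⟩ := this
    exact ⟨fun v hv => h1 ▸ h2 v (Finset.mem_univ v) hv,
      fun v w => h3 v (Finset.mem_univ v) w (Finset.mem_univ w)⟩
  · rintro S x s hxS hx ⟨hf, h1, h2, h3⟩
    rw [Stmt.den_ifThen]
    simp only [Test.holds_natEq, NExp.eval, hx, hf x, Fin.val_inj]
    split_ifs with hc
    · have e : (Stmt.seq (.setNat 16 (.var 22) (.const 0) (.var 15))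
          (.setNat 15 (.const 0) (.const 0) (.add (.var 15) (.const 1)))).den s =
          (s.updateNat 16 x 0 (s.nat 15 0 0)).updateNat 15 0 0 (s.nat 15 0 0 + 1) := by
        simp [Stmt.den, NExp.eval, Store.updateNat_nat_of_ne, hx]
      have e15 : ((Stmt.seq (.setNat 16 (.var 22) (.const 0) (.var 15))
          (.setNat 15 (.const 0) (.const 0) (.add (.var 15) (.const 1)))).den s).nat 15 0 0 =
          s.nat 15 0 0 + 1 := by
        rw [e, Store.updateNat_nat_self]; simp
      have e16 (y : Fin n) : ((Stmt.seq (.setNat 16 (.var 22) (.const 0) (.var 15))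
          (.setNat 15 (.const 0) (.const 0) (.add (.var 15) (.const 1)))).den s).nat 16 y 0 =
          if y = x then s.nat 15 0 0 else s.nat 16 y 0 := by
        rw [e, Store.updateNat_nat_of_ne _ (by decide), Store.updateNat_nat_self]
        simp [Fin.val_inj]
      rw [e15]
      simp only [e16]
      have hne {y : Fin n} (hy : y ∈ S) : y ≠ x := fun e => hxS (e ▸ hy)
      refine ⟨?_, ?_, fun v hv hfv => ?_, fun v hv w hw hfv hfw h => ?_⟩
      · rw [e]; exact hf
      · rw [Finset.filter_insert, if_pos hc, Finset.card_insert_of_notMem (by simp [hxS]), h1]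
      · rcases Finset.mem_insert.1 hv with rfl | hv
        · simp
        · rw [if_neg (hne hv)]
          exact (h2 v hv hfv).trans (Nat.lt_succ_self _)
      · rcases Finset.mem_insert.1 hv with e1 | hv <;> rcases Finset.mem_insert.1 hw with e2 | hw
        · exact e1.trans e2.symm
        · rw [if_pos e1, if_neg (hne hw)] at h
          exact absurd h (h2 w hw hfw).ne'
        · rw [if_pos e2, if_neg (hne hv)] at h
          exact absurd h (h2 v hv hfv).ne
        · rw [if_neg (hne hv), if_neg (hne hw)] at h
          exact h3 v hv w hw hfv hfw h
    · refine ⟨hf, by rw [Finset.filter_insert, if_neg hc, h1], fun v hv hfv => ?_,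
        fun v hv w hw hfv hfw h => ?_⟩
      · rcases Finset.mem_insert.1 hv with rfl | hv
        · exact absurd hfv hc
        · exact h2 v hv hfv
      · rcases Finset.mem_insert.1 hv with rfl | hv
        · exact absurd hfv hc
        rcases Finset.mem_insert.1 hw with rfl | hw
        · exact absurd hfw hc
        exact h3 v hv w hw hfv hfw h

theorem den_writeOut (hs : s.nat 0 0 0 = n) {f : Fin n → Fin n} (hf : Rep (s.nat 14) f)
    (v : Fin n) : (writeOut.den s).nat 2 v 0 = s.nat 16 (f v) 0 := by
  have := Stmt.den_eq_forN writeOut rfl (n := n)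
    (fun S s' => Rep (s'.nat 14) f ∧ s'.nat 16 = s.nat 16 ∧
      ∀ v ∈ S, s'.nat 2 v 0 = s.nat 16 (f v) 0)
    (fun S s m h => h) ?_ hs ⟨hf, rfl, by simp⟩
  · exact this.2.2 v (Finset.mem_univ v)
  · rintro S x s' hxS hx ⟨hf, h16, h⟩
    simp only [Stmt.den, NExp.eval, hx, hf x, h16]
    refine ⟨hf, h16, fun y hy => ?_⟩
    rw [Store.updateNat_nat_self]
    rcases Finset.mem_insert.1 hy with rfl | hy
    · simp
    · have : y ≠ x := fun e => hxS (e ▸ hy)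
      simpa [Fin.val_inj, this] using h y hy

/-- Output the best clustering. -/
def output : Stmt := .seq number writeOut

theorem den_output (hs : Base n k d G s) (hbest : BestFeasible n k d G s) {b : ℝ}
    (hb : Achieved b s) : ∃ c : Fin n → Fin k, IsOutput (output.den s) c ∧
      ConnectedFeasible G c ∧ msdCost d c ≤ s.real 7 0 0 := by
  obtain ⟨f, M, hf, hcl, hM, hle⟩ := hbest hb.1
  obtain ⟨h1, h2⟩ := den_number hs.size hf
  rw [hcl.card] at h1
  obtain ⟨c, hc, hfeas, hcost⟩ := hcl.exists_connectedFeasible hM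
    (idx := fun v => (number.den s).nat 16 v 0) h1 h2
  refine ⟨c, fun v => ?_, hfeas, hcost.trans hle⟩
  rw [hc, output, Stmt.den, den_writeOut (f := f)]
  · rw [Stmt.den_nat_of_notMem (by decide), hs.size]
  · rw [Stmt.den_nat_of_notMem (by decide)]; exact hf

end RAM

namespace RAM

open Clustering

variable {n k : ℕ} {d : Fin n → Fin n → ℝ} {G : SimpleGraph (Fin n)} {s : Store}

/-! ### The largest clusters -/

/-- There are `t` elements that dominate all others. -/
theorem exists_top {ι : Type} [Fintype ι] [DecidableEq ι] (D : ι → ℝ) (t : ℕ)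
    (ht : t ≤ Fintype.card ι) :
    ∃ I : Finset ι, I.card = t ∧ ∀ i ∈ I, ∀ j ∉ I, D j ≤ D i := by
  induction t with
  | zero => exact ⟨∅, rfl, by simp⟩
  | succ t ih =>
    obtain ⟨I, hI, hD⟩ := ih (by lia)
    have hne : (Iᶜ).Nonempty := by
      rw [← Finset.card_pos, Finset.card_compl]; lia
    obtain ⟨i, hi, hmax⟩ := Finset.exists_max_image Iᶜ D hne
    rw [Finset.mem_compl] at hi
    refine ⟨insert i I, by rw [Finset.card_insert_of_notMem hi, hI], fun x hx j hj => ?_⟩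
    rw [Finset.mem_insert, not_or] at hj
    rcases Finset.mem_insert.1 hx with rfl | hx
    · exact hmax j (Finset.mem_compl.2 hj.2)
    · exact hD x hx j hj.2

theorem exists_guesses (m : ℕ) {Γ : Finset (Fin n × Fin n)} {p : Fin n × Fin n} (hp : p ∈ Γ)
    (hcard : Γ.card ≤ m + 1) : ∃ g, g 0 = p ∧ guesses g m = Γ := by
  induction m generalizing Γ with
  | zero =>
    refine ⟨fun _ => p, rfl, ?_⟩
    have : Γ = {p} := Finset.eq_singleton_iff_unique_mem.2
      ⟨hp, fun x hx => Finset.card_le_one.1 hcard x hx p hp⟩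
    rw [this]; rfl
  | succ m ih =>
    by_cases h : ∃ x ∈ Γ, x ≠ p
    · obtain ⟨x, hx, hxp⟩ := h
      obtain ⟨g, hg, hgΓ⟩ := ih (Γ := Γ.erase x) (Finset.mem_erase.2 ⟨hxp.symm, hp⟩)
        (by rw [Finset.card_erase_of_mem hx]; lia)
      refine ⟨Function.update g (m + 1) x, by simpa using hg, ?_⟩
      have e : guesses (Function.update g (m + 1) x) m = guesses g m :=
        Finset.image_congr fun i hi => Function.update_of_ne (by simp at hi; lia) _ _
      rw [guesses_succ, e, hgΓ, Function.update_self, Finset.insert_erase hx]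
    · push Not at h
      refine ⟨fun _ => p, rfl, ?_⟩
      rw [guesses, Finset.image_const (by simp)]
      exact (Finset.eq_singleton_iff_unique_mem.2 ⟨hp, h⟩).symm

/-- The `m + 1` clusters of largest diameter are guessed, the smallest of them first, so that its
diameter `R` dominates all unguessed ones. Unguessed clusters are charged four times, guessed ones
twice, and `6 * R` is left over: `4 * R` from the slack error and `2 * R` from the ball of the
crossing. -/
theorem exists_goodGuess (hd : IsDistance d) (hk : 0 < k) {c : Fin n → Fin k}
    (hc : ConnectedFeasible G c) {ε : ℝ} (hε : 0 < ε) {m : ℕ} (hm : 6 ≤ ε * (m + 1)) :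
    ∃ g I q, GoodGuess d G c I q (guesses g m) (d (g 0).1 (g 0).2)
      ((4 + ε) * msdCost d c) := by
  have hcl (i : Fin k) : (cluster c i).Nonempty :=
    Set.nonempty_coe_sort.1 (hc i).nonempty
  choose a ha b hb hab using fun i => exists_eq_diam (d := d) (hcl i)
  set q : Fin k → Fin n × Fin n := fun i => (a i, b i) with hq
  set D : Fin k → ℝ := fun i => d (a i) (b i) with hD
  have hD0 (i : Fin k) : 0 ≤ D i := hd.nonneg _ _
  have hball (i : Fin k) : cluster c i ⊆ connBall d G (q i) :=
    subset_connBall (hc i) (ha i) fun x hx => (hab i).symm ▸ le_diam _ (ha i) hx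
  have hcost : msdCost d c = ∑ i, D i := Finset.sum_congr rfl fun i _ => (hab i).symm
  have hkn : k ≤ n := by
    have : Function.Surjective c := fun i => hcl i
    simpa using Fintype.card_le_of_surjective c this
  have hmeets (i : Fin k) : ∃ z ∈ connBall d G (q i), c z = i :=
    ⟨a i, fst_mem_connBall (q i), ha i⟩
  have hsum (I : Finset (Fin k)) : ∑ p ∈ I.image q, d p.1 p.2 ≤ ∑ i ∈ I, D i :=
    Finset.sum_image_le_of_nonneg (fun i _ => hd.nonneg _ _)
  rw [hcost]
  have hsum0 : 0 ≤ ∑ i, D i := Finset.sum_nonneg fun i _ => hD0 i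
  by_cases hmk : m + 1 ≤ k
  · obtain ⟨I, hI, hdom⟩ := exists_top D (m + 1) (by simpa using hmk)
    have hIne : I.Nonempty := by rw [← Finset.card_pos]; lia
    obtain ⟨i₀, hi₀, hmin⟩ := Finset.exists_min_image I D hIne
    obtain ⟨g, hg0, hg⟩ := exists_guesses m (Finset.mem_image_of_mem q hi₀)
      (Finset.card_image_le.trans hI.le)
    refine ⟨g, I, q, ?_⟩
    rw [hg, hg0]
    refine ⟨⟨fun p hp => ?_, fun i hi => ⟨q i, Finset.mem_image_of_mem q hi, fun z hz =>
      hball i hz⟩, fun z => hball _ rfl, fun i hi => hdom i₀ hi₀ i hi⟩, hIne, by lia, hkn, ?_⟩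
    · obtain ⟨i, hi, rfl⟩ := Finset.mem_image.1 hp
      exact ⟨i, hi, hmeets i⟩
    -- The smallest of the `m + 1` guessed diameters is at most their average.
    · have h1 : ((m : ℝ) + 1) * D i₀ ≤ ∑ i ∈ I, D i := by
        have := Finset.card_nsmul_le_sum I D (D i₀) hmin
        rw [hI, nsmul_eq_mul] at this
        exact_mod_cast this
      have h2 := Finset.sum_add_sum_compl I D
      have h3 : 0 ≤ ∑ i ∈ Iᶜ, D i := Finset.sum_nonneg fun i _ => hD0 i
      have h4 := mul_le_mul_of_nonneg_right hm (hD0 i₀)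
      have h5 := mul_le_mul_of_nonneg_left h1 hε.le
      have h6 := mul_le_mul_of_nonneg_left (le_add_of_nonneg_right h3 : ∑ i ∈ I, D i ≤ _) hε.le
      have h7 := hsum I
      have h8 : 0 ≤ ∑ i ∈ I, D i := Finset.sum_nonneg fun i _ => hD0 i
      rw [h2] at h6
      change 4 * (∑ i ∈ Iᶜ, D i + D i₀) + 2 * _ + 2 * D i₀ ≤ _
      linarith
  -- With at most `m` clusters all of them are guessed, and there is room for a ball of radius zero
  -- in the first place, which makes `R = 0`.
  · set v : Fin n := a ⟨0, hk⟩ with hv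
    obtain ⟨g, hg0, hg⟩ := exists_guesses m (Finset.mem_insert_self (v, v) (Finset.univ.image q))
      (by
        have h1 := Finset.card_insert_le (v, v) (Finset.univ.image q)
        have h2 : (Finset.univ.image q).card ≤ _ := Finset.card_image_le
        rw [Finset.card_univ, Fintype.card_fin] at h2
        lia)
    refine ⟨g, Finset.univ, q, ?_⟩
    rw [hg, hg0]
    refine ⟨⟨fun p hp => ?_, fun i hi => ⟨q i, Finset.mem_insert_of_mem
      (Finset.mem_image_of_mem q hi), fun z hz => hball i hz⟩, fun z => hball _ rfl,
      fun i hi => absurd (Finset.mem_univ i) hi⟩, ⟨⟨0, hk⟩, Finset.mem_univ _⟩, by lia, hkn, ?_⟩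
    · rcases Finset.mem_insert.1 hp with rfl | hp
      · exact ⟨_, Finset.mem_univ _, v, fst_mem_connBall (v, v), rfl⟩
      · obtain ⟨i, hi, rfl⟩ := Finset.mem_image.1 hp
        exact ⟨i, hi, hmeets i⟩
    · have h1 : ∑ p ∈ insert (v, v) (Finset.univ.image q), d p.1 p.2 ≤ ∑ i, D i := by
        rw [Finset.sum_insert_zero (f := fun p : Fin n × Fin n => d p.1 p.2) (hd.self v)]
        exact hsum _
      simp only [hd.self, Finset.compl_univ, Finset.sum_empty]
      have h2 := mul_nonneg hε.le hsum0
      linarith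

/-! ### The program -/

/-- The approximation algorithm that guesses `m + 1` balls. -/
def algorithm (m : ℕ) : Stmt := .seq tables (.seq (guessLoops m (m + 1)) output)

theorem input_input (n k : ℕ) (d : Fin n → Fin n → ℝ) (G : SimpleGraph (Fin n)) :
    Input n k d G (input n k d G) where
  size := by simp [input]
  num := by simp [input]
  adj x y := by
    simp only [input]
    split_ifs <;> simp_all
  dist x y := by simp [input]

theorem base_tables (n k : ℕ) (d : Fin n → Fin n → ℝ) (G : SimpleGraph (Fin n)) :
    Base n k d G (tables.den (input n k d G)) :=
  (input_input n k d G).base (fun x => by simp [input]) (fun x y => by simp [input])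
    (fun v w x => by simp [input])

theorem den_algorithm (hd : IsDistance d) (hk : 0 < k) {ε : ℝ} (hε : 0 < ε) {m : ℕ}
    (hm : 6 ≤ ε * (m + 1)) (h : ∃ c' : Fin n → Fin k, ConnectedFeasible G c') :
    ∃ c : Fin n → Fin k, IsOutput ((algorithm m).den (input n k d G)) c ∧
      IsApprox (ConnectedFeasible G) d (4 + ε) c := by
  have hB := base_tables n k d G
  have hbest : BestFeasible n k d G (tables.den (input n k d G)) := by
    intro h
    rw [Stmt.den_nat_of_notMem (by decide)] at h
    simp [input] at h
  -- The final cost does not depend on `c`, so it can be compared with all feasible solutions at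
  -- once.
  have hach (c : Fin n → Fin k) (hc : ConnectedFeasible G c) :
      Achieved ((4 + ε) * msdCost d c)
        ((guessLoops m (m + 1)).den (tables.den (input n k d G))) := by
    obtain ⟨g, I, q, hg⟩ := exists_goodGuess hd hk hc hε hm
    exact (den_guessLoops hd (m + 1) (g := g) hB (by lia) hbest).2.2 g (by lia) _ c I q hg
  obtain ⟨c', hc'⟩ := h
  obtain ⟨g, -⟩ := exists_goodGuess hd hk hc' hε hm
  obtain ⟨c, hout, hfeas, hle⟩ := den_output hB.guessLoops
    (den_guessLoops hd (m + 1) (g := g) hB (by lia) hbest).1 (hach c' hc')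
  exact ⟨c, hout, hfeas, fun c'' hc'' => hle.trans (hach c'' hc'').2⟩

/-- A decision procedure for well-formedness. -/
instance decidableWellFormed : (P : Stmt) → Decidable P.WellFormed
  | .setNat a _ _ _ => inferInstanceAs (Decidable (a ≠ 0))
  | .setReal _ _ _ _ => inferInstanceAs (Decidable True)
  | .seq P Q => @instDecidableAnd _ _ (decidableWellFormed P) (decidableWellFormed Q)
  | .ifThen _ P => decidableWellFormed P
  | .forN v P => @instDecidableAnd (v ≠ 0) (v ∉ P.natWrites ∧ P.WellFormed) _
      (@instDecidableAnd _ _ _ (decidableWellFormed P))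

theorem wellFormed_stage (m : ℕ) : (stage m).WellFormed :=
  ⟨by decide, wellFormed_forGuesses (by decide) m, by decide⟩

theorem wellFormed_core (m : ℕ) : (core m).WellFormed := by
  refine ⟨by decide, trivial, ⟨by decide, wellFormed_forGuesses (by decide) m⟩, by decide, ?_,
    by decide, ?_, wellFormed_stage m⟩
  · intro h
    rcases List.mem_cons.1 h with h | h
    · exact absurd h (by decide)
    · exact (stage_natWrites m _ h).1 (by decide)
  · exact fun h => (stage_natWrites m _ h).1 (by decide)

theorem wellFormed_guessLoops (m j : ℕ) : (guessLoops m j).WellFormed := by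
  induction j with
  | zero => exact wellFormed_core m
  | succ j ih =>
    refine ⟨by lia, fun h => ?_, by lia, fun h => ?_, ih⟩
    · rcases List.mem_cons.1 h with h | h
      · lia
      · have := (guessLoops_natWrites m j _ h).2; lia
    · have := (guessLoops_natWrites m j _ h).2; lia

theorem wellFormed_algorithm (m : ℕ) : (algorithm m).WellFormed :=
  ⟨by decide, wellFormed_guessLoops m (m + 1), by decide⟩

end RAM

/-- In the complete graph every nonempty set is connected, which reduces the regular problem to the
connected one. -/
theorem Clustering.connectedFeasible_top {V : Type} {k : ℕ} {c : V → Fin k} :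
    ConnectedFeasible ⊤ c ↔ Feasible c := by
  refine forall_congr' fun i => ⟨fun h => Set.nonempty_coe_sort.1 h.nonempty, fun h => ?_⟩
  have := h.to_subtype
  have e : (⊤ : SimpleGraph V).induce (cluster c i) = ⊤ :=
    SimpleGraph.comap_top Subtype.val_injective
  rw [e]
  exact SimpleGraph.connected_top

theorem mainTheorem3 (ε : ℝ) (hε : 0 < ε) :
    ∃ (P : RAM.Program) (p : Polynomial ℕ),
      -- connected min-sum-diameter
      (∀ (n k : ℕ) (d : Fin n → Fin n → ℝ) (G : SimpleGraph (Fin n)),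
        Clustering.IsDistance d → 2 ≤ k →
        ∃ (s : RAM.Store) (t : ℕ), RAM.Exec P (RAM.input n k d G) s t ∧ t ≤ p.eval n ∧
          ((∃ c' : Fin n → Fin k, Clustering.ConnectedFeasible G c') →
            ∃ c : Fin n → Fin k, RAM.IsOutput s c ∧
              Clustering.IsApprox (Clustering.ConnectedFeasible G) d (4 + ε) c)) ∧
      -- regular min-sum-diameter: no connectivity constraint, the complete graph as input
      (∀ (n k : ℕ) (d : Fin n → Fin n → ℝ),
        Clustering.IsDistance d → 2 ≤ k →
        ∃ (s : RAM.Store) (t : ℕ), RAM.Exec P (RAM.input n k d ⊤) s t ∧ t ≤ p.eval n ∧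
          ((∃ c' : Fin n → Fin k, Clustering.Feasible c') →
            ∃ c : Fin n → Fin k, RAM.IsOutput s c ∧
              Clustering.IsApprox Clustering.Feasible d (4 + ε) c)) := by
  -- The number of guesses depends on `ε` only, so the guesses contribute a fixed number of nested
  -- loops and the running time stays polynomial in `n`.
  obtain ⟨m, hm⟩ := exists_nat_ge (6 / ε)
  have hm' : 6 ≤ ε * (m + 1) := by
    rw [div_le_iff₀ hε] at hm
    nlinarith
  have main (n k : ℕ) (d : Fin n → Fin n → ℝ) (G : SimpleGraph (Fin n))
      (hd : Clustering.IsDistance d) (hk : 2 ≤ k) :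
      ∃ (s : RAM.Store) (t : ℕ),
        RAM.Exec (RAM.algorithm m).toProgram (RAM.input n k d G) s t ∧
          t ≤ (RAM.algorithm m).time.eval n ∧
          ((∃ c' : Fin n → Fin k, Clustering.ConnectedFeasible G c') →
            ∃ c : Fin n → Fin k, RAM.IsOutput s c ∧
              Clustering.IsApprox (Clustering.ConnectedFeasible G) d (4 + ε) c) := by
    obtain ⟨t, ht, hle⟩ :=
      RAM.Stmt.exec_toProgram (RAM.wellFormed_algorithm m) (RAM.input n k d G)
    rw [(RAM.input_input n k d G).size] at hle
    exact ⟨_, t, ht, hle, RAM.den_algorithm hd (by lia) hε hm'⟩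
  refine ⟨(RAM.algorithm m).toProgram, (RAM.algorithm m).time, main, fun n k d hd hk => ?_⟩
  have e : Clustering.Feasible = Clustering.ConnectedFeasible (k := k) (⊤ : SimpleGraph (Fin n)) :=
    funext fun _ => propext Clustering.connectedFeasible_top.symm
  rw [e]
  exact main n k d ⊤ hd hk
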